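/- An assignment problem of size $n$ consists of agents $1,\dots,n$, items $o_1,\dots,o_n$ and real utilities $u_{ij}$ such that every item has positive utility for some agent and every agent has positive utility for some item. Utilities are bi-valued if for every agent $i$ there are $\alpha_i>\beta_i\ge 0$ with $u_{ij}\in\{\alpha_i,\beta_i\}$ for all $j$. Let $D_i=\{o_j : u_{ij}=\max_k u_{ik}\}$; these sets are the underlying dichotomous preferences. A balanced allocation is a vector $y\in[0,1]^n$ with $\sum_j y_j=1$; a balanced assignment is a matrix $x\in[0,1]^{n\times n}$ all of whose row and column sums are $1$. Put $u_i(y)=\sum_j y_ju_{ij}$. A balanced assignment $x$ is an HZ (Hylland--Zeckhauser) solution if there are prices $p\in\mathbb{R}_{\ge 0}^n$ such that for every agent $i$: (a) $\sum_j p_jx_{ij}\le 1$, and $u_i(y)\le u_i(x_i)$ for every balanced allocation $y$ with $\sum_j p_jy_j\le 1$; (b) $\sum_j p_jx_{ij}\le\sum_j p_jy_j$ for every balanced allocation $y$ with $u_i(y)\ge u_i(x_i)$. The EPS (Extended Probabilistic Serial) procedure for dichotomous preferences $(D_i)$ starts with $N'$ the set of all agents and $O'$ the set of all items. While $N'\ne\emptyset$: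 if it is possible to give each $i\in N'$ one unit of items of $D_i\cap O'$ simultaneously (fractionally, at most one unit of each item), this is done and the loop ends. Otherwise let $v=\min_{\emptyset\ne C\subseteq N'}|\bigcup_{i\in C}(D_i\cap O')|/|C|$, let $X$ be the largest set attaining the minimum, and let $O_X=\bigcup_{i\in X}(D_i\cap O')$; each $i\in X$ gets the amount $v$ of items of $D_i\cap O_X$, and $X$ is removed from $N'$ and $O_X$ from $O'$. After the loop, whatever is left of the items in $O'$ is distributed to the agents who have less than one unit, so that the assignment becomes balanced. An EPS outcome is any assignment that can result from this procedure. Computation is on a uniform-cost random access machine: programs with integer variables and arrays, assignments, conditionals and loops, where addition, truncated subtraction, halving, comparison and array access on natural numbers cost one step each; the utilities are a read-only input of real numbers of which the program can only compare two at a time, at the cost of one step; the program also knows $n$. It outputs a matrix of fractions (numerators and nonzero denominators). Corollary. (1) For every assignment problem with bi-valued utilities, every EPS outcome for the underlying dichotomous preferences $(D_i)$ is an HZ solution. (2) There are a program and a function $T:\mathbb{N}\to\mathbb{N}$ with $T(n)=O(n^3\log n)$ such that, on every assignment problem of any size $n$ with bi-valued utilities, the program halts after at most $T(n)$ steps and outputs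 an EPS outcome for $(D_i)$; in particular its output is an HZ solution. -/

import Mathlib

open scoped BigOperators

/-! ### Assignment problems and HZ solutions -/

/-- An assignment problem with agents `Fin n` and items `Fin n`; `u i j` is the utility of
agent `i` for item `j`. Every item is valued by some agent, every agent values some item. -/
structure AssignmentProblem (n : ℕ) where
  u : Fin n → Fin n → ℝ
  item_valued : ∀ j, ∃ i, 0 < u i j
  agent_values : ∀ i, ∃ j, 0 < u i j

/-- A balanced allocation (of one agent): shares in `[0,1]` of total size `1`. -/
def IsBalancedAllocation {n : ℕ} (y : Fin n → ℝ) : Prop :=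
  (∀ j, y j ∈ Set.Icc (0 : ℝ) 1) ∧ ∑ j, y j = 1

/-- A balanced fractional assignment: entries in `[0,1]`, every item is fully allocated,
and every agent gets exactly one unit. -/
def IsBalancedAssignment {n : ℕ} (x : Fin n → Fin n → ℝ) : Prop :=
  (∀ i j, x i j ∈ Set.Icc (0 : ℝ) 1) ∧ (∀ j, ∑ i, x i j = 1) ∧ (∀ i, ∑ j, x i j = 1)

namespace AssignmentProblem

variable {n : ℕ}

/-- Expected utility of agent `i` from the allocation `y`. -/
noncomputable def utility (P : AssignmentProblem n) (i : Fin n) (y : Fin n → ℝ) : ℝ :=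
  ∑ j, y j * P.u i j

/-- Bi-valued utilities: `u i j ∈ {α i, β i}` with `α i > β i ≥ 0`. -/
def IsBivalued (P : AssignmentProblem n) : Prop :=
  ∀ i, ∃ α β : ℝ, β < α ∧ 0 ≤ β ∧ ∀ j, P.u i j = α ∨ P.u i j = β

open Classical in
/-- The set of items most preferred by agent `i`. These sets are the underlying dichotomous
preferences when the utilities are bi-valued. -/
noncomputable def favorites (P : AssignmentProblem n) (i : Fin n) : Finset (Fin n) :=
  Finset.univ.filter fun j => ∀ k, P.u i k ≤ P.u i j

/-- The cost of an allocation at given prices. -/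
noncomputable def cost (p : Fin n → ℝ) (y : Fin n → ℝ) : ℝ := ∑ j, p j * y j

/-- `x` is a Hylland–Zeckhauser solution: it is a balanced assignment, and for some nonnegative
prices every agent gets a utility-maximal balanced allocation subject to budget `1`, and one
that is cheapest among the balanced allocations that are at least as good for her. -/
def IsHZSolution (P : AssignmentProblem n) (x : Fin n → Fin n → ℝ) : Prop :=
  IsBalancedAssignment x ∧
  ∃ p : Fin n → ℝ, (∀ j, 0 ≤ p j) ∧ ∀ i,
    (cost p (x i) ≤ 1 ∧
      ∀ y, IsBalancedAllocation y → cost p y ≤ 1 → P.utility i y ≤ P.utility i (x i)) ∧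
    (∀ y, IsBalancedAllocation y → P.utility i (x i) ≤ P.utility i y →
      cost p (x i) ≤ cost p y)

end AssignmentProblem

/-! ### The Extended Probabilistic Serial (EPS) procedure for dichotomous preferences

`D i` is the set of items that agent `i` likes. -/

namespace EPS

variable {n : ℕ}

/-- The items in `O` liked by some agent in `C`. -/
def liked (D : Fin n → Finset (Fin n)) (O C : Finset (Fin n)) : Finset (Fin n) :=
  C.biUnion fun i => D i ∩ O

/-- The amount of liked items of `O` per agent of `C`. -/
noncomputable def ratio (D : Fin n → Finset (Fin n)) (O C : Finset (Fin n)) : ℝ :=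
  ((liked D O C).card : ℝ) / (C.card : ℝ)

/-- `X` is a largest-cardinality set among the nonempty sets of agents `C ⊆ N` that
minimise `ratio D O C`. -/
def IsBottleneck (D : Fin n → Finset (Fin n)) (N O X : Finset (Fin n)) : Prop :=
  X ⊆ N ∧ X.Nonempty ∧
  (∀ C ⊆ N, C.Nonempty → ratio D O X ≤ ratio D O C) ∧
  (∀ C ⊆ N, C.Nonempty → ratio D O C = ratio D O X → C.card ≤ X.card)

/-- `y` gives every agent of `X` exactly the amount `v` of items she likes, using at most one
unit of each item of `O`; nobody outside `X` and no item outside `O` is involved. -/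
def Gives (D : Fin n → Finset (Fin n)) (X O : Finset (Fin n)) (v : ℝ)
    (y : Fin n → Fin n → ℝ) : Prop :=
  (∀ i j, 0 ≤ y i j) ∧
  (∀ i j, y i j ≠ 0 → i ∈ X ∧ j ∈ D i ∩ O) ∧
  (∀ i ∈ X, ∑ j, y i j = v) ∧
  (∀ j, ∑ i, y i j ≤ 1)

/-- A state of the main loop: remaining agents, remaining items, partial assignment. -/
structure State (n : ℕ) where
  agents : Finset (Fin n)
  items : Finset (Fin n)
  alloc : Fin n → Fin n → ℝ

/-- One pass through the main loop. If every remaining agent can get one unit of remaining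
items she likes, this is done and the loop ends. Otherwise the bottleneck set `X` is served at
the rate given by its ratio and removed together with the items it likes. -/
inductive Step (D : Fin n → Finset (Fin n)) : State n → State n → Prop
  | unit (s : State n) (y : Fin n → Fin n → ℝ) (hs : s.agents.Nonempty)
      (hy : Gives D s.agents s.items 1 y) :
      Step D s ⟨∅, s.items, s.alloc + y⟩
  | bottleneck (s : State n) (X : Finset (Fin n)) (y : Fin n → Fin n → ℝ)
      (hs : s.agents.Nonempty)
      (hno : ¬ ∃ z, Gives D s.agents s.items 1 z)
      (hX : IsBottleneck D s.agents s.items X)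
      (hy : Gives D X (liked D s.items X) (ratio D s.items X) y) :
      Step D s ⟨s.agents \ X, s.items \ liked D s.items X, s.alloc + y⟩

/-- `x` is an outcome of EPS: run the main loop from all agents and all items until no agent
remains, then distribute what is left (`z`) of the remaining items among the agents who have
less than one unit, so that the assignment becomes balanced. -/
def IsOutcome (D : Fin n → Finset (Fin n)) (x : Fin n → Fin n → ℝ) : Prop :=
  ∃ s : State n,
    Relation.ReflTransGen (Step D) ⟨Finset.univ, Finset.univ, 0⟩ s ∧ s.agents = ∅ ∧
    ∃ z : Fin n → Fin n → ℝ,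
      (∀ i j, 0 ≤ z i j) ∧
      (∀ i j, z i j ≠ 0 → ∑ k, s.alloc i k < 1 ∧ j ∈ s.items) ∧
      x = s.alloc + z ∧ IsBalancedAssignment x

end EPS

/-! ### A random access machine with a step count

Programs are written in a structured language over finitely many integer variables and
integer arrays. The arithmetic is addition, truncated subtraction and halving (no
multiplication), at unit cost. The real utilities form a read-only input that can be accessed
only by comparing two of its entries, at unit cost. -/

namespace RAM

/-- Expressions with natural number values; `size` is the number `n` of agents and `get a i`
is the entry with index `i` of the array number `a`. -/
inductive Exp
  | const (k : ℕ)
  | size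
  | var (v : ℕ)
  | get (a : ℕ) (i : Exp)
  | add (e f : Exp)
  | sub (e f : Exp)
  | half (e : Exp)

/-- Tests; `utilLt i j k l` asks whether `u i j < u k l`. -/
inductive Test
  | lt (e f : Exp)
  | utilLt (i j k l : Exp)

/-- Programs. -/
inductive Cmd
  | skip
  | assign (v : ℕ) (e : Exp)
  | store (a : ℕ) (i e : Exp)
  | seq (c d : Cmd)
  | ite (t : Test) (c d : Cmd)
  | loop (t : Test) (c : Cmd)

/-- The contents of the variables and of the arrays. -/
structure Store where
  var : ℕ → ℕ
  arr : ℕ → ℕ → ℕ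

/-- The initial store: everything is `0`. -/
def Store.init : Store := ⟨fun _ => 0, fun _ _ => 0⟩

/-- The value of an expression for input size `n`. -/
def Exp.eval (n : ℕ) (s : Store) : Exp → ℕ
  | const k => k
  | size => n
  | var v => s.var v
  | get a i => s.arr a (i.eval n s)
  | add e f => e.eval n s + f.eval n s
  | sub e f => e.eval n s - f.eval n s
  | half e => e.eval n s / 2

/-- The number of operations performed to evaluate an expression. -/
def Exp.cost : Exp → ℕ
  | const _ => 1
  | size => 1
  | var _ => 1
  | get _ i => i.cost + 1
  | add e f => e.cost + f.cost + 1
  | sub e f => e.cost + f.cost + 1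
  | half e => e.cost + 1

/-- The truth value of a test on input `u`; a comparison with an index out of range fails. -/
def Test.Holds {n : ℕ} (u : Fin n → Fin n → ℝ) (s : Store) : Test → Prop
  | lt e f => e.eval n s < f.eval n s
  | utilLt i j k l => ∃ i' j' k' l' : Fin n,
      i.eval n s = i' ∧ j.eval n s = j' ∧ k.eval n s = k' ∧ l.eval n s = l' ∧ u i' j' < u k' l'

/-- The number of operations performed to evaluate a test. -/
def Test.cost : Test → ℕ
  | lt e f => e.cost + f.cost + 1
  | utilLt i j k l => i.cost + j.cost + k.cost + l.cost + 1

/-- `Run u c s t s'`: on input `u`, the program `c` started in `s` halts after `t` steps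
in `s'`. -/
inductive Run {n : ℕ} (u : Fin n → Fin n → ℝ) : Cmd → Store → ℕ → Store → Prop
  | skip (s : Store) : Run u .skip s 1 s
  | assign (v : ℕ) (e : Exp) (s : Store) :
      Run u (.assign v e) s (e.cost + 1)
        ⟨Function.update s.var v (e.eval n s), s.arr⟩
  | store (a : ℕ) (i e : Exp) (s : Store) :
      Run u (.store a i e) s (i.cost + e.cost + 1)
        ⟨s.var, Function.update s.arr a
          (Function.update (s.arr a) (i.eval n s) (e.eval n s))⟩
  | seq {c d : Cmd} {s s' s'' : Store} {t t' : ℕ} :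
      Run u c s t s' → Run u d s' t' s'' → Run u (.seq c d) s (t + t') s''
  | iteTrue {b : Test} {c d : Cmd} {s s' : Store} {t : ℕ} :
      b.Holds u s → Run u c s t s' → Run u (.ite b c d) s (b.cost + 1 + t) s'
  | iteFalse {b : Test} {c d : Cmd} {s s' : Store} {t : ℕ} :
      ¬ b.Holds u s → Run u d s t s' → Run u (.ite b c d) s (b.cost + 1 + t) s'
  | loopTrue {b : Test} {c : Cmd} {s s' s'' : Store} {t t' : ℕ} :
      b.Holds u s → Run u c s t s' → Run u (.loop b c) s' t' s'' →
      Run u (.loop b c) s (b.cost + 1 + t + t') s''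
  | loopFalse {b : Test} {c : Cmd} {s : Store} :
      ¬ b.Holds u s → Run u (.loop b c) s (b.cost + 1) s

/-- The `n × n` matrix `x` is the output in the store `s`: its entries are fractions, row by
row, with numerators in array `0` and nonzero denominators in array `1`. -/
def Outputs {n : ℕ} (s : Store) (x : Fin n → Fin n → ℝ) : Prop :=
  ∀ i j : Fin n,
    s.arr 1 (i * n + j) ≠ 0 ∧
    x i j = (s.arr 0 (i * n + j) : ℝ) / (s.arr 1 (i * n + j) : ℝ)

end RAM

/-! ### Equilibrium prices along a run of EPS. -/

namespace EPS

variable {n : ℕ}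

/-! Prices. When EPS serves a bottleneck set of ratio v, the items removed with it are priced 1/v;
items that are never removed cost 0. Since the set served is the largest minimiser, ratios increase
strictly from one bottleneck to the next (`IsBottleneck.ratio_lt`), so later items are cheaper. A
member of a bottleneck set of ratio v thus finds no favourite below price 1/v, and she spends her
budget of 1 exactly on v units of favourites at that price; what she gets in the final distribution
is free. For bi-valued utilities the utility of a balanced allocation is an increasing affine
function of its amount of favourites, so nothing better is affordable and nothing as good is
cheaper. An agent with a full unit of free favourites is satisfied trivially. The invariant is
`Prices`, and `IsBivalued.isHZSolution_of_isOutcome` draws the conclusion.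

Locating the ratios. All ratios are bisected simultaneously. At scale m, label a of an agent stands
for a ratio in the bracket from 2a/m to 2(a+1)/m. The lower bounds are certified by an integral
flow, the upper bounds by counting, for a set S of agents with the same label, the items of that
label that nobody else with the label can use (`Bracketing`). One level doubles the flow, opens one
more unit of demand for every agent, which is the midpoint of her bracket, and searches for
augmenting paths inside the blocks of equal label. A failed search marks what it has visited: these
items are full and only visited agents use them, so no later path passes through and later searches
may skip them. Marked agents belong to the lower half of the bracket, the others to the upper half
(`Bracketing.step`). A level consists of n searches in a matrix with O(n²) entries. After O(log n)
levels the brackets have width at most 1/n²; the ratios are fractions with denominators at most n,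
and integrality shows that the labels below the top are the bottleneck sets of EPS in order
(`Bracketing.blocks`, `Blocks.isBottleneck`), while all labels standing for a ratio of at least 1
are merged into the block of full units.

Exact shares. In a block of q agents and p items everybody needs p/q, that is, an integral flow with
demand p per agent and capacity q per item. The bits of q are read from the top: for a prefix κ
every item has capacity κ and every agent owns ⌊κp/q⌋ units, the remainder being stored. Appending a
bit doubles the flow and leaves a remainder below 3q, so two more passes with unit demands suffice
(`nextBit_spec`); Hall's condition in `Blocks` guarantees that none of these searches fails
(`Blocks.not_marked`). This is again O(log n) passes. The unused items of the top block are finally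
distributed in proportion to what the agents lack (`Blocks.isOutcome`). -/

lemma mem_liked {D : Fin n → Finset (Fin n)} {O C : Finset (Fin n)} {j : Fin n} :
    j ∈ liked D O C ↔ ∃ i ∈ C, j ∈ D i ∧ j ∈ O := by
  simp [liked]

lemma liked_subset (D : Fin n → Finset (Fin n)) (O C : Finset (Fin n)) : liked D O C ⊆ O := by
  intro j hj
  obtain ⟨i, -, -, h⟩ := mem_liked.1 hj
  exact h

/-- After a bottleneck set has been removed, all remaining sets have a larger ratio. -/
lemma IsBottleneck.ratio_lt {D : Fin n → Finset (Fin n)} {N O X C : Finset (Fin n)}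
    (hX : IsBottleneck D N O X) (hC : C ⊆ N \ X) (hne : C.Nonempty) :
    ratio D O X < ratio D (O \ liked D O X) C := by
  obtain ⟨hXN, hXne, hmin, hmax⟩ := hX
  -- Otherwise `X ∪ C` would be another minimiser, larger than `X`: what it likes is what `X` likes
  -- together with what `C` likes of the rest.
  by_contra hle
  push Not at hle
  have hdis : Disjoint X C := by
    rw [Finset.disjoint_left]
    intro i h1 h2
    exact (Finset.mem_sdiff.1 (hC h2)).2 h1
  have hcard : (X ∪ C).card = X.card + C.card := Finset.card_union_of_disjoint hdis
  have hsub : X ∪ C ⊆ N := Finset.union_subset hXN (hC.trans Finset.sdiff_subset)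
  have hlk : (liked D O (X ∪ C)).card
      ≤ (liked D O X).card + (liked D (O \ liked D O X) C).card := by
    refine le_trans (Finset.card_le_card ?_) (Finset.card_union_le _ _)
    intro j hj
    obtain ⟨i, hi, h1, h2⟩ := mem_liked.1 hj
    by_cases hjX : j ∈ liked D O X
    · exact Finset.mem_union_left _ hjX
    · refine Finset.mem_union_right _ (mem_liked.2 ⟨i, ?_, h1, Finset.mem_sdiff.2 ⟨h2, hjX⟩⟩)
      rcases Finset.mem_union.1 hi with h | h
      · exact absurd (mem_liked.2 ⟨i, h, h1, h2⟩) hjX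
      · exact h
  have hx : (0 : ℝ) < X.card := by exact_mod_cast hXne.card_pos
  have hc : (0 : ℝ) < C.card := by exact_mod_cast hne.card_pos
  have hune : (X ∪ C).Nonempty := hXne.mono Finset.subset_union_left
  have h1 := hmin _ hsub hune
  have h2 : ratio D O (X ∪ C) ≤ ratio D O X := by
    have e1 : ((liked D O X).card : ℝ) = ratio D O X * X.card := by
      rw [ratio, div_mul_cancel₀ _ hx.ne']
    have e2 : ((liked D (O \ liked D O X) C).card : ℝ) ≤ ratio D O X * C.card := by
      rw [ratio, div_le_iff₀ hc] at hle
      exact hle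
    rw [ratio, hcard, div_le_iff₀ (by push_cast; linarith)]
    have : ((liked D O (X ∪ C)).card : ℝ)
      ≤ (liked D O X).card + (liked D (O \ liked D O X) C).card := by exact_mod_cast hlk
    push_cast
    nlinarith
  have h3 := hmax _ hsub hune (le_antisymm h2 h1)
  have := hne.card_pos
  omega

/-- Agent `i` has been served: either as a member of a bottleneck set of ratio `v`, with prices
at least `1 / v` on all items she likes, or with a full unit of free items she likes. -/
def Served (D : Fin n → Finset (Fin n)) (p : Fin n → ℝ) (s : State n) (i : Fin n) : Prop :=
  (∃ v, 0 < v ∧ (∀ j ∈ D i, j ∉ s.items ∧ 1 ≤ v * p j) ∧ ∑ j, s.alloc i j = v ∧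
    ∀ j, s.alloc i j ≠ 0 → j ∈ D i ∧ v * p j = 1) ∨
  (s.agents = ∅ ∧ ∑ j, s.alloc i j = 1 ∧ ∀ j, s.alloc i j ≠ 0 → j ∈ D i ∧ p j = 0)

/-- Equilibrium prices for a state of the main loop, `v` being the last ratio. -/
def Prices (D : Fin n → Finset (Fin n)) (s : State n) (p : Fin n → ℝ) (v : ℝ) : Prop :=
  (∀ j, 0 ≤ p j) ∧ (∀ j ∈ s.items, p j = 0) ∧ (∀ j ∉ s.items, 1 ≤ v * p j) ∧ 0 ≤ v ∧
  (∀ C ⊆ s.agents, C.Nonempty → v < ratio D s.items C) ∧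
  (∀ i ∈ s.agents, s.alloc i = 0) ∧ ∀ i ∉ s.agents, Served D p s i

/-- In a bottleneck step the removed items get the price `1 / v'`, where `v'` is the new ratio.
Because `v < v'`, the bound `1 ≤ v * p j` on items removed earlier implies `1 ≤ v' * p j`, which
covers those favourites of the new agents that are already gone. Agents served before like no item
that is still present, so the change of prices does not concern them. A unit step changes no price.
-/
lemma Step.exists_prices {D : Fin n → Finset (Fin n)} {s t : State n} (h : Step D s t)
    (hs : ∃ p v, Prices D s p v) : ∃ p v, Prices D t p v := by
  classical
  obtain ⟨p, v, hp0, hpO, hpv, hv, hrat, hall, hserv⟩ := hs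
  cases h with
  | unit y hne hy =>
    obtain ⟨hy0, hysupp, hyrow, -⟩ := hy
    refine ⟨p, v, hp0, hpO, hpv, hv, ?_, ?_, ?_⟩
    · intro C hC hCne
      exact absurd (Finset.subset_empty.1 hC) hCne.ne_empty
    · intro i hi
      exact absurd hi (Finset.notMem_empty _)
    · intro i _
      by_cases hi : i ∈ s.agents
      · right
        have ha : ∀ j, (s.alloc + y) i j = y i j := by
          intro j
          simp [hall i hi]
        refine ⟨rfl, ?_, ?_⟩
        · simp only [ha]
          exact hyrow i hi
        · intro j hj
          simp only [ha] at hj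
          have := hysupp i j hj
          rw [Finset.mem_inter] at this
          exact ⟨this.2.1, hpO j this.2.2⟩
      · have ha : ∀ j, (s.alloc + y) i j = s.alloc i j := by
          intro j
          have : y i j = 0 := by
            by_contra h0
            exact hi (hysupp i j h0).1
          simp [this]
        rcases hserv i hi with ⟨w, h1, h2, h3, h4⟩ | ⟨h1, -⟩
        · left
          refine ⟨w, h1, h2, ?_, ?_⟩
          · simp only [ha]; exact h3
          · simp only [ha]; exact h4
        · exact absurd h1 hne.ne_empty
  | bottleneck X y hne hno hX hy =>
    obtain ⟨hy0, hysupp, hyrow, -⟩ := hy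
    have hvv : v < ratio D s.items X := hrat X hX.1 hX.2.1
    set v' := ratio D s.items X with hv'
    have hvpos : 0 < v' := hv.trans_lt hvv
    have hmul : v' * (1 / v') = 1 := by field_simp
    refine ⟨fun j => if j ∈ liked D s.items X then 1 / v' else p j, v', ?_, ?_, ?_, hvpos.le,
      ?_, ?_, ?_⟩
    · intro j
      dsimp only
      split_ifs
      · positivity
      · exact hp0 j
    · intro j hj
      have := Finset.mem_sdiff.1 hj
      simp only [this.2, if_false]
      exact hpO j this.1
    · intro j hj
      dsimp only
      split_ifs with hl
      · exact hmul.ge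
      · have : j ∉ s.items := fun h' => hj (Finset.mem_sdiff.2 ⟨h', hl⟩)
        have h1 := hpv j this
        have h2 := hp0 j
        nlinarith
    · intro C hC hCne
      exact hX.ratio_lt hC hCne
    · intro i hi
      have := Finset.mem_sdiff.1 hi
      funext j
      have hz : y i j = 0 := by
        by_contra h0
        exact this.2 (hysupp i j h0).1
      simp [hall i this.1, hz]
    · intro i hi
      by_cases hiX : i ∈ X
      · left
        have ha : ∀ j, (s.alloc + y) i j = y i j := by
          intro j
          simp [hall i (hX.1 hiX)]
        refine ⟨v', hvpos, ?_, ?_, ?_⟩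
        · intro j hj
          by_cases hjO : j ∈ s.items
          · have hl : j ∈ liked D s.items X := mem_liked.2 ⟨i, hiX, hj, hjO⟩
            refine ⟨fun h' => (Finset.mem_sdiff.1 h').2 hl, ?_⟩
            simp only [hl, if_true]
            exact hmul.ge
          · have hl : j ∉ liked D s.items X := fun h' => hjO (liked_subset _ _ _ h')
            refine ⟨fun h' => hjO (Finset.mem_sdiff.1 h').1, ?_⟩
            simp only [hl, if_false]
            have h1 := hpv j hjO
            have h2 := hp0 j
            nlinarith
        · simp only [ha]
          exact hyrow i hiX
        · intro j hj
          simp only [ha] at hj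
          have := hysupp i j hj
          rw [Finset.mem_inter] at this
          refine ⟨this.2.1, ?_⟩
          simp only [this.2.2, if_true]
          exact hmul
      · have hiN : i ∉ s.agents := fun h' => hi (Finset.mem_sdiff.2 ⟨h', hiX⟩)
        have ha : ∀ j, (s.alloc + y) i j = s.alloc i j := by
          intro j
          have : y i j = 0 := by
            by_contra h0
            exact hiX (hysupp i j h0).1
          simp [this]
        rcases hserv i hiN with ⟨w, h1, h2, h3, h4⟩ | ⟨h1, -⟩
        · left
          have hnl : ∀ j ∈ D i, j ∉ liked D s.items X :=
            fun j hj h' => (h2 j hj).1 (liked_subset _ _ _ h')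
          refine ⟨w, h1, ?_, ?_, ?_⟩
          · intro j hj
            refine ⟨fun h' => (h2 j hj).1 (Finset.mem_sdiff.1 h').1, ?_⟩
            simp only [hnl j hj, if_false]
            exact (h2 j hj).2
          · simp only [ha]; exact h3
          · intro j hj
            simp only [ha] at hj
            have := h4 j hj
            refine ⟨this.1, ?_⟩
            simp only [hnl j this.1, if_false]
            exact this.2
        · exact absurd h1 hne.ne_empty

lemma exists_prices_of_reflTransGen {D : Fin n → Finset (Fin n)} (hD : ∀ i, (D i).Nonempty)
    {s : State n} (h : Relation.ReflTransGen (Step D) ⟨Finset.univ, Finset.univ, 0⟩ s) :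
    ∃ p v, Prices D s p v := by
  induction h with
  | refl =>
    -- No item has been removed, so `v = 0` is admissible; it lies strictly below all ratios because
    -- every agent likes some item.
    refine ⟨0, 0, by simp, by simp, by simp, le_rfl, ?_, by simp, by simp⟩
    intro C _ hne
    have h1 : (0 : ℝ) < C.card := by exact_mod_cast hne.card_pos
    have h2 : 0 < (liked D Finset.univ C).card := by
      obtain ⟨i, hi⟩ := hne
      obtain ⟨j, hj⟩ := hD i
      exact Finset.card_pos.2 ⟨j, mem_liked.2 ⟨i, hi, hj, Finset.mem_univ _⟩⟩
    have h3 : (0 : ℝ) < (liked D Finset.univ C).card := by exact_mod_cast h2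
    exact div_pos h3 h1
  | tail _ hst ih => exact hst.exists_prices ih

end EPS

/-! ### EPS outcomes are HZ solutions. -/

namespace AssignmentProblem

variable {n : ℕ}

lemma favorites_nonempty (P : AssignmentProblem n) (i : Fin n) : (P.favorites i).Nonempty := by
  obtain ⟨j, -, hj⟩ := Finset.exists_max_image Finset.univ (P.u i) ⟨i, Finset.mem_univ _⟩
  exact ⟨j, by simpa [favorites] using hj⟩

lemma IsBivalued.exists_eq {P : AssignmentProblem n} (hP : P.IsBivalued) (i : Fin n) :
    ∃ b δ : ℝ, 0 < δ ∧ ∀ j, P.u i j = b + if j ∈ P.favorites i then δ else 0 := by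
  obtain ⟨α, β, hab, -, hu⟩ := hP i
  by_cases hα : ∃ k, P.u i k = α
  · obtain ⟨k, hk⟩ := hα
    refine ⟨β, α - β, by linarith, fun j => ?_⟩
    rcases hu j with h | h
    · have : j ∈ P.favorites i := by
        simp only [favorites, Finset.mem_filter, Finset.mem_univ, true_and]
        intro l
        rcases hu l with h' | h' <;> rw [h, h']
        exact hab.le
      simp [this, h]
    · have : j ∉ P.favorites i := by
        simp only [favorites, Finset.mem_filter, Finset.mem_univ, true_and, not_forall, not_le]
        exact ⟨k, by rw [h, hk]; exact hab⟩
      simp [this, h]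
  · push Not at hα
    have hall : ∀ j, P.u i j = β := fun j => (hu j).resolve_left (hα j)
    -- An indifferent agent has all items as favourites; base `β - 1` and gap `1` keep the affine
    -- form with a positive gap.
    refine ⟨β - 1, 1, one_pos, fun j => ?_⟩
    have : j ∈ P.favorites i := by simp [favorites, hall]
    simp [this, hall]

lemma IsBivalued.exists_utility_eq {P : AssignmentProblem n} (hP : P.IsBivalued) (i : Fin n) :
    ∃ b δ : ℝ, 0 < δ ∧ ∀ y : Fin n → ℝ, ∑ j, y j = 1 →
      P.utility i y = b + δ * ∑ j ∈ P.favorites i, y j := by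
  obtain ⟨b, δ, hδ, hu⟩ := hP.exists_eq i
  refine ⟨b, δ, hδ, fun y hy => ?_⟩
  simp only [utility, hu, mul_add, Finset.sum_add_distrib, ← Finset.sum_mul, hy, one_mul, mul_ite,
    mul_zero, Finset.sum_ite_mem, Finset.univ_inter]
  rw [mul_comm]

/-- For a member of a bottleneck set of ratio `v`, the bound `1 ≤ v * p j` on favourites gives
`hkey`: the amount of favourites is at most `v` times the cost. Her own allocation attains equality,
with amount `v` and cost `1`, and both optimality conditions follow. An agent with a full unit has
the largest possible amount at cost `0`. -/
theorem IsBivalued.isHZSolution_of_isOutcome {P : AssignmentProblem n} (hP : P.IsBivalued)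
    {x : Fin n → Fin n → ℝ} (hx : EPS.IsOutcome P.favorites x) : P.IsHZSolution x := by
  obtain ⟨s, hreach, hempty, z, hz0, hzs, rfl, hbal⟩ := hx
  obtain ⟨p, -, hp0, hpO, -, -, -, -, hserv⟩ :=
    EPS.exists_prices_of_reflTransGen P.favorites_nonempty hreach
  refine ⟨hbal, p, hp0, fun i => ?_⟩
  obtain ⟨b, δ, hδ, hutil⟩ := hP.exists_utility_eq i
  have hrow := hbal.2.2 i
  rw [hutil _ hrow]
  rcases hserv i (by simp [hempty]) with ⟨v, hv, hD, hsum, hsupp⟩ | ⟨-, hsum, hsupp⟩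
  · have hzp : ∀ j, p j * z i j = 0 := by
      intro j
      by_cases h : z i j = 0
      · simp [h]
      · simp [hpO j (hzs i j h).2]
    have hcost : cost p ((s.alloc + z) i) = 1 := by
      have h1 : ∀ j, p j * (s.alloc + z) i j = s.alloc i j * (1 / v) := by
        intro j
        simp only [Pi.add_apply, mul_add, hzp, add_zero]
        by_cases h : s.alloc i j = 0
        · simp [h]
        · have := (hsupp j h).2
          have : p j = 1 / v := by field_simp; linarith
          rw [this, mul_comm]
      simp only [cost, h1, ← Finset.sum_mul, hsum]
      field_simp
    have hfav : ∑ j ∈ P.favorites i, (s.alloc + z) i j = v := by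
      rw [← hsum]
      have h1 : ∀ j ∈ P.favorites i, (s.alloc + z) i j = s.alloc i j := by
        intro j hj
        have : z i j = 0 := by
          by_contra h
          exact (hD j hj).1 (hzs i j h).2
        simp [this]
      rw [Finset.sum_congr rfl h1]
      refine Finset.sum_subset (Finset.subset_univ _) ?_
      intro j _ hj
      by_contra h
      exact hj (hsupp j h).1
    have hkey : ∀ y, IsBalancedAllocation y →
        ∑ j ∈ P.favorites i, y j ≤ v * cost p y := by
      intro y hy
      rw [cost, Finset.mul_sum]
      refine le_trans (Finset.sum_le_sum (g := fun j => v * (p j * y j)) ?_)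
        (Finset.sum_le_univ_sum_of_nonneg ?_)
      · intro j hj
        have h1 := (hD j hj).2
        have h2 := (hy.1 j).1
        nlinarith
      · intro j
        have h2 := (hy.1 j).1
        have h3 := hp0 j
        positivity
    refine ⟨⟨hcost.le, ?_⟩, ?_⟩
    · intro y hy hyc
      rw [hutil _ hy.2, hfav]
      have := hkey y hy
      have : ∑ j ∈ P.favorites i, y j ≤ v := by nlinarith
      nlinarith
    · intro y hy hyu
      rw [hutil _ hy.2, hfav] at hyu
      have h1 : v ≤ ∑ j ∈ P.favorites i, y j := by
        by_contra h
        push Not at h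
        nlinarith
      have h2 := h1.trans (hkey y hy)
      rw [hcost]
      by_contra h
      push Not at h
      nlinarith
  · have hz : ∀ j, z i j = 0 := by
      intro j
      by_contra h
      exact absurd (hzs i j h).1 (by rw [hsum]; exact lt_irrefl _)
    have hcost : cost p ((s.alloc + z) i) = 0 := by
      refine Finset.sum_eq_zero fun j _ => ?_
      by_cases h : s.alloc i j = 0
      · simp [h, hz]
      · simp [(hsupp j h).2]
    have hfav : ∑ j ∈ P.favorites i, (s.alloc + z) i j = 1 := by
      rw [← hrow]
      refine Finset.sum_subset (Finset.subset_univ _) ?_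
      intro j _ hj
      have : s.alloc i j = 0 := by
        by_contra h
        exact hj (hsupp j h).1
      simp [this, hz]
    refine ⟨⟨hcost.le.trans zero_le_one, ?_⟩, ?_⟩
    · intro y hy _
      rw [hutil _ hy.2, hfav]
      have : ∑ j ∈ P.favorites i, y j ≤ 1 := by
        rw [← hy.2]
        exact Finset.sum_le_univ_sum_of_nonneg fun j => (hy.1 j).1
      nlinarith
    · intro y hy _
      rw [hcost]
      exact Finset.sum_nonneg fun j _ => mul_nonneg (hp0 j) (hy.1 j).1

end AssignmentProblem

/-! ### Reasoning about programs: frames, straight-line code, loops. -/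

namespace RAM

open Classical in
/-- The final store of a program without loops. -/
noncomputable def Cmd.exec {n : ℕ} (u : Fin n → Fin n → ℝ) : Cmd → Store → Store
  | .skip, s => s
  | .assign v e, s => ⟨Function.update s.var v (e.eval n s), s.arr⟩
  | .store a i e, s => ⟨s.var, Function.update s.arr a
      (Function.update (s.arr a) (i.eval n s) (e.eval n s))⟩
  | .seq c d, s => d.exec u (c.exec u s)
  | .ite b c d, s => if b.Holds u s then c.exec u s else d.exec u s
  | .loop _ _, s => s

/-- Does the program contain no loop? -/
def Cmd.loopFree : Cmd → Bool
  | .skip => true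
  | .assign _ _ => true
  | .store _ _ _ => true
  | .seq c d => c.loopFree && d.loopFree
  | .ite _ c d => c.loopFree && d.loopFree
  | .loop _ _ => false

/-- An upper bound for the number of steps of a program without loops. -/
def Cmd.maxCost : Cmd → ℕ
  | .skip => 1
  | .assign _ e => e.cost + 1
  | .store _ i e => i.cost + e.cost + 1
  | .seq c d => c.maxCost + d.maxCost
  | .ite b c d => b.cost + 1 + (c.maxCost + d.maxCost)
  | .loop _ _ => 0

/-- Does the program contain an assignment to the variable `v`? -/
def Cmd.writesVar (v : ℕ) : Cmd → Bool
  | .skip => false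
  | .assign w _ => Nat.beq v w
  | .store _ _ _ => false
  | .seq c d => c.writesVar v || d.writesVar v
  | .ite _ c d => c.writesVar v || d.writesVar v
  | .loop _ c => c.writesVar v

/-- Does the program contain an assignment to an entry of the array `a`? -/
def Cmd.writesArr (a : ℕ) : Cmd → Bool
  | .skip => false
  | .assign _ _ => false
  | .store b _ _ => Nat.beq a b
  | .seq c d => c.writesArr a || d.writesArr a
  | .ite _ c d => c.writesArr a || d.writesArr a
  | .loop _ c => c.writesArr a

/-- `s'` differs from `s` only in variables and arrays that `c` writes to. -/
def Frame (c : Cmd) (s s' : Store) : Prop :=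
  (∀ v, c.writesVar v = false → s'.var v = s.var v) ∧
  ∀ a, c.writesArr a = false → s'.arr a = s.arr a

lemma Frame.refl (c : Cmd) (s : Store) : Frame c s s := ⟨fun _ _ => rfl, fun _ _ => rfl⟩

lemma Frame.trans {c : Cmd} {s s' s'' : Store} (h : Frame c s s') (h' : Frame c s' s'') :
    Frame c s s'' :=
  ⟨fun v hv => (h'.1 v hv).trans (h.1 v hv), fun a ha => (h'.2 a ha).trans (h.2 a ha)⟩

lemma Frame.var {c : Cmd} {s s' : Store} (h : Frame c s s') (v : ℕ)
    (hv : c.writesVar v = false := by rfl) : s'.var v = s.var v := h.1 v hv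

lemma Frame.arr {c : Cmd} {s s' : Store} (h : Frame c s s') (a : ℕ)
    (ha : c.writesArr a = false := by rfl) : s'.arr a = s.arr a := h.2 a ha

lemma Frame.of_le {c d : Cmd} {s s' : Store} (h : Frame c s s')
    (hv : ∀ v, d.writesVar v = false → c.writesVar v = false)
    (ha : ∀ a, d.writesArr a = false → c.writesArr a = false) : Frame d s s' :=
  ⟨fun v h' => h.1 v (hv v h'), fun a h' => h.2 a (ha a h')⟩

variable {n : ℕ} {u : Fin n → Fin n → ℝ}

/-- Specifications mention only what a program changes. Everything else is recovered from the
syntactic sets of written variables and arrays; for concrete programs these side conditions hold by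
`rfl`. -/
lemma Run.frame {c : Cmd} {s s' : Store} {t : ℕ} (h : Run u c s t s') : Frame c s s' := by
  induction h with
  | skip s => exact Frame.refl _ _
  | assign v e s =>
    refine ⟨fun w hw => ?_, fun _ _ => rfl⟩
    have : w ≠ v := by
      rintro rfl
      simp [Cmd.writesVar] at hw
    simp [this]
  | store a i e s =>
    refine ⟨fun _ _ => rfl, fun b hb => ?_⟩
    have : b ≠ a := by
      rintro rfl
      simp [Cmd.writesArr] at hb
    simp [this]
  | seq _ _ ih₁ ih₂ =>
    exact Frame.trans
      (ih₁.of_le (by simp +contextual [Cmd.writesVar]) (by simp +contextual [Cmd.writesArr]))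
      (ih₂.of_le (by simp +contextual [Cmd.writesVar]) (by simp +contextual [Cmd.writesArr]))
  | iteTrue _ _ ih =>
    exact ih.of_le (by simp +contextual [Cmd.writesVar]) (by simp +contextual [Cmd.writesArr])
  | iteFalse _ _ ih =>
    exact ih.of_le (by simp +contextual [Cmd.writesVar]) (by simp +contextual [Cmd.writesArr])
  | loopTrue _ _ _ ih₁ ih₂ =>
    exact Frame.trans
      (ih₁.of_le (by simp +contextual [Cmd.writesVar]) (by simp +contextual [Cmd.writesArr])) ih₂
  | loopFalse _ => exact Frame.refl _ _

/-- Started in `s`, the program `c` halts after at most `T` steps in a store satisfying `Q`. -/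
def Ends (u : Fin n → Fin n → ℝ) (c : Cmd) (s : Store) (T : ℕ) (Q : Store → Prop) : Prop :=
  ∃ t s', Run u c s t s' ∧ t ≤ T ∧ Q s'

namespace Ends

variable {c d : Cmd} {s : Store} {T T' : ℕ} {Q Q' : Store → Prop}

lemma mono (h : Ends u c s T Q) (hT : T ≤ T') (hQ : ∀ s', Q s' → Q' s') :
    Ends u c s T' Q' := by
  obtain ⟨t, s', hr, ht, hq⟩ := h
  exact ⟨t, s', hr, ht.trans hT, hQ _ hq⟩

lemma frame (h : Ends u c s T Q) : Ends u c s T (fun s' => Frame c s s' ∧ Q s') := by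
  obtain ⟨t, s', hr, ht, hq⟩ := h
  exact ⟨t, s', hr, ht, hr.frame, hq⟩

lemma seq {T₁ T₂ : ℕ} (h : Ends u c s T₁ (fun s' => Ends u d s' T₂ Q)) (hT : T₁ + T₂ ≤ T) :
    Ends u (.seq c d) s T Q := by
  obtain ⟨t, s', hr, ht, t', s'', hr', ht', hq⟩ := h
  exact ⟨t + t', s'', hr.seq hr', by omega, hq⟩

/-- Run `c`, of which a specification is known, and go on with `d`. -/
lemma next {T₁ T₂ : ℕ} {P : Store → Prop} (h : Ends u c s T₁ P)
    (hT : T₁ + T₂ ≤ T) (h' : ∀ s', Frame c s s' → P s' → Ends u d s' T₂ Q) :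
    Ends u (.seq c d) s T Q :=
  seq (h.frame.mono le_rfl fun s' hs' => h' s' hs'.1 hs'.2) hT

lemma ite {b : Test} (h₁ : b.Holds u s → Ends u c s T Q) (h₂ : ¬ b.Holds u s → Ends u d s T Q)
    (hT : b.cost + 1 + T ≤ T') : Ends u (.ite b c d) s T' Q := by
  by_cases hb : b.Holds u s
  · obtain ⟨t, s', hr, ht, hq⟩ := h₁ hb
    exact ⟨_, s', .iteTrue hb hr, by omega, hq⟩
  · obtain ⟨t, s', hr, ht, hq⟩ := h₂ hb
    exact ⟨_, s', .iteFalse hb hr, by omega, hq⟩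

/-- Straight-line code is verified by evaluating it. `Cmd.maxCost` charges both branches of a
conditional, which is harmless for an upper bound. -/
lemma of_exec (hl : c.loopFree = true) (hQ : Q (c.exec u s)) (hT : c.maxCost ≤ T) :
    Ends u c s T Q := by
  suffices h : ∀ s, Ends u c s c.maxCost (fun s' => s' = c.exec u s) from
    (h s).mono hT fun s' hs' => hs' ▸ hQ
  clear hT hQ
  induction c with
  | skip => exact fun s => ⟨1, s, .skip s, le_rfl, rfl⟩
  | assign v e => exact fun s => ⟨_, _, .assign v e s, le_rfl, rfl⟩
  | store a i e => exact fun s => ⟨_, _, .store a i e s, le_rfl, rfl⟩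
  | seq c d ihc ihd =>
    simp only [Cmd.loopFree, Bool.and_eq_true] at hl
    intro s
    refine seq ((ihc hl.1 s).mono le_rfl fun s' hs' => ?_) le_rfl
    subst hs'
    exact ihd hl.2 _
  | ite b c d ihc ihd =>
    simp only [Cmd.loopFree, Bool.and_eq_true] at hl
    intro s
    refine ite (fun hb => (ihc hl.1 s).mono (Nat.le_add_right _ _) fun s' hs' => ?_)
      (fun hb => (ihd hl.2 s).mono (Nat.le_add_left _ _) fun s' hs' => ?_) le_rfl
    · simp [Cmd.exec, hb, hs']
    · simp [Cmd.exec, hb, hs']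
  | loop b c => simp [Cmd.loopFree] at hl

/-- A loop with invariant `I` and variant `m`. -/
lemma loop {b : Test} {B : ℕ} (I : Store → Prop) (m : Store → ℕ) (hI : I s)
    (hstep : ∀ s', Frame c s s' → I s' → b.Holds u s' →
      Ends u c s' B (fun s'' => I s'' ∧ m s'' < m s'))
    (hT : m s * (B + (b.cost + 1)) + (b.cost + 1) ≤ T) :
    Ends u (.loop b c) s T (fun s' => I s' ∧ ¬ b.Holds u s') := by
  suffices h : ∀ k s', Frame c s s' → I s' → m s' ≤ k →
      Ends u (.loop b c) s' (k * (B + (b.cost + 1)) + (b.cost + 1))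
        (fun s' => I s' ∧ ¬ b.Holds u s') from
    (h (m s) s (Frame.refl _ _) hI le_rfl).mono hT fun _ h => h
  intro k
  induction k with
  | zero =>
    intro s' hf hs' hm
    by_cases hb : b.Holds u s'
    · obtain ⟨t, s'', -, -, -, h⟩ := hstep s' hf hs' hb
      omega
    · exact ⟨_, s', .loopFalse hb, by omega, hs', hb⟩
  | succ k ih =>
    intro s' hf hs' hm
    by_cases hb : b.Holds u s'
    · obtain ⟨t, s'', hr, ht, hI', hm'⟩ := hstep s' hf hs' hb
      obtain ⟨t', s₃, hr', ht', h⟩ := ih s'' (hf.trans hr.frame) hI' (by omega)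
      refine ⟨_, s₃, .loopTrue hb hr hr', ?_, h⟩
      rw [Nat.succ_mul]
      omega
    · exact ⟨_, s', .loopFalse hb, by omega, hs', hb⟩

end Ends

/-- Execute `c` for all values of the variable `v` below the value of the variable `w`. -/
def forLoop (v w : ℕ) (c : Cmd) : Cmd :=
  .seq (.assign v (.const 0))
    (.loop (.lt (.var v) (.var w)) (.seq c (.assign v (.add (.var v) (.const 1)))))

/-- The store `s` with the value `k` assigned to the variable `v`. -/
def Store.setVar (s : Store) (v k : ℕ) : Store := ⟨Function.update s.var v k, s.arr⟩

@[simp] lemma Store.setVar_arr (s : Store) (v k : ℕ) : (s.setVar v k).arr = s.arr := rfl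

@[simp] lemma Store.setVar_var (s : Store) (v k w : ℕ) :
    (s.setVar v k).var w = if w = v then k else s.var w := by
  simp [Store.setVar, Function.update_apply]

/-- The step count is made up of 2 for the initial assignment, 4 for each test including the failing
one, and 4 for each increment; hence `B + 8` per round and 6 in addition. -/
lemma Ends.forLoop {v w : ℕ} {c : Cmd} {s : Store} {N B T : ℕ} (I : ℕ → Store → Prop)
    (hN : s.var w = N) (h0 : I 0 (s.setVar v 0))
    (hstep : ∀ k s', k < N → Frame (forLoop v w c) s s' → s'.var v = k → I k s' →
      Ends u c s' B (fun s'' => I (k + 1) (s''.setVar v (k + 1))))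
    (hT : N * (B + 8) + 6 ≤ T)
    (hw : c.writesVar w = false := by rfl) (hv : c.writesVar v = false := by rfl)
    (hwv : Nat.beq w v = false := by rfl) :
    Ends u (forLoop v w c) s T (fun s' => s'.var v = N ∧ I N s') := by
  have hwv' : w ≠ v := by
    rintro rfl
    simp at hwv
  have hfr : ∀ s s', Frame (.seq c (.assign v (.add (.var v) (.const 1)))) s s' →
      Frame (RAM.forLoop v w c) s s' := by
    intro s s' h
    refine h.of_le ?_ ?_
    · intro x hx
      simp only [RAM.forLoop, Cmd.writesVar, Bool.or_eq_false_iff] at hx ⊢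
      exact hx.2
    · intro x hx
      simp only [RAM.forLoop, Cmd.writesArr, Bool.or_eq_false_iff] at hx ⊢
      exact hx.2
  have hfr0 : Frame (RAM.forLoop v w c) s (s.setVar v 0) := by
    refine ⟨fun x hx => ?_, fun _ _ => rfl⟩
    have : x ≠ v := by
      rintro rfl
      simp [RAM.forLoop, Cmd.writesVar] at hx
    simp [this]
  have key := Ends.loop (u := u) (c := .seq c (.assign v (.add (.var v) (.const 1))))
    (s := s.setVar v 0) (b := .lt (.var v) (.var w)) (B := B + 4)
    (T := N * (B + 8) + 4)
    (fun s' => s'.var v ≤ N ∧ I (s'.var v) s') (fun s' => N - s'.var v)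
    (by simp [h0])
    (by
      rintro s' hf ⟨hle, hI⟩ hb
      have hF := hfr0.trans (hfr _ _ hf)
      have hwN : s'.var w = N := by
        rw [← hN]
        refine hF.1 w ?_
        simp only [RAM.forLoop, Cmd.writesVar, hw, hwv, Bool.or_false]
      have hlt : s'.var v < N := by
        simpa [Test.Holds, Exp.eval, hwN] using hb
      refine Ends.seq (T₁ := B) (T₂ := 4)
        ((hstep _ s' hlt hF rfl hI).frame.mono le_rfl ?_) le_rfl
      rintro s'' ⟨hf', hI'⟩
      have hvv : s''.var v = s'.var v := hf'.1 v hv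
      refine Ends.of_exec rfl ?_ le_rfl
      simp only [Cmd.exec, Exp.eval, hvv]
      refine ⟨⟨by simpa using hlt, ?_⟩, ?_⟩
      · simpa [Store.setVar] using hI'
      · simp only [Function.update_self]
        omega)
    (by
      have : N - (s.setVar v 0).var v = N := by simp
      rw [this]
      simp only [Test.cost, Exp.cost]
      have : B + 4 + (1 + 1 + 1 + 1) = B + 8 := by omega
      rw [this])
  refine Ends.seq (T₁ := 2) (T₂ := N * (B + 8) + 4) (Ends.of_exec rfl ?_ le_rfl) (by omega)
  refine key.frame.mono le_rfl ?_
  rintro s' ⟨hf, ⟨hle, hI⟩, hb⟩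
  have hF := hfr0.trans (hfr _ _ hf)
  have hwN : s'.var w = N := by
    rw [← hN]
    refine hF.1 w ?_
    simp only [RAM.forLoop, Cmd.writesVar, hw, hwv, Bool.or_false]
  have hge : N ≤ s'.var v := by
    simpa [Test.Holds, Exp.eval, hwN] using hb
  have heq : s'.var v = N := le_antisymm hle hge
  exact ⟨heq, heq ▸ hI⟩

end RAM

/-! ### Simultaneous bisection of the ratios. -/

namespace EPS

variable {n : ℕ}

/-- What one pass of unit augmentations achieves. `E` is the set of admissible pairs, `c` gives
the capacities of the items, `g₀` and `g` are the flows before and after the pass, `w₀ i` and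
`w i` are the demands of agent `i` that are open before and after it. The marked agents `A` and
the marked items `B` are those that can be reached from agents with an open demand. -/
structure Pass (E : Fin n → Fin n → Prop) (c : Fin n → ℕ) (g₀ g : Fin n → Fin n → ℕ)
    (w₀ w : Fin n → ℕ) (A B : Fin n → Prop) : Prop where
  supp : ∀ i j, 0 < g i j → E i j
  col_le : ∀ j, ∑ i, g i j ≤ c j
  row : ∀ i, ∑ j, g i j + w i = ∑ j, g₀ i j + w₀ i
  satisfied : ∀ i, ¬ A i → w i = 0
  closed_edge : ∀ i j, A i → E i j → B j
  closed_flow : ∀ i j, B j → 0 < g i j → A i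
  saturated : ∀ j, B j → c j ≤ ∑ i, g i j
  origin : ∀ j, B j → ∃ i, A i ∧ E i j
  reach : ∀ C : Set (Fin n), (∃ i, A i ∧ i ∉ C) →
    ∃ i, A i ∧ i ∉ C ∧ (0 < w i ∨ ∃ j, 0 < g i j ∧ ∃ i' ∈ C, E i' j)

/-- Agents and items are labelled such that the ratio at which agent `i` is served lies between
`2 * a i / m` and `2 * (a i + 1) / m`, without upper bound for the largest label. The lower bound
is certified by the flow `g`. -/
structure Bracketing (D : Fin n → Finset (Fin n)) (m : ℕ) (a b : Fin n → ℕ)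
    (g : Fin n → Fin n → ℕ) : Prop where
  supp : ∀ i j, 0 < g i j → j ∈ D i ∧ a i = b j
  row : ∀ i, ∑ j, g i j = a i
  col_le : ∀ j, 2 * ∑ i, g i j ≤ m
  a_lt : ∀ i, a i < m
  b_lt : ∀ j, b j < m
  le : ∀ i, ∀ j ∈ D i, b j ≤ a i
  exists_agent : ∀ j, b j + 1 < m → ∃ i, j ∈ D i ∧ a i = b j
  upper : ∀ α, α + 1 < m → ∀ S : Finset (Fin n), S.Nonempty → (∀ i ∈ S, a i = α) →
    m * (Finset.univ.filter fun j => b j = α ∧ ∀ i, a i = α → j ∈ D i → i ∈ S).card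
      < 2 * (α + 1) * S.card

/-- At scale 1 there is a single label, which is the top one and needs no upper bound; the empty
flow certifies its lower bound 0. -/
lemma Bracketing.init (D : Fin n → Finset (Fin n)) : Bracketing D 1 0 0 0 where
  supp := by simp
  row := by simp
  col_le := by simp
  a_lt := by simp
  b_lt := by simp
  le := by simp
  exists_agent := by simp
  upper := by
    intro α hα
    omega

open Classical in
/-- A pass with demands in the middle of the brackets halves the brackets. -/
lemma Bracketing.step {D : Fin n → Finset (Fin n)} {m : ℕ} {a b : Fin n → ℕ}
    {g g' : Fin n → Fin n → ℕ} {w : Fin n → ℕ} {A B : Fin n → Prop}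
    (h : Bracketing D m a b g)
    (hp : Pass (fun i j => j ∈ D i ∧ a i = b j) (fun _ => m) (fun i j => 2 * g i j) g'
      (fun _ => 1) w A B) :
    Bracketing D (2 * m) (fun i => 2 * a i + if A i then 0 else 1)
      (fun j => 2 * b j + if B j then 0 else 1)
      (fun i j => if A i ↔ B j then (if A i then 2 * g i j else g' i j) else 0) where
  supp := by
    intro i j hij
    split_ifs at hij with h1 h2
    · have := h.supp i j (by omega)
      simp only [this, h1, true_and]
    · have := hp.supp i j hij
      simp only [this, h1, true_and]
    · omega
  row := by
    intro i
    have hg : ∑ j, 2 * g i j = 2 * a i := by rw [← Finset.mul_sum, h.row]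
    -- A marked agent keeps the doubled old flow, an unmarked one takes the new flow, which contains
    -- her additional unit. Neither connects a marked with an unmarked node, so the restriction to
    -- pairs of the same kind loses nothing.
    by_cases hi : A i
    · simp only [hi, true_iff, if_true, add_zero]
      rw [← hg]
      refine Finset.sum_congr rfl fun j _ => ?_
      split_ifs with hj
      · rfl
      · by_contra h0
        exact hj (hp.closed_edge i j hi (h.supp i j (by omega)))
    · have h1 := hp.row i
      have h2 := hp.satisfied i hi
      simp only [hi, false_iff, if_false]
      rw [← hg]
      simp only [h2, add_zero] at h1
      rw [← h1]
      refine Finset.sum_congr rfl fun j _ => ?_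
      split_ifs with hj
      · by_contra h0
        exact hi (hp.closed_flow i j hj (by omega))
      · rfl
  col_le := by
    intro j
    by_cases hj : B j
    · have h1 : ∑ i, (if A i ↔ B j then (if A i then 2 * g i j else g' i j) else 0)
          ≤ ∑ i, 2 * g i j := by
        refine Finset.sum_le_sum fun i _ => ?_
        split_ifs with h1 h2 <;> first | omega | exact absurd (h1.2 hj) h2
      rw [← Finset.mul_sum] at h1
      have := h.col_le j
      omega
    · have h1 : ∑ i, (if A i ↔ B j then (if A i then 2 * g i j else g' i j) else 0)
          ≤ ∑ i, g' i j := by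
        refine Finset.sum_le_sum fun i _ => ?_
        split_ifs with h1 h2 <;> first | omega | exact absurd (h1.1 h2) hj
      have := hp.col_le j
      omega
  a_lt := by
    intro i
    have := h.a_lt i
    split_ifs <;> omega
  b_lt := by
    intro i
    have := h.b_lt i
    split_ifs <;> omega
  le := by
    intro i j hj
    have := h.le i j hj
    rcases this.lt_or_eq with h1 | h1
    · split_ifs <;> omega
    · by_cases hA : A i
      · have hB := hp.closed_edge i j hA ⟨hj, h1.symm⟩
        simp only [hA, hB, if_true]
        omega
      · simp only [hA, if_false]
        split_ifs <;> omega
  exists_agent := by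
    intro j hj
    by_cases hB : B j
    · obtain ⟨i, hi, hD, he⟩ := hp.origin j hB
      exact ⟨i, hD, by simp [hi, hB, he]⟩
    · simp only [hB, if_false] at hj
      obtain ⟨i, hD, he⟩ := h.exists_agent j (by omega)
      have hi : ¬ A i := fun hi => hB (hp.closed_edge i j hi ⟨hD, he⟩)
      exact ⟨i, hD, by simp [hi, hB, he]⟩
  upper := by
    intro α hα S hS hSα
    rcases Nat.even_or_odd' α with ⟨β, rfl | rfl⟩
    · have hA : ∀ i ∈ S, A i ∧ a i = β := by
        intro i hi
        have := hSα i hi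
        split_ifs at this with h1
        · exact ⟨h1, by omega⟩
        · omega
      set W := Finset.univ.filter fun j => (2 * b j + if B j then 0 else 1) = 2 * β ∧
        ∀ i, (2 * a i + if A i then 0 else 1) = 2 * β → j ∈ D i → i ∈ S with hW
      have hWB : ∀ j ∈ W, B j ∧ b j = β ∧ ∀ i, A i → a i = β → j ∈ D i → i ∈ S := by
        intro j hj
        obtain ⟨h1, h2⟩ := (Finset.mem_filter.1 hj).2
        split_ifs at h1 with h3
        · exact ⟨h3, by omega, fun i hi hai => h2 i (by simp [hi, hai])⟩
        · omega
      -- The items of `W` are marked and therefore full; their flow comes from marked agents of the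
      -- block, which belong to `S` by the definition of `W`.
      have hsum : m * W.card = ∑ i ∈ S, ∑ j ∈ W, g' i j := by
        rw [Finset.sum_comm, mul_comm, ← smul_eq_mul, ← Finset.sum_const]
        refine Finset.sum_congr rfl fun j hj => ?_
        obtain ⟨h1, h2, h3⟩ := hWB j hj
        refine (le_antisymm (hp.saturated j h1) (hp.col_le j)).trans ?_
        refine (Finset.sum_subset (Finset.subset_univ _) fun i _ hi => ?_).symm
        by_contra h0
        have h4 := hp.supp i j (by omega)
        exact hi (h3 i (hp.closed_flow i j h1 (by omega)) (h4.2.trans h2) h4.1)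
      have hrow : ∀ i ∈ S, ∑ j, g' i j + w i = 2 * β + 1 := by
        intro i hi
        rw [hp.row, ← Finset.mul_sum, h.row, (hA i hi).2]
      have hle : ∀ i ∈ S, ∑ j ∈ W, g' i j ≤ ∑ j, g' i j :=
        fun i _ => Finset.sum_le_sum_of_subset (Finset.subset_univ _)
      have hlt : ∑ i ∈ S, ∑ j ∈ W, g' i j < ∑ i ∈ S, (2 * β + 1) := by
        refine Finset.sum_lt_sum (fun i hi => ?_) ?_
        · have := hrow i hi
          have := hle i hi
          omega
        · obtain ⟨i₀, hi₀⟩ := hS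
          -- Strictness comes from reachability, applied to the marked agents outside `S`. It
          -- provides an agent of `S` who has an open demand or uses an item liked by a marked agent
          -- of her block outside `S`. Such an item is not in `W`, so in both cases a unit of the
          -- demand of `S` is not served from `W`.
          obtain ⟨i, hiA, hiC, hi⟩ := hp.reach {i | A i ∧ i ∉ S} ⟨i₀, (hA i₀ hi₀).1, by simp [hi₀]⟩
          have hiS : i ∈ S := by simpa [hiA] using hiC
          refine ⟨i, hiS, ?_⟩
          have h1 := hrow i hiS
          have h2 := hle i hiS
          rcases hi with hi | ⟨j, hj, i', hi', hE⟩
          · omega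
          · have h3 : ∑ j ∈ W, g' i j < ∑ j, g' i j := by
              refine Finset.sum_lt_sum_of_subset (Finset.subset_univ _) (Finset.mem_univ j) ?_ hj
                (by simp)
              intro hjW
              obtain ⟨-, h4, h5⟩ := hWB j hjW
              exact hi'.2 (h5 i' hi'.1 (hE.2.trans h4) hE.1)
            omega
      rw [Finset.sum_const, smul_eq_mul, mul_comm] at hlt
      rw [mul_assoc, hsum, mul_assoc]
      omega
    · have hA : ∀ i ∈ S, ¬ A i ∧ a i = β := by
        intro i hi
        have := hSα i hi
        split_ifs at this with h1
        · omega
        · exact ⟨h1, by omega⟩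
      have key := h.upper β (by omega) S hS fun i hi => (hA i hi).2
      -- The upper half inherits the old upper bound. A marked agent liking an item of her label
      -- would have caused the item to be marked, so for unmarked items the new condition on `S`
      -- already implies the old one.
      have hsub : (Finset.univ.filter fun j => (2 * b j + if B j then 0 else 1) = 2 * β + 1 ∧
        ∀ i, (2 * a i + if A i then 0 else 1) = 2 * β + 1 → j ∈ D i → i ∈ S).card ≤
        (Finset.univ.filter fun j => b j = β ∧ ∀ i, a i = β → j ∈ D i → i ∈ S).card := by
        refine Finset.card_le_card fun j hj => ?_
        obtain ⟨h1, h2⟩ := (Finset.mem_filter.1 hj).2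
        split_ifs at h1 with hB
        · omega
        · have hb : b j = β := by omega
          refine Finset.mem_filter.2 ⟨Finset.mem_univ _, hb, fun i hi hD => ?_⟩
          have hiA : ¬ A i := fun hiA => hB (hp.closed_edge i j hiA ⟨hD, hi.trans hb.symm⟩)
          exact h2 i (by simp [hiA, hi]) hD
      have := Nat.mul_le_mul_left m hsub
      rw [mul_assoc]
      rw [mul_assoc] at key ⊢
      have e : (2 * β + 1 + 1) * S.card = 2 * ((β + 1) * S.card) := by ring
      rw [e]
      omega

end EPS

/-! ### From narrow brackets to bottleneck sets, and from block flows to EPS outcomes. -/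

namespace EPS

variable {n : ℕ}

/-- The decomposition into blocks of equal label, in the order in which EPS serves them. Agents
with label `α < M` get `p α / q α` units; those with label `M` get a full unit. -/
structure Blocks (D : Fin n → Finset (Fin n)) (M : ℕ) (a b : Fin n → ℕ) (p q : ℕ → ℕ) :
    Prop where
  a_le : ∀ i, a i ≤ M
  b_le : ∀ j, b j ≤ M
  le : ∀ i, ∀ j ∈ D i, b j ≤ a i
  exists_agent : ∀ j, b j < M → ∃ i, j ∈ D i ∧ a i = b j
  p_eq : ∀ α, α < M → p α = (Finset.univ.filter fun j => b j = α).card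
  q_eq : ∀ α, α < M → q α = (Finset.univ.filter fun i => a i = α).card
  p_top : p M = 1
  q_top : q M = 1
  lt : ∀ α, α < M → 0 < q α → p α < q α
  hall : ∀ α, α ≤ M → 0 < q α → ∀ C : Finset (Fin n), (∀ i ∈ C, α ≤ a i) →
    p α * C.card ≤ q α * (Finset.univ.filter fun j => α ≤ b j ∧ ∃ i ∈ C, j ∈ D i).card
  hall_strict : ∀ α, α < M → 0 < q α → ∀ C : Finset (Fin n), (∀ i ∈ C, α ≤ a i) →
    (∃ i ∈ C, α < a i) →
    p α * C.card < q α * (Finset.univ.filter fun j => α ≤ b j ∧ ∃ i ∈ C, j ∈ D i).card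

/-- The number of indices with label `α`, but `1` if `α` is not below `M`. -/
def blockSize (M : ℕ) (a : Fin n → ℕ) (α : ℕ) : ℕ :=
  if α < M then (Finset.univ.filter fun i => a i = α).card else 1

/-- Count the flow of `C`: every agent receives at least `α` units, all from items she likes with
label at least `α`, and no item provides more than `M`. -/
lemma Bracketing.le_card {D : Fin n → Finset (Fin n)} {M : ℕ} {a b : Fin n → ℕ}
    {g : Fin n → Fin n → ℕ} (h : Bracketing D (2 * M) a b g) (α : ℕ) (C : Finset (Fin n))
    (hC : ∀ i ∈ C, α ≤ a i) :
    α * C.card ≤ M * (Finset.univ.filter fun j => α ≤ b j ∧ ∃ i ∈ C, j ∈ D i).card := by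
  set W := Finset.univ.filter fun j => α ≤ b j ∧ ∃ i ∈ C, j ∈ D i with hW
  calc α * C.card = ∑ i ∈ C, α := by rw [Finset.sum_const, smul_eq_mul, mul_comm]
    _ ≤ ∑ i ∈ C, ∑ j, g i j := Finset.sum_le_sum fun i hi => by rw [h.row]; exact hC i hi
    _ = ∑ i ∈ C, ∑ j ∈ W, g i j := by
        refine Finset.sum_congr rfl fun i hi => ?_
        refine (Finset.sum_subset (Finset.subset_univ _) fun j _ hj => ?_).symm
        by_contra h0
        obtain ⟨h1, h2⟩ := h.supp i j (by omega)
        exact hj (Finset.mem_filter.2 ⟨Finset.mem_univ _, h2 ▸ hC i hi, i, hi, h1⟩)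
    _ = ∑ j ∈ W, ∑ i ∈ C, g i j := Finset.sum_comm
    _ ≤ ∑ j ∈ W, M := by
        refine Finset.sum_le_sum fun j _ => ?_
        have h1 := h.col_le j
        have h2 : ∑ i ∈ C, g i j ≤ ∑ i, g i j :=
          Finset.sum_le_sum_of_subset (Finset.subset_univ _)
        omega
    _ = M * W.card := by rw [Finset.sum_const, smul_eq_mul, mul_comm]

/-- This is the upper bound for the set of all agents with label `α`; then every item of that label
is counted. -/
lemma Bracketing.mul_card_lt {D : Fin n → Finset (Fin n)} {M : ℕ} {a b : Fin n → ℕ}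
    {g : Fin n → Fin n → ℕ} (h : Bracketing D (2 * M) a b g) {α : ℕ} (hα : α < M)
    (hq : 0 < (Finset.univ.filter fun i => a i = α).card) :
    M * (Finset.univ.filter fun j => b j = α).card
      < (α + 1) * (Finset.univ.filter fun i => a i = α).card := by
  have := h.upper α (by omega) _ (Finset.card_pos.1 hq) (by simp)
  have e : (Finset.univ.filter fun j => b j = α ∧ ∀ i, a i = α → j ∈ D i →
      i ∈ Finset.univ.filter fun i => a i = α) = Finset.univ.filter fun j => b j = α := by
    ext j
    simp +contextual
  rw [e] at this
  rw [mul_assoc, mul_assoc] at this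
  omega

/-- Once the brackets are narrow enough, the labels determine the bottleneck sets. -/
lemma Bracketing.blocks {D : Fin n → Finset (Fin n)} {M : ℕ} {a b : Fin n → ℕ}
    {g : Fin n → Fin n → ℕ} (h : Bracketing D (2 * M) a b g) (hM : n * n ≤ M) (hM0 : 0 < M) :
    Blocks D M (fun i => min (a i) M) (fun j => min (b j) M)
      (blockSize M fun j => min (b j) M) (blockSize M fun i => min (a i) M) := by
  have hmin : ∀ (c : Fin n → ℕ) α, α < M → (Finset.univ.filter fun i => min (c i) M = α)
      = Finset.univ.filter fun i => c i = α := by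
    intro c α hα
    ext i
    simp only [Finset.mem_filter, Finset.mem_univ, true_and]
    omega
  have hbs : ∀ (c : Fin n → ℕ) α, α < M → blockSize M (fun i => min (c i) M) α
      = (Finset.univ.filter fun i => c i = α).card := by
    intro c α hα
    rw [blockSize, if_pos hα, hmin c α hα]
  have hfil : ∀ α, α ≤ M → ∀ C : Finset (Fin n),
      (Finset.univ.filter fun j => α ≤ min (b j) M ∧ ∃ i ∈ C, j ∈ D i)
      = Finset.univ.filter fun j => α ≤ b j ∧ ∃ i ∈ C, j ∈ D i := by
    intro α hα C
    ext j
    simp [hα]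
  have key : ∀ α, α < M → 0 < (Finset.univ.filter fun i => a i = α).card →
      ∀ C : Finset (Fin n), (∀ i ∈ C, α ≤ a i) →
      (Finset.univ.filter fun j => b j = α).card * C.card
        + (if (∃ i ∈ C, α < a i) then 1 else 0)
      ≤ (Finset.univ.filter fun i => a i = α).card *
        (Finset.univ.filter fun j => α ≤ b j ∧ ∃ i ∈ C, j ∈ D i).card := by
    intro α hα hq C hC
    have hlt := h.mul_card_lt hα hq
    set p := (Finset.univ.filter fun j => b j = α).card
    set q := (Finset.univ.filter fun i => a i = α).card
    have hqn : q ≤ n := (Finset.card_le_univ _).trans (by simp)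
    -- The agents of label `α` and those above it can be treated separately: an agent of label `α`
    -- likes no item of larger label, so `W₁` and `W₂` are disjoint.
    set C₁ := C.filter fun i => a i = α with hC₁
    set C₂ := C.filter fun i => ¬ a i = α with hC₂
    have hcard : C₁.card + C₂.card = C.card := Finset.card_filter_add_card_filter_not _
    set W₁ := Finset.univ.filter fun j => α ≤ b j ∧ ∃ i ∈ C₁, j ∈ D i with hW₁
    set W₂ := Finset.univ.filter fun j => α + 1 ≤ b j ∧ ∃ i ∈ C₂, j ∈ D i with hW₂
    set W := Finset.univ.filter fun j => α ≤ b j ∧ ∃ i ∈ C, j ∈ D i with hW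
    have h1 : α * C₁.card ≤ M * W₁.card :=
      h.le_card α C₁ fun i hi => hC i (Finset.mem_filter.1 hi).1
    have h2 : (α + 1) * C₂.card ≤ M * W₂.card := by
      refine h.le_card (α + 1) C₂ fun i hi => ?_
      have h1 := Finset.mem_filter.1 hi
      have h2 := hC i h1.1
      omega
    have hWc : W₁.card + W₂.card ≤ W.card := by
      have hdis : Disjoint W₁ W₂ := by
        rw [Finset.disjoint_left]
        intro j hj1 hj2
        obtain ⟨-, -, i, hi, hD⟩ := Finset.mem_filter.1 hj1
        have h3 := (Finset.mem_filter.1 hj2).2.1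
        have h4 := h.le i j hD
        have h5 := (Finset.mem_filter.1 hi).2
        omega
      rw [← Finset.card_union_of_disjoint hdis]
      refine Finset.card_le_card fun j hj => ?_
      rcases Finset.mem_union.1 hj with hj | hj
      · obtain ⟨-, h1, i, hi, hD⟩ := Finset.mem_filter.1 hj
        exact Finset.mem_filter.2 ⟨Finset.mem_univ _, h1, i, (Finset.mem_filter.1 hi).1, hD⟩
      · obtain ⟨-, h1, i, hi, hD⟩ := Finset.mem_filter.1 hj
        exact Finset.mem_filter.2
          ⟨Finset.mem_univ _, by omega, i, (Finset.mem_filter.1 hi).1, hD⟩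
    -- Here the narrowness of the brackets enters. If the inequality failed, the two integers would
    -- differ by at least 1, hence by at least `M` after scaling, while the bracket allows a
    -- difference below `q * C₁.card ≤ n * n ≤ M`.
    have h3 : p * C₁.card ≤ q * W₁.card := by
      by_contra hcon
      push Not at hcon
      have hcn : C₁.card ≤ n := (Finset.card_le_univ _).trans (by simp)
      have e1 : M * (q * W₁.card + 1) ≤ M * (p * C₁.card) := Nat.mul_le_mul_left _ hcon
      have e2 : (M * p) * C₁.card + C₁.card ≤ (α + 1) * q * C₁.card := by
        have := Nat.mul_le_mul_right C₁.card hlt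
        rwa [Nat.succ_mul] at this
      have e3 : q * (α * C₁.card) ≤ q * (M * W₁.card) := Nat.mul_le_mul_left _ h1
      have e4 : q * C₁.card ≤ n * n := Nat.mul_le_mul hqn hcn
      have hc : C₁.card ≠ 0 := by
        intro h0
        simp [h0] at hcon
      have : 0 < C₁.card := Nat.pos_of_ne_zero hc
      nlinarith
    -- Agents above `α` have the lower bound `(α + 1) / M`, which exceeds `p / q`. This is the
    -- source of the strict inequality, and the width of the bracket plays no role.
    have h4 : p * C₂.card + (if (∃ i ∈ C, α < a i) then 1 else 0) ≤ q * W₂.card := by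
      by_cases hex : ∃ i ∈ C, α < a i
      · obtain ⟨i, hi, hlt'⟩ := hex
        have hc : 0 < C₂.card :=
          Finset.card_pos.2 ⟨i, Finset.mem_filter.2 ⟨hi, by omega⟩⟩
        rw [if_pos ⟨i, hi, hlt'⟩]
        have e1 : (M * p) * C₂.card < (α + 1) * q * C₂.card := Nat.mul_lt_mul_of_pos_right hlt hc
        have e2 : q * ((α + 1) * C₂.card) ≤ q * (M * W₂.card) := Nat.mul_le_mul_left _ h2
        have e3 : M * (p * C₂.card) < M * (q * W₂.card) := by nlinarith
        exact Nat.lt_of_mul_lt_mul_left e3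
      · have hc : C₂ = ∅ := by
          refine Finset.filter_eq_empty_iff.2 fun i hi => ?_
          push Not at hex
          have := hex i hi
          have := hC i hi
          omega
        rw [if_neg hex, hc]
        simp
    have h5 : q * (W₁.card + W₂.card) ≤ q * W.card := Nat.mul_le_mul_left _ hWc
    rw [← hcard, Nat.mul_add]
    rw [Nat.mul_add] at h5
    omega
  refine ⟨fun i => min_le_right _ _, fun j => min_le_right _ _, ?_, ?_, ?_, ?_, ?_, ?_, ?_, ?_,
    ?_⟩
  · intro i j hj
    have := h.le i j hj
    omega
  · intro j hj
    obtain ⟨i, h1, h2⟩ := h.exists_agent j (by omega)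
    exact ⟨i, h1, by omega⟩
  · intro α hα
    rw [blockSize, if_pos hα]
  · intro α hα
    rw [blockSize, if_pos hα]
  · simp [blockSize]
  · simp [blockSize]
  · intro α hα hq
    rw [hbs _ _ hα] at hq
    rw [hbs _ _ hα, hbs _ _ hα]
    have h1 := h.mul_card_lt hα hq
    have h2 : (α + 1) * (Finset.univ.filter fun i => a i = α).card
        ≤ M * (Finset.univ.filter fun i => a i = α).card := Nat.mul_le_mul_right _ hα
    exact Nat.lt_of_mul_lt_mul_left (h1.trans_le h2)
  · intro α hα hq C hC
    rw [hfil α hα C]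
    have hC' : ∀ i ∈ C, α ≤ a i := fun i hi => (hC i hi).trans (min_le_left _ _)
    rcases hα.lt_or_eq with hα' | rfl
    · rw [hbs _ _ hα'] at hq
      rw [hbs _ _ hα', hbs _ _ hα']
      exact (Nat.le_add_right _ _).trans (key α hα' hq C hC')
    · simp only [blockSize, lt_irrefl, if_false, one_mul]
      exact Nat.le_of_mul_le_mul_left (h.le_card α C hC') hM0
  · intro α hα hq C hC hex
    rw [hfil α hα.le C]
    rw [hbs _ _ hα] at hq
    rw [hbs _ _ hα, hbs _ _ hα]
    have hC' : ∀ i ∈ C, α ≤ a i := fun i hi => (hC i hi).trans (min_le_left _ _)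
    have := key α hα hq C hC'
    obtain ⟨i, hi, hlt⟩ := hex
    rw [if_pos ⟨i, hi, lt_of_lt_of_le hlt (min_le_left _ _)⟩] at this
    omega

namespace Blocks

variable {D : Fin n → Finset (Fin n)} {M : ℕ} {a b : Fin n → ℕ} {p q : ℕ → ℕ}

lemma q_pos (h : Blocks D M a b p q) (i : Fin n) : 0 < q (a i) := by
  rcases (h.a_le i).lt_or_eq with h1 | h1
  · rw [h.q_eq _ h1]
    exact Finset.card_pos.2 ⟨i, by simp⟩
  · rw [h1, h.q_top]
    exact one_pos

lemma p_le_q (h : Blocks D M a b p q) (i : Fin n) : p (a i) ≤ q (a i) := by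
  rcases (h.a_le i).lt_or_eq with h1 | h1
  · exact (h.lt _ h1 (h.q_pos i)).le
  · rw [h1, h.q_top, h.p_top]

/-- Demands that do not exceed the rates of the blocks are always satisfied. -/
lemma not_marked (h : Blocks D M a b p q) {c : Fin n → ℕ} {g₀ g : Fin n → Fin n → ℕ}
    {w₀ w : Fin n → ℕ} {A B : Fin n → Prop} (κ : ℕ → ℕ)
    (hp : Pass (fun i j => j ∈ D i ∧ a i = b j) c g₀ g w₀ w A B) (hc : ∀ j, c j = κ (b j))
    (hd : ∀ i, (∑ j, g₀ i j + w₀ i) * q (a i) ≤ κ (a i) * p (a i)) : ∀ i, ¬ A i := by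
  classical
  intro i₁ hi₁
  -- For the empty set the second alternative of reachability is void, so some marked agent has an
  -- open demand.
  obtain ⟨i, hiA, -, hi⟩ := hp.reach ∅ ⟨i₁, hi₁, by simp⟩
  have hw : 0 < w i := by
    rcases hi with hi | ⟨j, -, i', hi', -⟩
    · exact hi
    · exact absurd hi' (by simp)
  set α := a i with hα
  set C := Finset.univ.filter fun i => A i ∧ a i = α with hC
  have hiC : i ∈ C := by simp [hC, hiA, hα]
  have hCα : ∀ i ∈ C, A i ∧ a i = α := fun i hi => (Finset.mem_filter.1 hi).2
  set W := Finset.univ.filter fun j => α ≤ b j ∧ ∃ i ∈ C, j ∈ D i with hW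
  have hq : 0 < q α := h.q_pos i
  have hall := h.hall α (h.a_le i) hq C fun i hi => (hCα i hi).2.ge
  have hWB : ∀ j ∈ W, B j ∧ b j = α := by
    intro j hj
    obtain ⟨-, h1, i', hi', hD⟩ := Finset.mem_filter.1 hj
    obtain ⟨h2, h3⟩ := hCα i' hi'
    have h4 := h.le i' j hD
    have h5 : b j = α := by omega
    exact ⟨hp.closed_edge i' j h2 ⟨hD, h3.trans h5.symm⟩, h5⟩
  -- The items of `W` are full with `κ α` units each and serve only agents of `C`, who nevertheless
  -- miss a unit. With demands of at most `κ α * p α / q α` this contradicts Hall's inequality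
  -- `hall`.
  have h1 : κ α * W.card ≤ ∑ i ∈ C, ∑ j ∈ W, g i j := by
    rw [Finset.sum_comm, mul_comm, ← smul_eq_mul, ← Finset.sum_const]
    refine Finset.sum_le_sum fun j hj => ?_
    obtain ⟨h1, h2⟩ := hWB j hj
    rw [← h2, ← hc]
    refine (hp.saturated j h1).trans (le_of_eq ?_)
    refine (Finset.sum_subset (Finset.subset_univ _) fun i _ hi => ?_).symm
    by_contra h0
    have h4 := hp.supp i j (by omega)
    exact hi (Finset.mem_filter.2 ⟨Finset.mem_univ _, hp.closed_flow i j h1 (by omega),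
      h4.2.trans h2⟩)
  have h2 : ∑ i ∈ C, ∑ j ∈ W, g i j < ∑ i ∈ C, (∑ j, g₀ i j + w₀ i) := by
    have hle : ∀ i ∈ C, ∑ j ∈ W, g i j ≤ ∑ j, g i j :=
      fun i _ => Finset.sum_le_sum_of_subset (Finset.subset_univ _)
    refine Finset.sum_lt_sum (fun i' hi' => ?_) ⟨i, hiC, ?_⟩
    · have := hle i' hi'
      have := hp.row i'
      omega
    · have := hle i hiC
      have := hp.row i
      omega
  have h3 : (∑ i ∈ C, (∑ j, g₀ i j + w₀ i)) * q α ≤ κ α * (p α * C.card) := by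
    rw [Finset.sum_mul]
    have : κ α * (p α * C.card) = ∑ i ∈ C, κ α * p α := by
      rw [Finset.sum_const, smul_eq_mul]
      ring
    rw [this]
    refine Finset.sum_le_sum fun i hi => ?_
    have := hd i
    rwa [(hCα i hi).2] at this
  have h4 := Nat.mul_lt_mul_of_pos_right (h1.trans_lt h2) hq
  have h5 := Nat.mul_le_mul_left (κ α) hall
  rw [← hW] at h5
  nlinarith

lemma card_pos_of_lt (h : Blocks D M a b p q) {j : Fin n} (hj : b j < M) : 0 < q (b j) := by
  obtain ⟨i, -, hi⟩ := h.exists_agent j hj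
  rw [← hi]
  exact h.q_pos i

lemma liked_eq (h : Blocks D M a b p q) {α : ℕ} (hα : α < M) :
    liked D (Finset.univ.filter fun j => α ≤ b j) (Finset.univ.filter fun i => a i = α)
      = Finset.univ.filter fun j => b j = α := by
  ext j
  simp only [mem_liked, Finset.mem_filter, Finset.mem_univ, true_and]
  constructor
  · rintro ⟨i, rfl, hD, hb⟩
    exact le_antisymm (h.le i j hD) hb
  · intro hb
    obtain ⟨i, hD, hi⟩ := h.exists_agent j (by omega)
    exact ⟨i, by omega, hD, by omega⟩

lemma ratio_eq (h : Blocks D M a b p q) {α : ℕ} (hα : α < M) :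
    ratio D (Finset.univ.filter fun j => α ≤ b j) (Finset.univ.filter fun i => a i = α)
      = p α / q α := by
  rw [ratio, h.liked_eq hα, h.p_eq α hα, h.q_eq α hα]

lemma liked_eq_filter (α : ℕ) (C : Finset (Fin n)) :
    liked D (Finset.univ.filter fun j => α ≤ b j) C
      = Finset.univ.filter fun j => α ≤ b j ∧ ∃ i ∈ C, j ∈ D i := by
  ext j
  simp only [mem_liked, Finset.mem_filter, Finset.mem_univ, true_and]
  constructor
  · rintro ⟨i, hi, hD, hb⟩
    exact ⟨hb, i, hi, hD⟩
  · rintro ⟨hb, i, hi, hD⟩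
    exact ⟨i, hi, hD, hb⟩

/-- `hall` makes the block a minimiser of the ratio, and `hall_strict` shows that no minimiser
contains an agent of larger label, so every minimiser is part of the block. -/
lemma isBottleneck (h : Blocks D M a b p q) {α : ℕ} (hα : α < M) (hq : 0 < q α) :
    IsBottleneck D (Finset.univ.filter fun i => α ≤ a i) (Finset.univ.filter fun j => α ≤ b j)
      (Finset.univ.filter fun i => a i = α) := by
  have hqR : (0 : ℝ) < q α := by exact_mod_cast hq
  refine ⟨?_, ?_, ?_, ?_⟩
  · intro i
    simp only [Finset.mem_filter, Finset.mem_univ, true_and]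
    omega
  · rw [h.q_eq α hα] at hq
    exact Finset.card_pos.1 hq
  · intro C hC hne
    have hc : (0 : ℝ) < C.card := by exact_mod_cast hne.card_pos
    have := h.hall α hα.le hq C fun i hi => (Finset.mem_filter.1 (hC hi)).2
    rw [h.ratio_eq hα, ratio, liked_eq_filter, div_le_div_iff₀ hqR hc, mul_comm _ (q α : ℝ)]
    exact_mod_cast this
  · intro C hC hne heq
    have hc : (0 : ℝ) < C.card := by exact_mod_cast hne.card_pos
    refine Finset.card_le_card fun i hi => ?_
    by_contra hcon
    have hlt : α < a i := by
      have h1 := (Finset.mem_filter.1 (hC hi)).2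
      simp only [Finset.mem_filter, Finset.mem_univ, true_and] at hcon
      omega
    have := h.hall_strict α hα hq C (fun i hi => (Finset.mem_filter.1 (hC hi)).2) ⟨i, hi, hlt⟩
    rw [h.ratio_eq hα, ratio, liked_eq_filter, div_eq_div_iff hc.ne' hqR.ne',
      mul_comm _ (q α : ℝ)] at heq
    norm_cast at heq
    omega

/-- Among the remaining items, the agents of label `α` like only those of label `α`, and these are
too few. -/
lemma not_gives_one (h : Blocks D M a b p q) {α : ℕ} (hα : α < M) (hq : 0 < q α) :
    ¬ ∃ z, Gives D (Finset.univ.filter fun i => α ≤ a i)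
      (Finset.univ.filter fun j => α ≤ b j) 1 z := by
  rintro ⟨z, hz0, hzs, hzr, hzc⟩
  have hlt := h.lt α hα hq
  rw [h.p_eq α hα, h.q_eq α hα] at hlt
  have h1 : ((Finset.univ.filter fun i => a i = α).card : ℝ)
      = ∑ i ∈ Finset.univ.filter (fun i => a i = α),
        ∑ j ∈ Finset.univ.filter (fun j => b j = α), z i j := by
    rw [Finset.card_eq_sum_ones, Nat.cast_sum]
    refine Finset.sum_congr rfl fun i hi => ?_
    have hi' := (Finset.mem_filter.1 hi).2
    rw [Nat.cast_one, ← hzr i (by simp [hi'])]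
    refine (Finset.sum_subset (Finset.subset_univ _) fun j _ hj => ?_).symm
    by_contra h0
    have := (Finset.mem_inter.1 (hzs i j h0).2)
    have h2 := h.le i j this.1
    have h3 := (Finset.mem_filter.1 this.2).2
    simp only [Finset.mem_filter, Finset.mem_univ, true_and] at hj
    omega
  rw [Finset.sum_comm] at h1
  have h2 : ((Finset.univ.filter fun i => a i = α).card : ℝ)
      ≤ (Finset.univ.filter fun j => b j = α).card := by
    rw [h1, Finset.card_eq_sum_ones, Nat.cast_sum]
    refine Finset.sum_le_sum fun j _ => ?_
    rw [Nat.cast_one]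
    exact (Finset.sum_le_univ_sum_of_nonneg fun i => hz0 i j).trans (hzc j)
  have : (Finset.univ.filter fun i => a i = α).card
      ≤ (Finset.univ.filter fun j => b j = α).card := by exact_mod_cast h2
  omega

variable {y : Fin n → Fin n → ℝ}

/-- The main loop of EPS serves the blocks with labels below `M` in increasing order. -/
lemma reflTransGen (h : Blocks D M a b p q) (hy0 : ∀ i j, 0 ≤ y i j)
    (hys : ∀ i j, y i j ≠ 0 → j ∈ D i ∧ a i = b j)
    (hyr : ∀ i, ∑ j, y i j = p (a i) / q (a i)) (hyc : ∀ j, ∑ i, y i j ≤ 1) (α : ℕ)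
    (hα : α ≤ M) :
    Relation.ReflTransGen (Step D) ⟨Finset.univ, Finset.univ, 0⟩
      ⟨Finset.univ.filter fun i => α ≤ a i, Finset.univ.filter fun j => α ≤ b j,
        fun i j => if a i < α then y i j else 0⟩ := by
  induction α with
  | zero =>
    have : (⟨Finset.univ.filter fun i => 0 ≤ a i, Finset.univ.filter fun j => 0 ≤ b j,
        fun i j => if a i < 0 then y i j else 0⟩ : State n) = ⟨Finset.univ, Finset.univ, 0⟩ := by
      simp only [State.mk.injEq]
      refine ⟨by simp, by simp, ?_⟩
      funext i j
      simp
    rw [this]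
  | succ α ih =>
    have hα' : α < M := hα
    specialize ih hα'.le
    have hagents : (Finset.univ.filter fun i => α + 1 ≤ a i)
        = (Finset.univ.filter fun i => α ≤ a i) \ (Finset.univ.filter fun i => a i = α) := by
      ext i
      simp only [Finset.mem_filter, Finset.mem_univ, true_and, Finset.mem_sdiff]
      omega
    have hitems : (Finset.univ.filter fun j => α + 1 ≤ b j)
        = (Finset.univ.filter fun j => α ≤ b j) \ (Finset.univ.filter fun j => b j = α) := by
      ext i
      simp only [Finset.mem_filter, Finset.mem_univ, true_and, Finset.mem_sdiff]
      omega
    have halloc : (fun i j => if a i < α + 1 then y i j else 0)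
        = (fun i j => if a i < α then y i j else 0) + fun i j => if a i = α then y i j else 0 := by
      funext i j
      simp only [Pi.add_apply]
      rcases lt_trichotomy (a i) α with h1 | h1 | h1
      · simp [h1, h1.ne, Nat.lt_succ_of_lt h1]
      · simp [h1]
      · have h2 : ¬ a i < α + 1 := by omega
        have h3 : ¬ a i < α := by omega
        simp [h2, h3, h1.ne']
    -- A label without agents has no items either; the state does not change and EPS makes no step.
    rcases Nat.eq_zero_or_pos (q α) with hq | hq
    · have hnone : ∀ i, a i ≠ α := by
        intro i hi
        have := h.q_pos i
        rw [hi] at this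
        omega
      have hnone' : ∀ j, b j ≠ α := by
        intro j hj
        have := h.card_pos_of_lt (j := j) (by omega)
        rw [hj] at this
        omega
      rw [hagents, hitems, halloc]
      simp only [hnone, hnone', if_false, Finset.filter_false, Finset.sdiff_empty]
      convert ih using 2
      funext i j
      simp
    · refine ih.tail ?_
      have hqR : (0 : ℝ) < q α := by exact_mod_cast hq
      have hst := Step.bottleneck (D := D) ⟨Finset.univ.filter fun i => α ≤ a i,
        Finset.univ.filter fun j => α ≤ b j, fun i j => if a i < α then y i j else 0⟩
        (Finset.univ.filter fun i => a i = α) (fun i j => if a i = α then y i j else 0)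
        ((h.isBottleneck hα' hq).2.1.mono (h.isBottleneck hα' hq).1)
        (h.not_gives_one hα' hq) (h.isBottleneck hα' hq) (by
          dsimp only
          rw [h.liked_eq hα', h.ratio_eq hα']
          refine ⟨?_, ?_, ?_, ?_⟩
          · intro i j
            dsimp only
            split_ifs
            · exact hy0 i j
            · exact le_rfl
          · intro i j hij
            dsimp only at hij
            split_ifs at hij with hi
            · have := hys i j hij
              refine ⟨by simp [hi], ?_⟩
              rw [Finset.mem_inter]
              exact ⟨this.1, by simp [← this.2, hi]⟩
            · exact absurd rfl hij
          · intro i hi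
            have hi' := (Finset.mem_filter.1 hi).2
            simp only [hi', if_true]
            rw [hyr, hi']
          · intro j
            refine (Finset.sum_le_sum fun i _ => ?_).trans (hyc j)
            dsimp only
            split_ifs
            · exact le_rfl
            · exact hy0 i j)
      rw [hagents, hitems, halloc]
      dsimp only at hst
      rwa [h.liked_eq hα'] at hst

/-- The agents of the block receive `q α * (p α / q α) = p α` units in total, as many as there are
items, and no item provides more than one. -/
lemma col_eq_one (h : Blocks D M a b p q) (hys : ∀ i j, y i j ≠ 0 → j ∈ D i ∧ a i = b j)
    (hyr : ∀ i, ∑ j, y i j = p (a i) / q (a i)) (hyc : ∀ j, ∑ i, y i j ≤ 1) {j : Fin n}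
    (hj : b j < M) : ∑ i, y i j = 1 := by
  set α := b j with hα
  have hq := h.card_pos_of_lt hj
  rw [← hα] at hq
  have hqR : (0 : ℝ) < q α := by exact_mod_cast hq
  have htot : ∑ j ∈ Finset.univ.filter (fun j => b j = α), ∑ i, y i j
      = ∑ j ∈ Finset.univ.filter (fun j => b j = α), (1 : ℝ) := by
    have h1 : ∑ j ∈ Finset.univ.filter (fun j => b j = α), ∑ i, y i j
        = ∑ i ∈ Finset.univ.filter (fun i => a i = α), ∑ j, y i j := by
      rw [Finset.sum_comm, Finset.sum_filter]
      refine Finset.sum_congr rfl fun i _ => ?_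
      split_ifs with hi
      · refine Finset.sum_subset (Finset.subset_univ _) fun j _ hj => ?_
        by_contra h0
        exact hj (by simp [← (hys i j h0).2, hi])
      · refine Finset.sum_eq_zero fun j hj => ?_
        by_contra h0
        exact hi ((hys i j h0).2.trans (Finset.mem_filter.1 hj).2)
    have h2 : ∑ i ∈ Finset.univ.filter (fun i => a i = α), ∑ j, y i j
        = ∑ i ∈ Finset.univ.filter (fun i => a i = α), (p α / q α : ℝ) := by
      refine Finset.sum_congr rfl fun i hi => ?_
      rw [hyr, (Finset.mem_filter.1 hi).2]
    rw [h1, h2, Finset.sum_const, Finset.sum_const, ← h.q_eq α hj, ← h.p_eq α hj, nsmul_eq_mul,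
      nsmul_eq_mul]
    field_simp
  exact (Finset.sum_eq_sum_iff_of_le fun j _ => hyc j).1 htot j (by simp [hα])

open Classical in
/-- Serving the blocks by `y` and distributing the free items proportionally is an outcome. -/
theorem isOutcome (h : Blocks D M a b p q) (hy0 : ∀ i j, 0 ≤ y i j)
    (hys : ∀ i j, y i j ≠ 0 → j ∈ D i ∧ a i = b j)
    (hyr : ∀ i, ∑ j, y i j = p (a i) / q (a i)) (hyc : ∀ j, ∑ i, y i j ≤ 1)
    (F : Finset (Fin n)) (hF : ∀ j ∈ F, b j = M ∧ ∑ i, y i j = 0)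
    (hF' : ∀ j, b j = M → j ∉ F → ∑ i, y i j = 1) :
    IsOutcome D fun i j => if a i < M ∧ j ∈ F
      then ((q (a i) - p (a i) : ℕ) : ℝ) / ((q (a i) : ℝ) * F.card) else y i j := by
  have hreach := h.reflTransGen hy0 hys hyr hyc M le_rfl
  set z : Fin n → Fin n → ℝ := fun i j => if a i < M ∧ j ∈ F
      then ((q (a i) - p (a i) : ℕ) : ℝ) / ((q (a i) : ℝ) * F.card) else 0 with hz
  have hz0 : ∀ i j, 0 ≤ z i j := by
    intro i j
    simp only [hz]
    split_ifs <;> positivity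
  have hyF : ∀ i, ∀ j ∈ F, y i j = 0 := by
    intro i j hj
    exact (Finset.sum_eq_zero_iff_of_nonneg fun i _ => hy0 i j).1 (hF j hj).2 i
      (Finset.mem_univ _)
  have hx : (fun i j => if a i < M ∧ j ∈ F
      then ((q (a i) - p (a i) : ℕ) : ℝ) / ((q (a i) : ℝ) * F.card) else y i j) = y + z := by
    funext i j
    simp only [Pi.add_apply, hz]
    split_ifs with h1
    · simp [hyF i j h1.2]
    · simp
  have hrow : ∀ i, ∑ j, y i j ≤ 1 := by
    intro i
    rw [hyr]
    have h1 : (0 : ℝ) < q (a i) := by exact_mod_cast h.q_pos i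
    rw [div_le_one h1]
    exact_mod_cast h.p_le_q i
  have hrow' : ∀ i, 1 - ∑ j, y i j
      = if a i < M then ((q (a i) - p (a i) : ℕ) : ℝ) / q (a i) else 0 := by
    intro i
    have h1 : (0 : ℝ) < q (a i) := by exact_mod_cast h.q_pos i
    rw [hyr]
    split_ifs with hi
    · rw [Nat.cast_sub (h.p_le_q i), sub_div, div_self h1.ne']
    · have : a i = M := le_antisymm (h.a_le i) (not_lt.1 hi)
      simp [this, h.q_top, h.p_top]
  have hcol' : ∀ j, 1 - ∑ i, y i j = if j ∈ F then 1 else 0 := by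
    intro j
    split_ifs with hj
    · rw [(hF j hj).2, sub_zero]
    · rcases (h.b_le j).lt_or_eq with h1 | h1
      · rw [h.col_eq_one hys hyr hyc h1, sub_self]
      · rw [hF' j h1 hj, sub_self]
  -- There are as many agents as items, so the total shortage of the agents equals what is left of
  -- the items, and only the items in `F` have anything left.
  have htotal : ∑ i, (1 - ∑ j, y i j) = F.card := by
    have : ∑ i, (1 - ∑ j, y i j) = ∑ j, (1 - ∑ i, y i j) := by
      rw [Finset.sum_sub_distrib, Finset.sum_sub_distrib, Finset.sum_comm]
    rw [this]
    simp [hcol']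
  have hzcol : ∀ j, ∑ i, z i j = 1 - ∑ i, y i j := by
    intro j
    rw [hcol']
    split_ifs with hj
    · have hr : (0 : ℝ) < F.card := by exact_mod_cast Finset.card_pos.2 ⟨j, hj⟩
      have : ∀ i, z i j = (1 - ∑ j, y i j) / F.card := by
        intro i
        rw [hrow']
        simp only [hz, hj, and_true]
        split_ifs
        · rw [div_div]
        · simp
      simp only [this]
      rw [← Finset.sum_div, htotal, div_self hr.ne']
    · refine Finset.sum_eq_zero fun i _ => ?_
      simp [hz, hj]
  have hzrow : ∀ i, ∑ j, z i j = 1 - ∑ j, y i j := by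
    intro i
    -- Without free items the total shortage is zero, so nobody lacks anything; the case is separate
    -- because the shares are divided by `F.card`.
    by_cases hr : F.card = 0
    · have h1 : ∀ i ∈ Finset.univ, (1 - ∑ j, y i j) = 0 := by
        refine (Finset.sum_eq_zero_iff_of_nonneg fun i _ => sub_nonneg.2 (hrow i)).1 ?_
        rw [htotal, hr, Nat.cast_zero]
      rw [h1 i (Finset.mem_univ _)]
      refine Finset.sum_eq_zero fun j _ => ?_
      simp [hz, Finset.card_eq_zero.1 hr]
    · have hr' : (F.card : ℝ) ≠ 0 := by exact_mod_cast hr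
      rw [hrow']
      split_ifs with hi
      · simp only [hz, hi, true_and, Finset.sum_ite_mem, Finset.univ_inter, Finset.sum_const,
          nsmul_eq_mul]
        field_simp
      · simp [hz, hi]
  have hbal : IsBalancedAssignment (y + z) := by
    have hc : ∀ j, ∑ i, (y + z) i j = 1 := by
      intro j
      simp only [Pi.add_apply, Finset.sum_add_distrib, hzcol]
      ring
    have hn : ∀ i j, 0 ≤ (y + z) i j := fun i j => add_nonneg (hy0 i j) (hz0 i j)
    refine ⟨fun i j => ⟨hn i j, ?_⟩, hc, ?_⟩
    · rw [← hc j]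
      exact Finset.single_le_sum (f := fun i => (y + z) i j) (fun i _ => hn i j)
        (Finset.mem_univ i)
    · intro i
      simp only [Pi.add_apply, Finset.sum_add_distrib, hzrow]
      ring
  have hzs : ∀ i j, z i j ≠ 0 → a i < M ∧ ∑ k, y i k < 1 ∧ j ∈ Finset.univ.filter
      fun j => M ≤ b j := by
    intro i j hij
    have hij' := hij
    simp only [hz] at hij
    split_ifs at hij with h1
    · refine ⟨h1.1, ?_, ?_⟩
      · rw [← sub_pos, ← hzrow]
        exact lt_of_lt_of_le (lt_of_le_of_ne (hz0 i j) hij'.symm)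
          (Finset.single_le_sum (f := fun j => z i j) (fun j _ => hz0 i j) (Finset.mem_univ j))
      · simp [(hF j h1.2).1]
    · exact absurd rfl hij
  rw [hx]
  -- Agents with the top label are served by one unit step at the end; if there are none, the loop
  -- has already ended.
  by_cases hne : (Finset.univ.filter fun i => M ≤ a i).Nonempty
  · refine ⟨⟨∅, Finset.univ.filter fun j => M ≤ b j, y⟩, ?_, rfl, z, hz0, ?_, rfl, hbal⟩
    · refine hreach.tail ?_
      have hst := Step.unit (D := D) ⟨Finset.univ.filter fun i => M ≤ a i,
        Finset.univ.filter fun j => M ≤ b j, fun i j => if a i < M then y i j else 0⟩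
        (fun i j => if a i < M then 0 else y i j) hne (by
          refine ⟨?_, ?_, ?_, ?_⟩
          · intro i j
            dsimp only
            split_ifs
            · exact le_rfl
            · exact hy0 i j
          · intro i j hij
            dsimp only at hij
            split_ifs at hij with hi
            · exact absurd rfl hij
            · have := hys i j hij
              have h2 : a i = M := le_antisymm (h.a_le i) (not_lt.1 hi)
              refine ⟨by simp [h2], Finset.mem_inter.2 ⟨this.1, ?_⟩⟩
              simp [← this.2, h2]
          · intro i hi
            have h2 : a i = M := le_antisymm (h.a_le i) (Finset.mem_filter.1 hi).2
            simp only [h2, lt_irrefl, if_false]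
            rw [hyr, h2, h.p_top, h.q_top]
            norm_num
          · intro j
            refine (Finset.sum_le_sum fun i _ => ?_).trans (hyc j)
            dsimp only
            split_ifs
            · exact hy0 i j
            · exact le_rfl)
      convert hst using 2
      funext i j
      simp only [Pi.add_apply]
      split_ifs <;> simp
    · exact fun i j hij => (hzs i j hij).2
  · refine ⟨_, hreach, Finset.not_nonempty_iff_eq_empty.1 hne, z, hz0, ?_, ?_, hbal⟩
    · intro i j hij
      obtain ⟨h1, h2⟩ := hzs i j hij
      simpa [h1] using h2
    · have : ∀ i, a i < M := by
        intro i
        by_contra hi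
        exact hne ⟨i, by simpa using hi⟩
      funext i j
      simp [this]

end Blocks

end EPS

namespace RAM

/-! ### Breadth first search

Variables: `0` number of agents, `1` number `V` of nodes, `3` root, `4` head and `5` tail of the
queue, `6` current node, `7` current neighbour, `8` sum of the row of the current node, `9` flag,
`10` end node.
Arrays: `2` residual matrix, `5` offsets of its rows, `6` visited nodes, `7` parents, `8` queue,
`9` marked nodes, `10` capacities, `11` open demands. -/

/-- The entry of the matrix in array `a` in row `w` and column `y`. -/
def Exp.entry (a : ℕ) (w y : Exp) : Exp := .get a (.add (.get 5 w) y)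

/-- Add the residual capacity towards node `7` and put the node into the queue if it is new. -/
def scanNode : Cmd :=
  .seq (.assign 8 (.add (.var 8) (.entry 2 (.var 6) (.var 7))))
  (.ite (.lt (.const 0) (.entry 2 (.var 6) (.var 7)))
    (.ite (.lt (.get 6 (.var 7)) (.const 1))
      (.seq (.store 6 (.var 7) (.const 1))
      (.seq (.store 7 (.var 7) (.var 6))
      (.seq (.store 8 (.var 5) (.var 7))
      (.assign 5 (.add (.var 5) (.const 1)))))) .skip) .skip)

/-- Take a node out of the queue, scan its neighbours and test whether it is saturated. -/
def visitNode : Cmd :=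
  .seq (.assign 6 (.get 8 (.var 4)))
  (.seq (.assign 4 (.add (.var 4) (.const 1)))
  (.seq (.assign 8 (.const 0))
  (.seq (forLoop 7 1 scanNode)
  (.ite (.lt (.var 8) (.get 10 (.var 6)))
    (.seq (.assign 9 (.const 1)) (.seq (.assign 10 (.var 6)) (.assign 4 (.var 5)))) .skip))))

/-- Breadth first search from the node in variable `3` for an unsaturated node. -/
def bfs : Cmd :=
  .seq (forLoop 7 1 (.store 6 (.var 7) (.get 9 (.var 7))))
  (.seq (.seq (.store 8 (.const 0) (.var 3))
    (.seq (.store 6 (.var 3) (.const 1))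
    (.seq (.store 7 (.var 3) (.var 1))
    (.seq (.assign 4 (.const 0))
    (.seq (.assign 5 (.const 1))
    (.assign 9 (.const 0)))))))
  (.loop (.lt (.var 4) (.var 5)) visitNode))

/-- `Q 0, …, Q (t - 1)` are the nodes found so far by a search from `root` that avoids the marked
nodes. -/
structure Queue (V : ℕ) (r : ℕ → ℕ → ℕ) (mark : ℕ → ℕ) (root : ℕ) (vis par Q : ℕ → ℕ)
    (t : ℕ) : Prop where
  lt : ∀ k < t, Q k < V
  inj : ∀ k < t, ∀ l < t, Q k = Q l → k = l
  unmarked : ∀ k < t, mark (Q k) = 0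
  vis_iff : ∀ y < V, vis y ≠ 0 ↔ mark y ≠ 0 ∨ ∃ k < t, Q k = y
  pos : 0 < t
  root_eq : Q 0 = root
  par_root : par root = V
  parent : ∀ k, 0 < k → k < t → ∃ l < k, par (Q k) = Q l ∧ 0 < r (Q l) (Q k)

namespace Queue

variable {V root t : ℕ} {r : ℕ → ℕ → ℕ} {mark vis par Q : ℕ → ℕ}

lemma le (h : Queue V r mark root vis par Q t) : t ≤ V := by
  have := Finset.card_le_card_of_injOn (s := Finset.range t) (t := Finset.range V) Q
    (by
      intro k hk
      simpa using h.lt k (by simpa using hk))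
    (by
      intro k hk l hl hkl
      exact h.inj k (by simpa using hk) l (by simpa using hl) hkl)
  simpa using this

/-- The parent `V` of the root is not a node; it is the end marker when a path is traced back. -/
lemma init (hr : root < V) (hm : mark root = 0) (hvis : ∀ y < V, vis y = mark y) :
    Queue V r mark root (Function.update vis root 1) (Function.update par root V)
      (Function.update Q 0 root) 1 where
  lt := by
    intro k hk
    have : k = 0 := by omega
    simp [this, hr]
  inj := by
    intro k hk l hl _
    omega
  unmarked := by
    intro k hk
    have : k = 0 := by omega
    simp [this, hm]
  vis_iff := by
    intro y hy
    by_cases hyr : y = root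
    · subst hyr
      simp
    · simp only [ne_eq, hyr, not_false_eq_true, Function.update_of_ne, hvis y hy]
      constructor
      · exact Or.inl
      · rintro (h | ⟨k, hk, h⟩)
        · exact h
        · have : k = 0 := by omega
          subst this
          simp only [Function.update_self] at h
          exact absurd h.symm hyr
  pos := one_pos
  root_eq := by simp
  par_root := by simp
  parent := by
    intro k h1 h2
    omega

/-- An unvisited node differs from all nodes in the queue, so no earlier parent or queue entry is
overwritten. -/
lemma push (h : Queue V r mark root vis par Q t) {k y : ℕ} (hk : k < t) (hy : y < V)
    (hv : vis y = 0) (hr : 0 < r (Q k) y) :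
    Queue V r mark root (Function.update vis y 1) (Function.update par y (Q k))
      (Function.update Q t y) (t + 1) := by
  have hnot := (h.vis_iff y hy).not.1 (by simpa using hv)
  push Not at hnot
  obtain ⟨hm, hne⟩ := hnot
  have hQ : ∀ l < t, Function.update Q t y l = Q l := by
    intro l hl
    rw [Function.update_of_ne hl.ne]
  have hpar : ∀ l < t, Function.update par y (Q k) (Q l) = par (Q l) := by
    intro l hl
    rw [Function.update_of_ne (hne l hl)]
  have hcase : ∀ l, l < t + 1 → l < t ∨ l = t := fun l hl => by omega
  refine ⟨?_, ?_, ?_, ?_, ?_, ?_, ?_, ?_⟩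
  · intro l hl
    rcases hcase l hl with h1 | rfl
    · rw [hQ l h1]; exact h.lt l h1
    · simpa using hy
  · intro l hl l' hl' he
    rcases hcase l hl with h1 | rfl <;> rcases hcase l' hl' with h2 | rfl
    · rw [hQ l h1, hQ l' h2] at he
      exact h.inj l h1 l' h2 he
    · rw [hQ l h1, Function.update_self] at he
      exact absurd he (hne l h1)
    · rw [hQ l' h2, Function.update_self] at he
      exact absurd he.symm (hne l' h2)
    · rfl
  · intro l hl
    rcases hcase l hl with h1 | rfl
    · rw [hQ l h1]; exact h.unmarked l h1
    · simpa using hm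
  · intro x hx
    by_cases hxy : x = y
    · subst hxy
      simp only [Function.update_self, ne_eq, one_ne_zero, not_false_eq_true, true_iff]
      exact Or.inr ⟨t, Nat.lt_succ_self t, by simp⟩
    · rw [Function.update_of_ne hxy, h.vis_iff x hx]
      refine or_congr Iff.rfl ⟨?_, ?_⟩
      · rintro ⟨l, hl, rfl⟩
        exact ⟨l, by omega, hQ l hl⟩
      · rintro ⟨l, hl, rfl⟩
        rcases hcase l hl with h1 | rfl
        · exact ⟨l, h1, (hQ l h1).symm⟩
        · simp at hxy
  · omega
  · rw [hQ 0 h.pos]; exact h.root_eq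
  · have : root ≠ y := by
      rw [← h.root_eq]
      exact hne 0 h.pos
    rw [Function.update_of_ne this]
    exact h.par_root
  · intro l hl hl'
    rcases hcase l hl' with h1 | rfl
    · obtain ⟨l', h2, h3, h4⟩ := h.parent l hl h1
      exact ⟨l', h2, by rw [hQ l h1, hQ l' (h2.trans h1), hpar l h1, h3],
        by rw [hQ l h1, hQ l' (h2.trans h1)]; exact h4⟩
    · exact ⟨k, hk, by rw [Function.update_self, Function.update_self, hQ k hk],
        by rw [Function.update_self, hQ k hk]; exact hr⟩

end Queue

/-- The entry of the matrix with `V` columns in array `a`. -/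
def Store.mat (s : Store) (V a w y : ℕ) : ℕ := s.arr a (w * V + y)

/-- The variables and arrays that describe the layout of the matrices. -/
structure Layout (n : ℕ) (s : Store) : Prop where
  agents : s.var 0 = n
  nodes : s.var 1 = 2 * n
  entries : s.var 14 = (2 * n) * (2 * n)
  offset : ∀ w ≤ 2 * n, s.arr 5 w = w * (2 * n)

lemma Layout.frame {n : ℕ} {s s' : Store} {c : Cmd} (h : Layout n s) (hf : Frame c s s')
    (h0 : c.writesVar 0 = false := by rfl) (h1 : c.writesVar 1 = false := by rfl)
    (h2 : c.writesVar 14 = false := by rfl) (h3 : c.writesArr 5 = false := by rfl) :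
    Layout n s' :=
  ⟨(hf.var 0 h0).trans h.agents, (hf.var 1 h1).trans h.nodes, (hf.var 14 h2).trans h.entries,
    fun w hw => by rw [hf.arr 5 h3, h.offset w hw]⟩

variable {n : ℕ} {u : Fin n → Fin n → ℝ}

lemma scanNode_spec {s : Store} (hL : Layout n s) {r : ℕ → ℕ → ℕ} {mark : ℕ → ℕ}
    {root k h : ℕ} (hr : ∀ w < 2 * n, ∀ y < 2 * n, s.mat (2 * n) 2 w y = r w y)
    (hk : k < 2 * n) (hsk : s.var 7 = k) (hht : h < s.var 5) (hw : s.var 6 = s.arr 8 h)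
    (hq : Queue (2 * n) r mark root (s.arr 6) (s.arr 7) (s.arr 8) (s.var 5)) :
    Ends u scanNode s 100 (fun s' =>
      h < s'.var 5 ∧ s'.var 6 = s'.arr 8 h ∧
      Queue (2 * n) r mark root (s'.arr 6) (s'.arr 7) (s'.arr 8) (s'.var 5) ∧
      s'.var 8 = s.var 8 + r (s.var 6) k ∧
      (∀ y, s.arr 6 y ≠ 0 → s'.arr 6 y ≠ 0) ∧ (0 < r (s.var 6) k → s'.arr 6 k ≠ 0) ∧
      (∀ l < s.var 5, s'.arr 8 l = s.arr 8 l) ∧ s'.var 6 = s.var 6) := by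
  have hwlt : s.var 6 < 2 * n := hw ▸ hq.lt h hht
  have hent : s.arr 2 (s.arr 5 (s.var 6) + k) = r (s.var 6) k := by
    rw [hL.offset _ hwlt.le]
    exact hr _ hwlt _ hk
  refine Ends.of_exec rfl ?_ (by decide)
  by_cases h1 : 0 < r (s.var 6) k
  · by_cases h2 : s.arr 6 k = 0
    · have hp := hq.push hht hk h2 (by rwa [← hw])
      have hne : h ≠ s.var 5 := hht.ne
      have he : scanNode.exec u s = ⟨Function.update (Function.update s.var 8
          (s.var 8 + r (s.var 6) k)) 5 (s.var 5 + 1),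
          Function.update (Function.update (Function.update s.arr 6 (Function.update (s.arr 6) k 1))
            7 (Function.update (s.arr 7) k (s.var 6)))
            8 (Function.update (s.arr 8) (s.var 5) k)⟩ := by
        simp [scanNode, Cmd.exec, Exp.entry, Exp.eval, Test.Holds, hent, hsk, h1, h2]
      rw [he]
      refine ⟨?_, by simp [hne, hw], by simpa [hw] using hp, by simp, ?_, by simp, ?_, by simp⟩
      · simp only [Function.update_self]
        omega
      · intro y hy
        by_cases hyk : y = k
        · simp [hyk]
        · simpa [hyk] using hy
      · intro l hl
        simp [hl.ne]
    · simp [scanNode, Cmd.exec, Exp.entry, Exp.eval, Test.Holds, hent, hsk, h1, h2, hht, hw.symm,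
        hq]
  · simp [scanNode, Cmd.exec, Exp.entry, Exp.eval, Test.Holds, hent, hsk, h1, hht, hw.symm,
        hq]

end RAM

namespace RAM

variable {n : ℕ} {u : Fin n → Fin n → ℝ}

/-- The first `h` nodes of the queue are saturated and all their neighbours have been visited. -/
def Scanned (V : ℕ) (r : ℕ → ℕ → ℕ) (cap vis Q : ℕ → ℕ) (h : ℕ) : Prop :=
  ∀ k < h, (∀ y < V, 0 < r (Q k) y → vis y ≠ 0) ∧
    cap (Q k) ≤ ∑ y ∈ Finset.range V, r (Q k) y

/-- The search has found the unsaturated node `e`. -/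
def Found (V : ℕ) (r : ℕ → ℕ → ℕ) (cap Q : ℕ → ℕ) (t e : ℕ) : Prop :=
  ∃ k < t, e = Q k ∧ ∑ y ∈ Finset.range V, r (Q k) y < cap (Q k)

lemma visitNode_spec {s : Store} (hL : Layout n s) {r : ℕ → ℕ → ℕ} {mark : ℕ → ℕ} {root : ℕ}
    (hr : ∀ w < 2 * n, ∀ y < 2 * n, s.mat (2 * n) 2 w y = r w y)
    (hq : Queue (2 * n) r mark root (s.arr 6) (s.arr 7) (s.arr 8) (s.var 5))
    (hh : s.var 4 < s.var 5) (hs : Scanned (2 * n) r (s.arr 10) (s.arr 6) (s.arr 8) (s.var 4)) :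
    Ends u visitNode s (2 * n * 108 + 100) (fun s' =>
      Queue (2 * n) r mark root (s'.arr 6) (s'.arr 7) (s'.arr 8) (s'.var 5) ∧
      s.var 4 < s'.var 4 ∧ s'.var 4 ≤ s'.var 5 ∧
      ((s'.var 9 = s.var 9 ∧ Scanned (2 * n) r (s'.arr 10) (s'.arr 6) (s'.arr 8) (s'.var 4)) ∨
        (s'.var 9 = 1 ∧ s'.var 4 = s'.var 5 ∧
          Found (2 * n) r (s'.arr 10) (s'.arr 8) (s'.var 5) (s'.var 10)))) := by
  set h := s.var 4 with hhd
  set w := s.arr 8 h with hw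
  have hwlt : w < 2 * n := hq.lt h hh
  refine Ends.next (T₁ := 3) (T₂ := 2 * n * 108 + 97) (P := fun s' => s' = s.setVar 6 w)
    (Ends.of_exec rfl (by simp [Cmd.exec, Exp.eval, Store.setVar, hw, hhd]) (by decide)) (by omega) ?_
  rintro s₁ - rfl
  refine Ends.next (T₁ := 4) (T₂ := 2 * n * 108 + 90)
    (P := fun s' => s' = (s.setVar 6 w).setVar 4 (h + 1))
    (Ends.of_exec rfl (by simp [Cmd.exec, Exp.eval, Store.setVar, hw, hhd]) (by decide)) (by omega) ?_
  rintro s₂ - rfl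
  refine Ends.next (T₁ := 2) (T₂ := 2 * n * 108 + 80)
    (P := fun s' => s' = ((s.setVar 6 w).setVar 4 (h + 1)).setVar 8 0)
    (Ends.of_exec rfl (by simp [Cmd.exec, Exp.eval, Store.setVar]) (by decide)) (by omega) ?_
  rintro s₃ hf₃ hs₃
  have hL₃ : Layout n s₃ := by
    subst hs₃
    exact ⟨by simpa using hL.agents, by simpa using hL.nodes, by simpa using hL.entries,
      by simpa using hL.offset⟩
  refine Ends.next (T₁ := 2 * n * (100 + 8) + 6) (T₂ := 40) (Ends.forLoop
    (fun k s' => h < s'.var 5 ∧ s'.var 6 = s'.arr 8 h ∧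
      Queue (2 * n) r mark root (s'.arr 6) (s'.arr 7) (s'.arr 8) (s'.var 5) ∧
      s'.var 8 = ∑ y ∈ Finset.range k, r w y ∧
      (∀ y, s.arr 6 y ≠ 0 → s'.arr 6 y ≠ 0) ∧ (∀ y < k, 0 < r w y → s'.arr 6 y ≠ 0) ∧
      (∀ l ≤ h, s'.arr 8 l = s.arr 8 l) ∧ s'.var 6 = w)
    hL₃.nodes ?_ ?_ le_rfl) (by omega) ?_
  · subst hs₃
    simp [hh, hw, hq]
  · rintro k s' hk hf hsk ⟨h1, h2, h3, h4, h5, h6, h7, h8⟩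
    have hr' : ∀ w < 2 * n, ∀ y < 2 * n, s'.mat (2 * n) 2 w y = r w y := by
      intro w hw y hy
      rw [← hr w hw y hy]
      simp only [Store.mat, hf.arr 2, hs₃, Store.setVar_arr]
    refine (scanNode_spec (hL₃.frame hf) hr' hk hsk h1 h2 h3).mono le_rfl ?_
    rintro s'' ⟨g1, g2, g3, g4, g5, g6, g7, g8⟩
    refine ⟨by simpa using g1, by simpa using g2, by simpa using g3, ?_, ?_, ?_, ?_, ?_⟩
    · simp only [Store.setVar_var, Nat.reduceEqDiff, if_false]
      rw [g4, h4, h8, Finset.sum_range_succ]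
    · exact fun y hy => g5 y (h5 y hy)
    · intro y hy hry
      rcases Nat.lt_succ_iff_lt_or_eq.1 hy with h | rfl
      · exact g5 y (h6 y h hry)
      · exact g6 (by rwa [h8])
    · intro l hl
      exact (g7 l (by omega)).trans (h7 l hl)
    · simpa using g8.trans h8
  · rintro s₄ hf₄ ⟨-, h1, h2, h3, h4, h5, h6, h7, h8⟩
    have e10 : s₄.arr 10 = s.arr 10 := by
      rw [hf₄.arr 10, hs₃]
      rfl
    have e9 : s₄.var 9 = s.var 9 := by
      rw [hf₄.var 9, hs₃]
      simp
    have e4 : s₄.var 4 = h + 1 := by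
      rw [hf₄.var 4, hs₃]
      simp
    have hsc : ∀ k < h, (∀ y < 2 * n, 0 < r (s₄.arr 8 k) y → s₄.arr 6 y ≠ 0) ∧
        s₄.arr 10 (s₄.arr 8 k) ≤ ∑ y ∈ Finset.range (2 * n), r (s₄.arr 8 k) y := by
      intro k hk
      rw [h7 k hk.le, e10]
      exact ⟨fun y hy hry => h5 y ((hs k hk).1 y hy hry), (hs k hk).2⟩
    refine Ends.of_exec rfl ?_ (by decide)
    by_cases hc : s₄.var 8 < s₄.arr 10 w
    · have he : (Cmd.ite (.lt (.var 8) (.get 10 (.var 6)))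
          (.seq (.assign 9 (.const 1)) (.seq (.assign 10 (.var 6)) (.assign 4 (.var 5))))
          .skip).exec u s₄ = ((s₄.setVar 9 1).setVar 10 w).setVar 4 (s₄.var 5) := by
        simp [Cmd.exec, Test.Holds, Exp.eval, h8, hc, Store.setVar]
      rw [he]
      refine ⟨by simpa using h3, by simpa using h1, by simp, Or.inr ⟨by simp, by simp, h, ?_⟩⟩
      simp only [Store.setVar_arr, Store.setVar_var]
      refine ⟨by simpa using h1, ?_, ?_⟩
      · simp [h7 h le_rfl, hw]
      · rw [h7 h le_rfl, ← hw, ← h4]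
        exact hc
    · have he : (Cmd.ite (.lt (.var 8) (.get 10 (.var 6)))
          (.seq (.assign 9 (.const 1)) (.seq (.assign 10 (.var 6)) (.assign 4 (.var 5))))
          .skip).exec u s₄ = s₄ := by
        simp [Cmd.exec, Test.Holds, Exp.eval, h8, hc]
      rw [he]
      refine ⟨h3, by omega, by omega, Or.inl ⟨e9, ?_⟩⟩
      rw [e4]
      intro k hk
      rcases Nat.lt_succ_iff_lt_or_eq.1 hk with h' | rfl
      · exact hsc k h'
      · rw [h7 h le_rfl, ← hw, ← h4]
        exact ⟨h6, not_lt.1 hc⟩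

/-- The head of the queue moves strictly forward and is bounded by the number of nodes, and each
node is scanned in linear time; hence the quadratic bound. A search that fails has exhausted its
queue, so every node found is saturated and has only visited neighbours. -/
lemma bfs_spec {s : Store} (hL : Layout n s) {r : ℕ → ℕ → ℕ} {mark cap : ℕ → ℕ} {root : ℕ}
    (hr : ∀ w < 2 * n, ∀ y < 2 * n, s.mat (2 * n) 2 w y = r w y) (hmark : s.arr 9 = mark)
    (hcap : s.arr 10 = cap) (hroot : s.var 3 = root) (hlt : root < 2 * n) (hm : mark root = 0) :
    Ends u bfs s (1000 * (2 * n * (2 * n))) (fun s' =>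
      Queue (2 * n) r mark root (s'.arr 6) (s'.arr 7) (s'.arr 8) (s'.var 5) ∧
      ((s'.var 9 = 0 ∧ Scanned (2 * n) r cap (s'.arr 6) (s'.arr 8) (s'.var 5)) ∨
        (s'.var 9 = 1 ∧ Found (2 * n) r cap (s'.arr 8) (s'.var 5) (s'.var 10)))) := by
  have hV : 1 ≤ 2 * n := by omega
  refine Ends.next (T₁ := 2 * n * (4 + 8) + 6) (T₂ := 2 * n * (2 * n * 108 + 200) + 100)
    (Ends.forLoop (fun k s' => ∀ y < k, s'.arr 6 y = mark y) hL.nodes (by simp) ?_ le_rfl)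
    (by nlinarith) ?_
  · intro k s' hk hf hsk hI
    refine Ends.of_exec rfl ?_ (by decide)
    intro y hy
    have e : s'.arr 9 = mark := (hf.arr 9).trans hmark
    rcases Nat.lt_succ_iff_lt_or_eq.1 hy with h | rfl
    · simp [Cmd.exec, Exp.eval, hsk, e, h.ne, hI y h]
    · simp [Cmd.exec, Exp.eval, hsk, e]
  rintro s₁ hf₁ ⟨-, hvis⟩
  have hL₁ := hL.frame hf₁
  have hroot₁ : s₁.var 3 = root := (hf₁.var 3).trans hroot
  refine Ends.next (T₁ := 40) (T₂ := 2 * n * (2 * n * 108 + 200) + 60)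
    (P := fun s' => s'.arr 6 = Function.update (s₁.arr 6) root 1 ∧
      s'.arr 7 = Function.update (s₁.arr 7) root (2 * n) ∧
      s'.arr 8 = Function.update (s₁.arr 8) 0 root ∧ s'.var 4 = 0 ∧ s'.var 5 = 1 ∧ s'.var 9 = 0)
    (Ends.of_exec rfl (by simp [Cmd.exec, Exp.eval, hroot₁, hL₁.nodes]) (by decide)) (by omega) ?_
  rintro s₂ hf₂ ⟨e6, e7, e8, e4, e5, e9⟩
  have hL₂ := hL₁.frame hf₂
  have hcap₂ : s₂.arr 10 = cap := ((hf₂.arr 10).trans (hf₁.arr 10)).trans hcap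
  have hmat₂ : s₂.arr 2 = s.arr 2 := (hf₂.arr 2).trans (hf₁.arr 2)
  have hloop := Ends.loop (u := u) (s := s₂) (c := visitNode) (b := .lt (.var 4) (.var 5))
    (B := 2 * n * 108 + 100) (T := 2 * n * (2 * n * 108 + 200) + 60)
    (fun s' => Queue (2 * n) r mark root (s'.arr 6) (s'.arr 7) (s'.arr 8) (s'.var 5) ∧
      s'.var 4 ≤ s'.var 5 ∧
      ((s'.var 9 = 0 ∧ Scanned (2 * n) r cap (s'.arr 6) (s'.arr 8) (s'.var 4)) ∨
        (s'.var 9 = 1 ∧ s'.var 4 = s'.var 5 ∧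
          Found (2 * n) r cap (s'.arr 8) (s'.var 5) (s'.var 10))))
    (fun s' => 2 * n - s'.var 4)
    (by
      rw [e6, e7, e8, e5, e4, e9]
      exact ⟨Queue.init hlt hm hvis, by omega, Or.inl ⟨rfl, fun k hk => by omega⟩⟩)
    (by
      rintro s' hf ⟨hq, hle, hI⟩ hb
      have hb' : s'.var 4 < s'.var 5 := hb
      have hr' : ∀ w < 2 * n, ∀ y < 2 * n, s'.mat (2 * n) 2 w y = r w y := by
        intro w hw y hy
        rw [← hr w hw y hy]
        simp only [Store.mat, hf.arr 2, hmat₂]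
      have hcap' : s'.arr 10 = cap := (hf.arr 10).trans hcap₂
      rcases hI with ⟨h9, hs⟩ | ⟨-, h45, -⟩
      · have hv := visitNode_spec (u := u) (hL₂.frame hf) hr' hq hb' (by rwa [hcap'])
        refine hv.frame.mono le_rfl ?_
        rintro s'' ⟨hf', hq', hlt', hle', hI'⟩
        have hcap'' : s''.arr 10 = cap := (hf'.arr 10).trans hcap'
        rw [hcap''] at hI'
        refine ⟨⟨hq', hle', ?_⟩, ?_⟩
        · rcases hI' with ⟨h, h'⟩ | h
          · exact Or.inl ⟨h.trans h9, h'⟩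
          · exact Or.inr h
        · have := hq'.le
          omega
      · omega)
    (by
      rw [e4]
      simp only [Test.cost, Exp.cost]
      have : (2 * n - 0) * (2 * n * 108 + 100 + (1 + 1 + 1 + 1)) ≤ 2 * n * (2 * n * 108 + 200) :=
        Nat.mul_le_mul (by omega) (by omega)
      omega)
  refine hloop.mono le_rfl ?_
  rintro s' ⟨⟨hq, hle, hI⟩, hb⟩
  have hb' : ¬ s'.var 4 < s'.var 5 := hb
  have h45 : s'.var 4 = s'.var 5 := by omega
  refine ⟨hq, ?_⟩
  rcases hI with ⟨h9, hs⟩ | ⟨h9, -, h⟩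
  · exact Or.inl ⟨h9, h45 ▸ hs⟩
  · exact Or.inr ⟨h9, h⟩

end RAM

namespace RAM

variable {n : ℕ} {u : Fin n → Fin n → ℝ}

/-! ### Augmentation -/

/-- A loop whose invariant carries a decreasing index. -/
lemma Ends.loopIdx {b : Test} {c : Cmd} {s : Store} {B T N : ℕ} (I : ℕ → Store → Prop)
    (hI : I N s)
    (hstep : ∀ k s', Frame c s s' → I k s' → b.Holds u s' →
      Ends u c s' B (fun s'' => ∃ l < k, I l s''))
    (hT : N * (B + (b.cost + 1)) + (b.cost + 1) ≤ T) :
    Ends u (.loop b c) s T (fun s' => (∃ k, I k s') ∧ ¬ b.Holds u s') := by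
  refine Ends.loop (fun s' => ∃ k, I k s') (fun s' => sInf {k | I k s'}) ⟨N, hI⟩ (B := B) ?_ ?_
  · rintro s' hf ⟨k, hk⟩ hb
    have hmem : I (sInf {k | I k s'}) s' := Nat.sInf_mem (s := {k | I k s'}) ⟨k, hk⟩
    refine (hstep _ s' hf hmem hb).mono le_rfl ?_
    rintro s'' ⟨l, hl, hI'⟩
    exact ⟨⟨l, hI'⟩, lt_of_le_of_lt (Nat.sInf_le hI') hl⟩
  · have : sInf {k | I k s} ≤ N := Nat.sInf_le hI
    have := Nat.mul_le_mul_right (B + (b.cost + 1)) this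
    omega

/-- The matrix `r` with the entry in row `w` and column `y` replaced by `v`. -/
def setEntry (r : ℕ → ℕ → ℕ) (w y v : ℕ) : ℕ → ℕ → ℕ :=
  fun w' y' => if w' = w ∧ y' = y then v else r w' y'

lemma sum_range_ite {N c v : ℕ} (f : ℕ → ℕ) (hc : c < N) :
    (∑ x ∈ Finset.range N, if x = c then v else f x) + f c
      = ∑ x ∈ Finset.range N, f x + v := by
  rw [← Finset.add_sum_erase _ _ (Finset.mem_range.2 hc),
    ← Finset.add_sum_erase (Finset.range N) f (Finset.mem_range.2 hc), if_pos rfl]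
  have : ∑ x ∈ (Finset.range N).erase c, (if x = c then v else f x)
      = ∑ x ∈ (Finset.range N).erase c, f x :=
    Finset.sum_congr rfl fun x hx => if_neg (Finset.ne_of_mem_erase hx)
  rw [this]
  ring

/-- Old and new entry stand on opposite sides, which avoids truncated subtraction. -/
lemma sum_row_setEntry {N w y v : ℕ} (r : ℕ → ℕ → ℕ) (hy : y < N) (w' : ℕ) :
    ∑ x ∈ Finset.range N, setEntry r w y v w' x + (if w' = w then r w y else 0)
      = ∑ x ∈ Finset.range N, r w' x + if w' = w then v else 0 := by
  by_cases h : w' = w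
  · subst h
    simp only [setEntry, true_and, if_true]
    exact sum_range_ite _ hy
  · simp [setEntry, h]

lemma sum_col_setEntry {N w y v : ℕ} (r : ℕ → ℕ → ℕ) (hw : w < N) (y' : ℕ) :
    ∑ x ∈ Finset.range N, setEntry r w y v x y' + (if y' = y then r w y else 0)
      = ∑ x ∈ Finset.range N, r x y' + if y' = y then v else 0 := by
  by_cases h : y' = y
  · subst h
    simp only [setEntry, and_true, if_true]
    exact sum_range_ite (fun x => r x y') hw
  · simp [setEntry, h]

lemma index_injective {V w y w' y' : ℕ} (hy : y < V) (hy' : y' < V)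
    (h : w * V + y = w' * V + y') : w = w' ∧ y = y' := by
  have h1 : (y + V * w) / V = w := by
    rw [Nat.add_mul_div_left _ _ (by omega), Nat.div_eq_of_lt hy, zero_add]
  have h2 : (y' + V * w') / V = w' := by
    rw [Nat.add_mul_div_left _ _ (by omega), Nat.div_eq_of_lt hy', zero_add]
  have : w = w' := by
    rw [← h1, ← h2]
    congr 1
    linarith [mul_comm V w, mul_comm V w']
  subst this
  exact ⟨rfl, by omega⟩

lemma update_index {V w y w' y' v : ℕ} (f : ℕ → ℕ) (hy : y < V) (hy' : y' < V) :
    Function.update f (w * V + y) v (w' * V + y')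
      = setEntry (fun w y => f (w * V + y)) w y v w' y' := by
  simp only [setEntry]
  split_ifs with h
  · rw [h.1, h.2, Function.update_self]
  · rw [Function.update_of_ne]
    intro he
    exact h (index_injective hy' hy he)

/-- One unit is missing at the node `y` of the search tree (`y = 2 * n` if it has been taken from
the root), `r₀` being the matrix that was searched. -/
structure Augmenting (n : ℕ) (r₀ : ℕ → ℕ → ℕ) (mark cap : ℕ → ℕ) (root : ℕ) (Q : ℕ → ℕ)
    (t : ℕ) (r : ℕ → ℕ → ℕ) (y k : ℕ) : Prop where
  bip : ∀ w < 2 * n, ∀ x < 2 * n, 0 < r w x → (w < n ↔ n ≤ x)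
  agent_row : ∀ i < n, ∀ x < 2 * n, r i x = r₀ i x
  supp : ∀ w, n ≤ w → w < 2 * n → ∀ i < n, 0 < r w i → 0 < r₀ i w
  row : ∀ w, n ≤ w → w < 2 * n →
    ∑ x ∈ Finset.range (2 * n), r w x + (if w = y then 1 else 0) ≤ cap w
  col : ∀ i < n, ∑ w ∈ Finset.range (2 * n), r w i
    = ∑ w ∈ Finset.range (2 * n), r₀ w i + if y = 2 * n ∧ i = root then 1 else 0
  frame : ∀ w < 2 * n, ∀ x < 2 * n, mark w ≠ 0 ∨ mark x ≠ 0 → r w x = r₀ w x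
  tree : y = 2 * n ∨ ∃ q < t, k = q + 1 ∧ Q q = y ∧ n ≤ y ∧
    ∀ l ≤ q, ∀ w < 2 * n, r w (Q l) = r₀ w (Q l)

/-- Let `i` be the agent from whom the item `y` was reached, and `z` the item from which `i` was
reached. She takes one unit more from `y` and one less from `z`; her total is unchanged and the
missing unit moves to `z`. At the root there is no `z`: the marker `2 * n` stands in for it and the
root gains a unit. Queue positions decrease along the path, so the columns of the agents still to
come are those of the searched matrix. -/
lemma Augmenting.step {r₀ r : ℕ → ℕ → ℕ} {mark cap vis par Q : ℕ → ℕ} {root t y k : ℕ}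
    (hq : Queue (2 * n) r₀ mark root vis par Q t) (hroot : root < n)
    (hb₀ : ∀ w < 2 * n, ∀ x < 2 * n, 0 < r₀ w x → (w < n ↔ n ≤ x))
    (h : Augmenting n r₀ mark cap root Q t r y k) (hy : y < 2 * n) :
    par y < n ∧ par (par y) ≤ 2 * n ∧ ∃ l < k, Augmenting n r₀ mark cap root Q t
      (setEntry (setEntry r y (par y) (r y (par y) + 1)) (par (par y)) (par y)
        (setEntry r y (par y) (r y (par y) + 1) (par (par y)) (par y) - 1)) (par (par y)) l := by
  obtain ⟨q, hqt, rfl, hQq, hny, hcol⟩ := h.tree.resolve_left hy.ne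
  have hq0 : 0 < q := by
    rcases Nat.eq_zero_or_pos q with h0 | h0
    · subst h0
      have := hq.root_eq
      omega
    · exact h0
  obtain ⟨q', hq', hpar, hpos⟩ := hq.parent q hq0 hqt
  rw [hQq] at hpar hpos
  have hq't : q' < t := hq'.trans hqt
  set i := par y with hi
  rw [← hpar] at hpos
  have hi2 : i < 2 * n := hpar ▸ hq.lt q' hq't
  have hin : i < n := (hb₀ i hi2 y hy hpos).2 hny
  have hmi : mark i = 0 := hpar ▸ hq.unmarked q' hq't
  have hmy : mark y = 0 := hQq ▸ hq.unmarked q hqt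
  set r₁ := setEntry r y i (r y i + 1) with hr₁
  have r₁_ne : ∀ w x, ¬ (w = y ∧ x = i) → r₁ w x = r w x := fun w x hne => by
    simp only [hr₁, setEntry, if_neg hne]
  have r₁_row : ∀ w, ∑ x ∈ Finset.range (2 * n), r₁ w x
      = ∑ x ∈ Finset.range (2 * n), r w x + if w = y then 1 else 0 := by
    intro w
    have := sum_row_setEntry (v := r y i + 1) (w := y) r hi2 w
    rw [← hr₁] at this
    split_ifs at this ⊢ <;> omega
  have r₁_col : ∀ x, ∑ w ∈ Finset.range (2 * n), r₁ w x
      = ∑ w ∈ Finset.range (2 * n), r w x + if x = i then 1 else 0 := by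
    intro x
    have := sum_col_setEntry (v := r y i + 1) (y := i) r hy x
    rw [← hr₁] at this
    split_ifs at this ⊢ <;> omega
  rcases Nat.eq_zero_or_pos q' with h0 | h0
  · subst h0
    rw [hq.root_eq] at hpar
    have hpi : par i = 2 * n := by rw [hpar, hq.par_root]
    rw [hpi]
    refine ⟨hin, le_rfl, 0, by omega, ?_⟩
    -- Row `2 * n` lies outside of the matrix, so the subtraction at the end marker affects no entry
    -- that counts.
    have e : ∀ w < 2 * n, ∀ x, setEntry r₁ (2 * n) i (r₁ (2 * n) i - 1) w x = r₁ w x := by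
      intro w hw x
      simp [setEntry, hw.ne]
    have erow : ∀ w < 2 * n, ∑ x ∈ Finset.range (2 * n),
        setEntry r₁ (2 * n) i (r₁ (2 * n) i - 1) w x = ∑ x ∈ Finset.range (2 * n), r₁ w x :=
      fun w hw => Finset.sum_congr rfl fun x _ => e w hw x
    have ecol : ∀ x, ∑ w ∈ Finset.range (2 * n),
        setEntry r₁ (2 * n) i (r₁ (2 * n) i - 1) w x = ∑ w ∈ Finset.range (2 * n), r₁ w x :=
      fun x => Finset.sum_congr rfl fun w hw => e w (Finset.mem_range.1 hw) x
    refine ⟨?_, ?_, ?_, ?_, ?_, ?_, Or.inl rfl⟩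
    · intro w hw x hx hwx
      rw [e w hw] at hwx
      by_cases hc : w = y ∧ x = i
      · omega
      · rw [r₁_ne w x hc] at hwx
        exact h.bip w hw x hx hwx
    · intro j hj x hx
      rw [e j (by omega), r₁_ne j x (by omega)]
      exact h.agent_row j hj x hx
    · intro w hw hw2 j hj hwj
      rw [e w hw2] at hwj
      by_cases hc : w = y ∧ j = i
      · rw [hc.1, hc.2]; exact hpos
      · rw [r₁_ne w j hc] at hwj
        exact h.supp w hw hw2 j hj hwj
    · intro w hw hw2
      rw [erow w hw2, r₁_row w, if_neg hw2.ne]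
      exact h.row w hw hw2
    · intro j hj
      have h1 := h.col j hj
      rw [if_neg (fun h' => hy.ne h'.1)] at h1
      rw [ecol, r₁_col, h1, hpar]
      simp
    · intro w hw x hx hm
      rw [e w hw, r₁_ne w x]
      · exact h.frame w hw x hx hm
      · rintro ⟨rfl, rfl⟩
        omega
  · obtain ⟨q'', hq'', hpar', hpos'⟩ := hq.parent q' h0 hq't
    rw [← hpar] at hpar' hpos'
    have hq''t : q'' < t := hq''.trans hq't
    set z := par i with hz
    rw [← hpar'] at hpos'
    have hz2 : z < 2 * n := hpar' ▸ hq.lt q'' hq''t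
    have hzn : n ≤ z := by
      have := hb₀ z hz2 i hi2 hpos'
      omega
    have hzy : z ≠ y := by
      rw [hpar', ← hQq]
      intro he
      have := hq.inj _ hq''t _ hqt he
      omega
    have hmz : mark z = 0 := hpar' ▸ hq.unmarked q'' hq''t
    -- The column of `i` is still that of the searched matrix, so the entry along which the search
    -- went is positive and the subtraction below is not truncated.
    have hrzi : 0 < r₁ z i := by
      rw [r₁_ne z i (fun h' => hzy h'.1), hpar, hcol q' hq'.le z hz2, ← hpar]
      exact hpos'
    refine ⟨hin, hz2.le, q'' + 1, by omega, ?_⟩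
    set r₂ := setEntry r₁ z i (r₁ z i - 1) with hr₂
    have r₂_le : ∀ w x, r₂ w x ≤ r₁ w x := by
      intro w x
      simp only [hr₂, setEntry]
      split_ifs with hc
      · rw [hc.1, hc.2]; omega
      · exact le_rfl
    have r₂_ne : ∀ w x, ¬ (w = z ∧ x = i) → r₂ w x = r₁ w x := fun w x hne => by
      simp only [hr₂, setEntry, if_neg hne]
    have r₂_row : ∀ w, ∑ x ∈ Finset.range (2 * n), r₂ w x + (if w = z then 1 else 0)
        = ∑ x ∈ Finset.range (2 * n), r₁ w x := by
      intro w
      have := sum_row_setEntry (v := r₁ z i - 1) (w := z) r₁ hi2 w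
      rw [← hr₂] at this
      split_ifs at this ⊢ <;> omega
    have r₂_col : ∀ x, ∑ w ∈ Finset.range (2 * n), r₂ w x + (if x = i then 1 else 0)
        = ∑ w ∈ Finset.range (2 * n), r₁ w x := by
      intro x
      have := sum_col_setEntry (v := r₁ z i - 1) (y := i) r₁ hz2 x
      rw [← hr₂] at this
      split_ifs at this ⊢ <;> omega
    refine ⟨?_, ?_, ?_, ?_, ?_, ?_, Or.inr ⟨q'', hq''t, rfl, hpar'.symm, hzn, ?_⟩⟩
    · intro w hw x hx hwx
      have hwx' := hwx.trans_le (r₂_le w x)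
      by_cases hc : w = y ∧ x = i
      · omega
      · rw [r₁_ne w x hc] at hwx'
        exact h.bip w hw x hx hwx'
    · intro j hj x hx
      rw [r₂_ne j x (by omega), r₁_ne j x (by omega)]
      exact h.agent_row j hj x hx
    · intro w hw hw2 j hj hwj
      have hwj' := hwj.trans_le (r₂_le w j)
      by_cases hc : w = y ∧ j = i
      · rw [hc.1, hc.2]; exact hpos
      · rw [r₁_ne w j hc] at hwj'
        exact h.supp w hw hw2 j hj hwj'
    · intro w hw hw2
      rw [r₂_row w, r₁_row w]
      exact h.row w hw hw2
    · intro j hj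
      have h1 := h.col j hj
      have h2 := r₂_col j
      have h3 := r₁_col j
      rw [if_neg (fun h' => hy.ne h'.1)] at h1
      rw [if_neg (fun h' => hz2.ne h'.1)]
      omega
    · intro w hw x hx hm
      rw [r₂_ne w x, r₁_ne w x]
      · exact h.frame w hw x hx hm
      · rintro ⟨rfl, rfl⟩
        omega
      · rintro ⟨rfl, rfl⟩
        omega
    · intro l hl w hw
      have hli : Q l ≠ i := by
        rw [hpar]
        intro he
        have := hq.inj l (by omega) q' hq't he
        omega
      rw [r₂_ne w _ (fun h' => hli h'.2), r₁_ne w _ (fun h' => hli h'.2)]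
      exact hcol l (by omega) w hw

/-- Shift one unit along the path from node `10` to the root of the search tree. -/
def augment : Cmd :=
  .seq (.assign 11 (.var 10))
  (.loop (.lt (.var 11) (.var 1))
    (.seq (.assign 12 (.get 7 (.var 11)))
    (.seq (.store 2 (.add (.get 5 (.var 11)) (.var 12))
      (.add (.entry 2 (.var 11) (.var 12)) (.const 1)))
    (.seq (.assign 11 (.get 7 (.var 12)))
    (.store 2 (.add (.get 5 (.var 11)) (.var 12))
      (.sub (.entry 2 (.var 11) (.var 12)) (.const 1)))))))

/-- The position in the queue bounds the number of rounds. The matrix is tracked in all rows, not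
only in those of nodes, since the last round writes to row `2 * n`. -/
lemma augment_spec {s : Store} (hL : Layout n s) {r₀ : ℕ → ℕ → ℕ} {mark cap vis par Q : ℕ → ℕ}
    {root t : ℕ} (hq : Queue (2 * n) r₀ mark root vis par Q t) (hroot : root < n)
    (hb₀ : ∀ w < 2 * n, ∀ x < 2 * n, 0 < r₀ w x → (w < n ↔ n ≤ x))
    (hr : ∀ w, ∀ y < 2 * n, s.mat (2 * n) 2 w y = r₀ w y) (hpar : s.arr 7 = par)
    (hs₀ : ∀ w, n ≤ w → w < 2 * n → ∀ i < n, 0 < r₀ w i → 0 < r₀ i w)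
    (hrow : ∀ w, n ≤ w → w < 2 * n → ∑ x ∈ Finset.range (2 * n), r₀ w x ≤ cap w)
    (hcap : ∀ i < n, cap i = 0) (hf : Found (2 * n) r₀ cap Q t (s.var 10)) :
    Ends u augment s (2 * n * 100 + 100) (fun s' => ∃ r k,
      (∀ w, ∀ y < 2 * n, s'.mat (2 * n) 2 w y = r w y) ∧
      Augmenting n r₀ mark cap root Q t r (2 * n) k) := by
  obtain ⟨q, hqt, he, hlt⟩ := hf
  have hen : n ≤ s.var 10 := by
    by_contra hcon
    rw [← he, hcap _ (not_le.1 hcon)] at hlt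
    omega
  refine Ends.next (T₁ := 2) (T₂ := 2 * n * 100 + 50) (P := fun s' => s' = s.setVar 11 (s.var 10))
    (Ends.of_exec rfl (by simp [Cmd.exec, Exp.eval, Store.setVar]) (by decide)) (by omega) ?_
  intro s₁ hf₁ hs₁
  have hL₁ := hL.frame hf₁
  have hloop := Ends.loopIdx (u := u) (s := s₁) (b := .lt (.var 11) (.var 1))
    (c := .seq (.assign 12 (.get 7 (.var 11)))
    (.seq (.store 2 (.add (.get 5 (.var 11)) (.var 12))
      (.add (.entry 2 (.var 11) (.var 12)) (.const 1)))
    (.seq (.assign 11 (.get 7 (.var 12)))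
    (.store 2 (.add (.get 5 (.var 11)) (.var 12))
      (.sub (.entry 2 (.var 11) (.var 12)) (.const 1))))))
    (B := 40) (T := 2 * n * 100 + 50) (N := q + 1)
    (fun k s' => s'.var 11 ≤ 2 * n ∧ ∃ r,
      (∀ w, ∀ y < 2 * n, s'.mat (2 * n) 2 w y = r w y) ∧
      Augmenting n r₀ mark cap root Q t r (s'.var 11) k)
    (by
      have e11 : s₁.var 11 = s.var 10 := by simp [hs₁]
      have e2 : s₁.arr 2 = s.arr 2 := hf₁.arr 2
      rw [e11]
      refine ⟨he ▸ (hq.lt q hqt).le, r₀, ?_, hb₀, fun _ _ _ _ => rfl, hs₀, ?_, ?_,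
        fun _ _ _ _ _ => rfl, Or.inr ⟨q, hqt, rfl, he.symm, hen, fun _ _ _ _ => rfl⟩⟩
      · intro w y hy
        rw [← hr w y hy, Store.mat, Store.mat, e2]
      · intro w hw hw2
        split_ifs with hc
        · rw [hc, he]
          exact hlt
        · exact hrow w hw hw2
      · intro i hi
        have := hq.lt q hqt
        rw [if_neg (fun h' => by omega)]
        rfl)
    (by
      rintro k s' hf' ⟨-, r, hr', hA⟩ hb
      have hL' := hL₁.frame hf'
      have hb' : s'.var 11 < 2 * n := by
        rw [← hL'.nodes]
        exact hb
      have epar : s'.arr 7 = par := ((hf'.arr 7).trans (hf₁.arr 7)).trans hpar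
      obtain ⟨hi, hz, l, hl, hA'⟩ := hA.step hq hroot hb₀ hb'
      refine Ends.of_exec rfl ?_ (by decide)
      set y := s'.var 11 with hy
      have e5 : s'.arr 5 y = y * (2 * n) := hL'.offset _ hb'.le
      have e5' : s'.arr 5 (par (par y)) = par (par y) * (2 * n) := hL'.offset _ hz
      have e1 : s'.arr 2 (y * (2 * n) + par y) = r y (par y) := hr' y _ (by omega)
      have inner : ∀ w, ∀ x < 2 * n, Function.update (s'.arr 2) (y * (2 * n) + par y)
          (r y (par y) + 1) (w * (2 * n) + x) = setEntry r y (par y) (r y (par y) + 1) w x := by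
        intro w x hx
        rw [update_index _ (by omega) hx]
        have := hr' w x hx
        simp only [Store.mat] at this
        simp only [setEntry, this]
      have e2 := inner (par (par y)) (par y) (by omega)
      refine ⟨l, hl, ?_, setEntry (setEntry r y (par y) (r y (par y) + 1)) (par (par y)) (par y)
        (setEntry r y (par y) (r y (par y) + 1) (par (par y)) (par y) - 1), ?_, ?_⟩
      rotate_left 2
      · convert hA' using 1
        simp [Cmd.exec, Exp.eval, ← hy, epar]
      · simpa [Cmd.exec, Exp.eval, ← hy, epar] using hz
      · intro w x hx
        simp only [Store.mat, Cmd.exec, Exp.eval, Exp.entry, ← hy, epar, ne_eq,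
          not_false_eq_true, Function.update_self, Function.update_of_ne, e5, e5', e1, e2,
          Nat.reduceEqDiff]
        rw [update_index _ (by omega) hx]
        exact if_congr Iff.rfl rfl (inner w x hx))
    (by
      simp only [Test.cost, Exp.cost]
      have := hq.le
      omega)
  refine hloop.frame.mono le_rfl ?_
  rintro s' ⟨hf', ⟨k, h1, r, h2, h3⟩, hb⟩
  have hL' := hL₁.frame hf'
  have hb' : ¬ s'.var 11 < 2 * n := by
    rw [← hL'.nodes]
    exact hb
  have : s'.var 11 = 2 * n := by omega
  exact ⟨r, k, h2, this ▸ h3⟩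

end RAM

/-! ### Passes: one search for every open demand. -/

namespace RAM

variable {n : ℕ} {u : Fin n → Fin n → ℝ}

/-- The state of a pass of augmentations: `r₀` and `want₀` are the residual matrix and the open
demands at its beginning. -/
structure PassState (n : ℕ) (r₀ : ℕ → ℕ → ℕ) (cap want₀ : ℕ → ℕ) (r : ℕ → ℕ → ℕ)
    (mark want : ℕ → ℕ) : Prop where
  bip : ∀ w < 2 * n, ∀ x < 2 * n, 0 < r w x → (w < n ↔ n ≤ x)
  agent_row : ∀ i < n, ∀ x < 2 * n, r i x = r₀ i x
  supp : ∀ w, n ≤ w → w < 2 * n → ∀ i < n, 0 < r w i → 0 < r₀ i w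
  row : ∀ w, n ≤ w → w < 2 * n → ∑ x ∈ Finset.range (2 * n), r w x ≤ cap w
  col : ∀ i < n, ∑ w ∈ Finset.range (2 * n), r w i + want i
    = ∑ w ∈ Finset.range (2 * n), r₀ w i + want₀ i
  closed : ∀ w < 2 * n, ∀ x < 2 * n, mark w ≠ 0 → 0 < r w x → mark x ≠ 0
  saturated : ∀ w, n ≤ w → w < 2 * n → mark w ≠ 0 → cap w ≤ ∑ x ∈ Finset.range (2 * n), r w x
  origin : ∀ w, n ≤ w → w < 2 * n → mark w ≠ 0 → ∃ i < n, mark i ≠ 0 ∧ 0 < r₀ i w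
  reach : ∀ C : Set ℕ, (∃ i < n, mark i ≠ 0 ∧ i ∉ C) → ∃ i < n, mark i ≠ 0 ∧ i ∉ C ∧
    (0 < want i ∨ ∃ w, n ≤ w ∧ w < 2 * n ∧ 0 < r w i ∧ ∃ i' ∈ C, i' < n ∧ 0 < r₀ i' w)
  want_le : ∀ i < n, want i ≤ 1

/-- The path avoids marked nodes, so their rows and columns and everything known about them persist.
The root is unmarked, hence `reach` does not see that her demand has changed. -/
lemma PassState.augment {r₀ r r' : ℕ → ℕ → ℕ} {cap want₀ mark want Q : ℕ → ℕ} {root t k : ℕ}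
    (h : PassState n r₀ cap want₀ r mark want) (hroot : root < n) (hw : 0 < want root)
    (hm : mark root = 0) (hA : Augmenting n r mark cap root Q t r' (2 * n) k) :
    PassState n r₀ cap want₀ r' mark (Function.update want root (want root - 1)) where
  bip := hA.bip
  agent_row := fun i hi x hx => (hA.agent_row i hi x hx).trans (h.agent_row i hi x hx)
  supp := by
    intro w hw1 hw2 i hi hwi
    rw [← h.agent_row i hi w hw2]
    exact hA.supp w hw1 hw2 i hi hwi
  row := by
    intro w hw1 hw2
    have := hA.row w hw1 hw2
    rwa [if_neg hw2.ne] at this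
  col := by
    intro i hi
    have h1 := h.col i hi
    have h2 := hA.col i hi
    by_cases hir : i = root
    · subst hir
      simp only [Function.update_self, and_self, if_true] at h2 ⊢
      omega
    · rw [Function.update_of_ne hir]
      simp only [hir, and_false, if_false] at h2
      omega
  closed := by
    intro w hw1 x hx hmw hwx
    rw [hA.frame w hw1 x hx (Or.inl hmw)] at hwx
    exact h.closed w hw1 x hx hmw hwx
  saturated := by
    intro w hw1 hw2 hmw
    refine (h.saturated w hw1 hw2 hmw).trans (le_of_eq ?_)
    exact Finset.sum_congr rfl fun x hx =>
      (hA.frame w hw2 x (Finset.mem_range.1 hx) (Or.inl hmw)).symm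
  origin := h.origin
  reach := by
    intro C hC
    obtain ⟨i, hi, h1, h2, h3⟩ := h.reach C hC
    refine ⟨i, hi, h1, h2, ?_⟩
    have hir : i ≠ root := by
      rintro rfl
      exact h1 hm
    rw [Function.update_of_ne hir]
    rcases h3 with h3 | ⟨w, hw1, hw2, hwi, h4⟩
    · exact Or.inl h3
    · refine Or.inr ⟨w, hw1, hw2, ?_, h4⟩
      rwa [hA.frame w hw2 i (by omega) (Or.inr h1)]
  want_le := by
    intro i hi
    by_cases hir : i = root
    · subst hir
      have := h.want_le i hi
      rw [Function.update_self]
      omega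
    · rw [Function.update_of_ne hir]
      exact h.want_le i hi

/-- The nodes visited in vain are saturated and closed under residual edges. For `reach`, consider
the first agent in the queue outside `C`: she is the root, whose demand is open, or her grandparent
in the search tree is an earlier agent and therefore lies in `C`. -/
lemma PassState.mark {r₀ r : ℕ → ℕ → ℕ} {cap want₀ mark want vis par Q : ℕ → ℕ} {root t : ℕ}
    (h : PassState n r₀ cap want₀ r mark want) (hroot : root < n) (hw : 0 < want root)
    (hq : Queue (2 * n) r mark root vis par Q t) (hs : Scanned (2 * n) r cap vis Q t) :
    PassState n r₀ cap want₀ r vis want where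
  bip := h.bip
  agent_row := h.agent_row
  supp := h.supp
  row := h.row
  col := h.col
  closed := by
    intro w hw1 x hx hv hwx
    rcases (hq.vis_iff w hw1).1 hv with h1 | ⟨l, hl, rfl⟩
    · exact (hq.vis_iff x hx).2 (Or.inl (h.closed w hw1 x hx h1 hwx))
    · exact (hs l hl).1 x hx hwx
  saturated := by
    intro w hw1 hw2 hv
    rcases (hq.vis_iff w hw2).1 hv with h1 | ⟨l, hl, rfl⟩
    · exact h.saturated w hw1 hw2 h1
    · exact (hs l hl).2
  origin := by
    intro w hw1 hw2 hv
    rcases (hq.vis_iff w hw2).1 hv with h1 | ⟨l, hl, rfl⟩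
    · obtain ⟨i, hi, h2, h3⟩ := h.origin w hw1 hw2 h1
      exact ⟨i, hi, (hq.vis_iff i (by omega)).2 (Or.inl h2), h3⟩
    · have hl0 : 0 < l := by
        rcases Nat.eq_zero_or_pos l with h0 | h0
        · subst h0
          have := hq.root_eq
          omega
        · exact h0
      obtain ⟨l', hl', -, h2⟩ := hq.parent l hl0 hl
      have hlt := hq.lt l' (hl'.trans hl)
      have hi : Q l' < n := (h.bip _ hlt _ hw2 h2).2 hw1
      exact ⟨Q l', hi, (hq.vis_iff _ hlt).2 (Or.inr ⟨l', hl'.trans hl, rfl⟩),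
        by rwa [← h.agent_row _ hi _ hw2]⟩
  reach := by
    rintro C ⟨i, hi, hv, hiC⟩
    rcases (hq.vis_iff i (by omega)).1 hv with h1 | ⟨l₀, hl₀, rfl⟩
    · obtain ⟨i, hi, h2, h3⟩ := h.reach C ⟨i, hi, h1, hiC⟩
      exact ⟨i, hi, (hq.vis_iff i (by omega)).2 (Or.inl h2), h3⟩
    · have hex : ∃ l, l < t ∧ Q l < n ∧ Q l ∉ C := ⟨l₀, hl₀, hi, hiC⟩
      classical
      obtain ⟨hl, hln, hlC⟩ := Nat.find_spec hex
      have hmin := fun l => Nat.find_min hex (m := l)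
      set l := Nat.find hex
      have hlv : vis (Q l) ≠ 0 := (hq.vis_iff _ (by omega)).2 (Or.inr ⟨l, hl, rfl⟩)
      refine ⟨Q l, hln, hlv, hlC, ?_⟩
      rcases Nat.eq_zero_or_pos l with h0 | h0
      · left
        rw [h0, hq.root_eq]
        exact hw
      · right
        obtain ⟨l', hl', -, hr⟩ := hq.parent l h0 hl
        have hlt' := hq.lt l' (hl'.trans hl)
        have hn' : n ≤ Q l' := by
          have := h.bip _ hlt' _ (by omega) hr
          omega
        have h0' : 0 < l' := by
          rcases Nat.eq_zero_or_pos l' with h0 | h0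
          · rw [h0, hq.root_eq] at hn'
            omega
          · exact h0
        obtain ⟨l'', hl'', -, hr'⟩ := hq.parent l' h0' (hl'.trans hl)
        have hlt'' := hq.lt l'' (by omega)
        have hn'' : Q l'' < n := (h.bip _ hlt'' _ hlt' hr').2 hn'
        refine ⟨Q l', hn', hlt', hr, Q l'', ?_, hn'', by rwa [← h.agent_row _ hn'' _ hlt']⟩
        by_contra hcon
        exact hmin l'' (by omega) ⟨by omega, hn'', hcon⟩
  want_le := h.want_le

/-- Look for an augmenting path from the agent in variable `3`; augment or mark. -/
def search : Cmd :=
  .seq bfs (.ite (.lt (.const 0) (.var 9))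
    (.seq (.store 11 (.var 3) (.sub (.get 11 (.var 3)) (.const 1))) augment)
    (forLoop 7 1 (.store 9 (.var 7) (.get 6 (.var 7)))))

/-- Try to serve all open demands. -/
def pass : Cmd :=
  forLoop 3 0 (.ite (.lt (.const 0) (.get 11 (.var 3)))
    (.ite (.lt (.get 9 (.var 3)) (.const 1)) search .skip) .skip)

/-- Demands are at most 1, so a success closes the demand of the root and a failure marks her. Marks
only grow and demands only shrink, so one search per agent settles the whole pass. -/
lemma search_spec {s : Store} (hL : Layout n s) {r₀ r : ℕ → ℕ → ℕ} {want₀ : ℕ → ℕ} {root : ℕ}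
    (hr : ∀ w, ∀ y < 2 * n, s.mat (2 * n) 2 w y = r w y)
    (h : PassState n r₀ (s.arr 10) want₀ r (s.arr 9) (s.arr 11)) (hroot : s.var 3 = root)
    (hlt : root < n) (hm : s.arr 9 root = 0) (hw : 0 < s.arr 11 root)
    (hcap : ∀ i < n, s.arr 10 i = 0) :
    Ends u search s (1200 * (2 * n * (2 * n))) (fun s' => ∃ r',
      (∀ w, ∀ y < 2 * n, s'.mat (2 * n) 2 w y = r' w y) ∧
      PassState n r₀ (s'.arr 10) want₀ r' (s'.arr 9) (s'.arr 11) ∧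
      (∀ i < n, s'.arr 9 i = 0 → s.arr 9 i = 0) ∧
      (∀ i < n, s'.arr 11 i ≤ s.arr 11 i) ∧ (s'.arr 9 root = 0 → s'.arr 11 root = 0)) := by
  have hV : 2 ≤ 2 * n := by omega
  refine Ends.next (T₁ := 1000 * (2 * n * (2 * n))) (T₂ := 2 * n * 100 + 200)
    (bfs_spec hL (fun w _ => hr w) rfl rfl hroot (by omega) hm) (by nlinarith) ?_
  rintro s₁ hf₁ ⟨hq, hres⟩
  have hL₁ := hL.frame hf₁
  have hr₁ : ∀ w, ∀ y < 2 * n, s₁.mat (2 * n) 2 w y = r w y := by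
    intro w y hy
    rw [← hr w y hy, Store.mat, Store.mat, hf₁.arr 2]
  have hroot₁ : s₁.var 3 = root := (hf₁.var 3).trans hroot
  have e9 : s₁.arr 9 = s.arr 9 := hf₁.arr 9
  have e10 : s₁.arr 10 = s.arr 10 := hf₁.arr 10
  have e11 : s₁.arr 11 = s.arr 11 := hf₁.arr 11
  refine Ends.ite (T := 2 * n * 100 + 150) (fun hb => ?_) (fun hb => ?_)
    (by simp only [Test.cost, Exp.cost]; omega)
  · have hb' : 0 < s₁.var 9 := hb
    obtain ⟨-, hfound⟩ := hres.resolve_left (fun h' => by omega)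
    refine Ends.next (T₁ := 6) (T₂ := 2 * n * 100 + 100)
      (P := fun s' => s'.arr 11 = Function.update (s.arr 11) root (s.arr 11 root - 1))
      (Ends.of_exec rfl (by simp [Cmd.exec, Exp.eval, hroot₁, e11]) (by decide)) (by omega) ?_
    intro s₂ hf₂ hw₂
    refine (augment_spec (hL₁.frame hf₂) (by rw [← hf₂.arr 6, ← hf₂.arr 7, ← hf₂.arr 8] at hq; exact hq)
      hlt h.bip ?_ rfl ?_ h.row hcap ?_).frame.mono le_rfl ?_
    · intro w y hy
      rw [← hr₁ w y hy, Store.mat, Store.mat, hf₂.arr 2]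
    · intro w hw1 hw2 i hi hwi
      rw [h.agent_row i hi w hw2]
      exact h.supp w hw1 hw2 i hi hwi
    · rw [hf₂.var 10, hf₂.arr 8]
      exact hfound
    · rintro s₃ ⟨hf₃, r', k, hr', hA⟩
      have e9' : s₃.arr 9 = s.arr 9 := ((hf₃.arr 9).trans (hf₂.arr 9)).trans e9
      have e10' : s₃.arr 10 = s.arr 10 := ((hf₃.arr 10).trans (hf₂.arr 10)).trans e10
      have e11' : s₃.arr 11 = Function.update (s.arr 11) root (s.arr 11 root - 1) :=
        (hf₃.arr 11).trans hw₂
      rw [e9', e10', e11']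
      refine ⟨r', hr', h.augment hlt hw hm hA, fun _ _ h => h, ?_, ?_⟩
      · intro i _
        by_cases hi : i = root
        · subst hi
          rw [Function.update_self]
          omega
        · rw [Function.update_of_ne hi]
      · intro _
        have := h.want_le root hlt
        rw [Function.update_self]
        omega
  · have hb' : ¬ 0 < s₁.var 9 := hb
    obtain ⟨-, hs⟩ := hres.resolve_right (fun h' => by omega)
    refine (Ends.forLoop (B := 4) (fun k s' => ∀ y < k, s'.arr 9 y = s₁.arr 6 y) hL₁.nodes (by simp)
      ?_ le_rfl).frame.mono (by omega) ?_
    · intro k s' hk hf hsk hI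
      refine Ends.of_exec rfl ?_ (by decide)
      have e6 : s'.arr 6 = s₁.arr 6 := hf.arr 6
      intro y hy
      rcases Nat.lt_succ_iff_lt_or_eq.1 hy with h' | rfl
      · simp [Cmd.exec, Exp.eval, hsk, h'.ne, hI y h']
      · simp [Cmd.exec, Exp.eval, hsk, e6]
    · rintro s₂ ⟨hf₂, -, hI⟩
      have hM := h.mark hlt hw hq hs
      have e10' : s₂.arr 10 = s.arr 10 := (hf₂.arr 10).trans e10
      have e11' : s₂.arr 11 = s.arr 11 := (hf₂.arr 11).trans e11
      rw [e10', e11']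
      refine ⟨r, ?_, ?_, ?_, fun _ _ => le_rfl, ?_⟩
      · intro w y hy
        rw [← hr₁ w y hy, Store.mat, Store.mat, hf₂.arr 2]
      · exact
          { bip := hM.bip
            agent_row := hM.agent_row
            supp := hM.supp
            row := hM.row
            col := hM.col
            closed := by
              intro w hw x hx h1 h2
              rw [hI w hw] at h1
              rw [hI x hx]
              exact hM.closed w hw x hx h1 h2
            saturated := by
              intro w hw1 hw2 h1
              rw [hI w hw2] at h1
              exact hM.saturated w hw1 hw2 h1
            origin := by
              intro w hw1 hw2 h1
              rw [hI w hw2] at h1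
              obtain ⟨i, hi, h2, h3⟩ := hM.origin w hw1 hw2 h1
              exact ⟨i, hi, by rwa [hI i (by omega)], h3⟩
            reach := by
              rintro C ⟨i, hi, h1, h2⟩
              rw [hI i (by omega)] at h1
              obtain ⟨i, hi, h3, h4⟩ := hM.reach C ⟨i, hi, h1, h2⟩
              exact ⟨i, hi, by rwa [hI i (by omega)], h4⟩
            want_le := hM.want_le }
      · intro i hi h1
        rw [hI i (by omega)] at h1
        by_contra h2
        exact (hq.vis_iff i (by omega)).2 (Or.inl h2) h1
      · intro h1
        rw [hI root (by omega)] at h1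
        exact absurd h1 ((hq.vis_iff root (by omega)).2 (Or.inr ⟨0, hq.pos, hq.root_eq⟩))

lemma pass_spec {s : Store} (hL : Layout n s) {r₀ : ℕ → ℕ → ℕ}
    (hr : ∀ w, ∀ y < 2 * n, s.mat (2 * n) 2 w y = r₀ w y)
    (h : PassState n r₀ (s.arr 10) (s.arr 11) r₀ (s.arr 9) (s.arr 11))
    (hcap : ∀ i < n, s.arr 10 i = 0) :
    Ends u pass s (n * (1200 * (2 * n * (2 * n)) + 28) + 6) (fun s' => ∃ r',
      (∀ w, ∀ y < 2 * n, s'.mat (2 * n) 2 w y = r' w y) ∧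
      PassState n r₀ (s.arr 10) (s.arr 11) r' (s'.arr 9) (s'.arr 11) ∧
      ∀ i < n, s'.arr 9 i = 0 → s'.arr 11 i = 0) := by
  refine (Ends.forLoop (B := 1200 * (2 * n * (2 * n)) + 20)
    (fun k s' => ∃ r',
      (∀ w, ∀ y < 2 * n, s'.mat (2 * n) 2 w y = r' w y) ∧
      PassState n r₀ (s.arr 10) (s.arr 11) r' (s'.arr 9) (s'.arr 11) ∧
      ∀ i < k, s'.arr 9 i = 0 → s'.arr 11 i = 0) hL.agents ?_ ?_ le_rfl).mono (le_of_eq (by ring))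
    fun s' h' => h'.2
  · exact ⟨r₀, hr, h, fun i hi => absurd hi (Nat.not_lt_zero i)⟩
  · rintro k s' hk hf hsk ⟨r', hr', hP, hI⟩
    have hL' := hL.frame hf
    have e10 : s'.arr 10 = s.arr 10 := hf.arr 10
    have hnext : (s'.arr 9 k = 0 → s'.arr 11 k = 0) →
        ∀ i < k + 1, s'.arr 9 i = 0 → s'.arr 11 i = 0 := by
      intro hk' i hi
      rcases Nat.lt_succ_iff_lt_or_eq.1 hi with h' | rfl
      · exact hI i h'
      · exact hk'
    refine Ends.ite (T := 1200 * (2 * n * (2 * n)) + 10) (fun hb => ?_) (fun hb => ?_)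
      (by simp only [Test.cost, Exp.cost]; omega)
    · have hb' : 0 < s'.arr 11 k := by
        simpa [Test.Holds, Exp.eval, hsk] using hb
      refine Ends.ite (T := 1200 * (2 * n * (2 * n)) + 1) (fun hc => ?_) (fun hc => ?_)
        (by simp only [Test.cost, Exp.cost]; omega)
      · have hc' : s'.arr 9 k = 0 := by
          simpa [Test.Holds, Exp.eval, hsk] using hc
        refine (search_spec hL' hr' (by rwa [e10]) hsk hk hc' hb' (by rwa [e10])).frame.mono
          (by omega) ?_
        rintro s'' ⟨hf', r'', hr'', hP', h1, h2, h3⟩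
        have e10' : s''.arr 10 = s.arr 10 := (hf'.arr 10).trans e10
        rw [e10'] at hP'
        refine ⟨r'', hr'', hP', ?_⟩
        intro i hi hi9
        rcases Nat.lt_succ_iff_lt_or_eq.1 hi with h' | rfl
        · have := hI i h' (h1 i (by omega) hi9)
          have := h2 i (by omega)
          simp only [Store.setVar_arr]
          omega
        · exact h3 hi9
      · have hc' : s'.arr 9 k ≠ 0 := by
          simpa [Test.Holds, Exp.eval, hsk] using hc
        refine Ends.of_exec rfl ?_ (by simp [Cmd.maxCost])
        exact ⟨r', hr', hP, hnext fun h' => absurd h' hc'⟩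
    · have hb' : s'.arr 11 k = 0 := by
        simpa [Test.Holds, Exp.eval, hsk] using hb
      refine Ends.of_exec rfl ?_ (by simp [Cmd.maxCost])
      exact ⟨r', hr', hP, hnext fun _ => hb'⟩

end RAM

/-! ### The residual matrix as a flow between agents and items. -/

namespace RAM

variable {n : ℕ} {u : Fin n → Fin n → ℝ}

/-- The matrix `r` on the nodes `0, …, 2 * n - 1` contains the admissible pairs `E` (rows of
agents) and the flow `g` (rows of items). -/
structure Represents (n : ℕ) (r : ℕ → ℕ → ℕ) (E : Fin n → Fin n → Prop)
    (g : Fin n → Fin n → ℕ) : Prop where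
  bip : ∀ w < 2 * n, ∀ x < 2 * n, 0 < r w x → (w < n ↔ n ≤ x)
  edge : ∀ i j : Fin n, 0 < r i (n + j) ↔ E i j
  flow : ∀ i j : Fin n, r (n + j) i = g i j

lemma sum_range_two_mul (f : ℕ → ℕ) :
    ∑ x ∈ Finset.range (2 * n), f x
      = ∑ i : Fin n, f i + ∑ j : Fin n, f (n + j) := by
  rw [two_mul, Finset.sum_range_add, Finset.sum_range, Finset.sum_range]

lemma Represents.sum_row {r : ℕ → ℕ → ℕ} {E : Fin n → Fin n → Prop} {g : Fin n → Fin n → ℕ}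
    (h : Represents n r E g) (j : Fin n) :
    ∑ x ∈ Finset.range (2 * n), r (n + j) x = ∑ i, g i j := by
  rw [sum_range_two_mul]
  have : ∑ k : Fin n, r (n + j) (n + k) = 0 := by
    refine Finset.sum_eq_zero fun k _ => ?_
    by_contra h0
    have := h.bip (n + j) (by omega) (n + k) (by omega) (by omega)
    omega
  rw [this, add_zero]
  exact Finset.sum_congr rfl fun i _ => h.flow i j

lemma Represents.sum_col {r : ℕ → ℕ → ℕ} {E : Fin n → Fin n → Prop} {g : Fin n → Fin n → ℕ}
    (h : Represents n r E g) (i : Fin n) :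
    ∑ w ∈ Finset.range (2 * n), r w i = ∑ j, g i j := by
  rw [sum_range_two_mul]
  have : ∑ k : Fin n, r k i = 0 := by
    refine Finset.sum_eq_zero fun k _ => ?_
    by_contra h0
    have := h.bip k (by omega) i (by omega) (by omega)
    omega
  rw [this, zero_add]
  exact Finset.sum_congr rfl fun j _ => h.flow i j

lemma exists_fin_of_node {w : ℕ} (h1 : n ≤ w) (h2 : w < 2 * n) : ∃ j : Fin n, w = n + j :=
  ⟨⟨w - n, by omega⟩, by simp only; omega⟩

/-- The row sum of an item node is the amount in use of that item, and the column sum of an agent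
node is the amount she receives. With this dictionary `PassState` becomes `EPS.Pass`. -/
lemma pass_flow {s : Store} (hL : Layout n s) {E : Fin n → Fin n → Prop}
    {g₀ : Fin n → Fin n → ℕ} (hrep : Represents n (s.mat (2 * n) 2) E g₀)
    (hsupp : ∀ i j, 0 < g₀ i j → E i j) (hcol : ∀ j : Fin n, ∑ i, g₀ i j ≤ s.arr 10 (n + j))
    (hcap : ∀ i < n, s.arr 10 i = 0) (hmark : ∀ w < 2 * n, s.arr 9 w = 0)
    (hwant : ∀ i < n, s.arr 11 i ≤ 1) :
    Ends u pass s (n * (1200 * (2 * n * (2 * n)) + 28) + 6) (fun s' => ∃ g,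
      Represents n (s'.mat (2 * n) 2) E g ∧
      EPS.Pass E (fun j => s.arr 10 (n + j)) g₀ g (fun i => s.arr 11 i) (fun i => s'.arr 11 i)
        (fun i => s'.arr 9 i ≠ 0) (fun j => s'.arr 9 (n + j) ≠ 0)) := by
  refine (pass_spec hL (r₀ := s.mat (2 * n) 2) (fun _ _ _ => rfl) ?_ hcap).mono le_rfl ?_
  · refine ⟨hrep.bip, fun _ _ _ _ => rfl, ?_, ?_, fun _ _ => rfl, ?_, ?_, ?_, ?_, hwant⟩
    · intro w hw1 hw2 i hi hwi
      obtain ⟨j, rfl⟩ := exists_fin_of_node hw1 hw2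
      have h1 := hrep.flow ⟨i, hi⟩ j
      have h2 := (hrep.edge ⟨i, hi⟩ j).2 (hsupp ⟨i, hi⟩ j (by rw [← h1]; exact hwi))
      exact h2
    · intro w hw1 hw2
      obtain ⟨j, rfl⟩ := exists_fin_of_node hw1 hw2
      rw [hrep.sum_row]
      exact hcol j
    · exact fun w hw _ _ h => absurd (hmark w hw) h
    · exact fun w _ hw h => absurd (hmark w hw) h
    · exact fun w _ hw h => absurd (hmark w hw) h
    · rintro C ⟨i, hi, h, -⟩
      exact absurd (hmark i (by omega)) h
  · rintro s' ⟨r, hr, hP, hw⟩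
    have hrep' : Represents n r E (fun i j => r (n + j) i) := by
      refine ⟨hP.bip, fun i j => ?_, fun _ _ => rfl⟩
      rw [hP.agent_row i i.2 _ (by omega)]
      exact hrep.edge i j
    refine ⟨fun i j => r (n + j) i, ⟨?_, ?_, ?_⟩, ?_⟩
    · intro w hw x hx hwx
      rw [hr w x hx] at hwx
      exact hP.bip w hw x hx hwx
    · intro i j
      rw [hr i _ (by omega)]
      exact hrep'.edge i j
    · intro i j
      exact hr (n + j) i (by omega)
    · refine ⟨?_, ?_, ?_, ?_, ?_, ?_, ?_, ?_, ?_⟩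
      · intro i j hij
        exact (hrep.edge i j).1 (hP.supp (n + j) (by omega) (by omega) i i.2 hij)
      · intro j
        rw [← hrep'.sum_row]
        exact hP.row (n + j) (by omega) (by omega)
      · intro i
        rw [← hrep'.sum_col i, ← hrep.sum_col i]
        exact hP.col i i.2
      · intro i hi
        exact hw i i.2 (by simpa using hi)
      · intro i j hi hE
        exact hP.closed i (by omega) (n + j) (by omega) hi ((hrep'.edge i j).2 hE)
      · intro i j hj hij
        exact hP.closed (n + j) (by omega) i (by omega) hj hij
      · intro j hj
        rw [← hrep'.sum_row]
        exact hP.saturated (n + j) (by omega) (by omega) hj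
      · intro j hj
        obtain ⟨i, hi, h1, h2⟩ := hP.origin (n + j) (by omega) (by omega) hj
        exact ⟨⟨i, hi⟩, h1, (hrep.edge ⟨i, hi⟩ j).1 h2⟩
      · rintro C ⟨i, hi, hiC⟩
        obtain ⟨i', hi', h1, h2, h3⟩ := hP.reach (Fin.val '' C) ⟨i, i.2, hi, by
          rintro ⟨k, hk, hki⟩
          exact hiC (Fin.ext hki ▸ hk)⟩
        refine ⟨⟨i', hi'⟩, h1, fun hC => h2 ⟨_, hC, rfl⟩, ?_⟩
        rcases h3 with h3 | ⟨w, hw1, hw2, h4, i₂, ⟨k, hk, rfl⟩, hi₂, h5⟩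
        · exact Or.inl h3
        · obtain ⟨j, rfl⟩ := exists_fin_of_node hw1 hw2
          exact Or.inr ⟨j, h4, k, hk, (hrep.edge k j).1 h5⟩

end RAM

namespace RAM

variable {n : ℕ} {u : Fin n → Fin n → ℝ}

lemma index_lt {V w y : ℕ} (hw : w < V) (hy : y < V) : w * V + y < V * V := by
  have : (w + 1) * V ≤ V * V := Nat.mul_le_mul_right _ hw
  rw [Nat.succ_mul] at this
  omega

/-! ### Halving the brackets

Variables: `2` current scale, `13` and `15` loop variables, `14` number of matrix entries.
Arrays: `3` saved residual matrix, `4` preferences, `12` labels. -/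

/-- Double all entries of the residual matrix. -/
def double : Cmd := forLoop 13 14 (.store 2 (.var 13) (.add (.get 2 (.var 13)) (.get 2 (.var 13))))

/-- Copy the matrix in array `a` to array `b`. -/
def copyMatrix (a b : ℕ) : Cmd := forLoop 13 14 (.store b (.var 13) (.get a (.var 13)))

/-- Remove all marks. -/
def clearMarks : Cmd := forLoop 13 1 (.store 9 (.var 13) (.const 0))

/-- The entries in the rows of agents are doubled too; only their positivity carries information. -/
lemma double_spec {s : Store} (hL : Layout n s) :
    Ends u double s ((2 * n) * (2 * n) * 18 + 6) (fun s' =>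
      ∀ w < 2 * n, ∀ y < 2 * n, s'.mat (2 * n) 2 w y = 2 * s.mat (2 * n) 2 w y) := by
  refine (Ends.forLoop (B := 10) (fun k s' => ∀ x, s'.arr 2 x
    = if x < k then 2 * s.arr 2 x else s.arr 2 x) hL.entries ?_ ?_ (by omega)).mono le_rfl ?_
  · simp
  · intro k s' hk hf hsk hI
    refine Ends.of_exec rfl ?_ (by decide)
    intro x
    by_cases hx : x = k
    · subst hx
      simp [Cmd.exec, Exp.eval, hsk, hI, two_mul]
    · have : x < k + 1 ↔ x < k := by omega
      simp [Cmd.exec, Exp.eval, hsk, hI, hx, this]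
  · rintro s' ⟨-, hI⟩ w hw y hy
    rw [Store.mat, hI, if_pos (index_lt hw hy), Store.mat]

lemma copyMatrix_spec {s : Store} (hL : Layout n s) {a b : ℕ} (hab : Nat.beq a b = false) :
    Ends u (copyMatrix a b) s ((2 * n) * (2 * n) * 18 + 6) (fun s' =>
      ∀ w < 2 * n, ∀ y < 2 * n, s'.mat (2 * n) b w y = s.mat (2 * n) a w y) := by
  have hne : a ≠ b := by
    rintro rfl
    simp at hab
  refine (Ends.forLoop (B := 10) (fun k s' => ∀ x < k, s'.arr b x = s.arr a x) hL.entries ?_ ?_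
    (by omega)).mono le_rfl ?_
  · simp
  · intro k s' hk hf hsk hI
    refine Ends.of_exec rfl ?_ (by simp [Cmd.maxCost, Exp.cost])
    have e : s'.arr a = s.arr a := hf.arr a (by simpa [forLoop, Cmd.writesArr] using hab)
    intro x hx
    rcases Nat.lt_succ_iff_lt_or_eq.1 hx with h' | rfl
    · simp [Cmd.exec, Exp.eval, hsk, h'.ne, hI x h']
    · simp [Cmd.exec, Exp.eval, hsk, e]
  · rintro s' ⟨-, hI⟩ w hw y hy
    rw [Store.mat, hI _ (index_lt hw hy), Store.mat]

lemma clearMarks_spec {s : Store} (hL : Layout n s) :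
    Ends u clearMarks s (2 * n * 12 + 6) (fun s' => ∀ w < 2 * n, s'.arr 9 w = 0) := by
  refine (Ends.forLoop (B := 4) (fun k s' => ∀ x < k, s'.arr 9 x = 0) hL.nodes ?_ ?_
    (by omega)).mono le_rfl fun s' h => h.2
  · simp
  · intro k s' hk hf hsk hI
    refine Ends.of_exec rfl ?_ (by decide)
    intro x hx
    rcases Nat.lt_succ_iff_lt_or_eq.1 hx with h' | rfl
    · simp [Cmd.exec, Exp.eval, hsk, h'.ne, hI x h']
    · simp [Cmd.exec, Exp.eval, hsk]

/-- A loop that replaces row `13` of the residual matrix. -/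
lemma Ends.forRow {s : Store} {c : Cmd} {w B : ℕ} (hL : Layout n s) (hw : w < 2 * n)
    (F : ℕ → ℕ)
    (hstep : ∀ y < 2 * n, ∀ s', Frame (RAM.forLoop 15 1 c) s s' → s'.var 15 = y →
      s'.mat (2 * n) 2 w y = s.mat (2 * n) 2 w y → Ends u c s' B (fun s'' =>
        s''.arr 2 = Function.update (s'.arr 2) (w * (2 * n) + y) (F y)))
    (h1 : c.writesVar 1 = false := by rfl) (h15 : c.writesVar 15 = false := by rfl) :
    Ends u (RAM.forLoop 15 1 c) s (2 * n * (B + 8) + 6) (fun s' =>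
      ∀ w' < 2 * n, ∀ y < 2 * n, s'.mat (2 * n) 2 w' y
        = if w' = w then F y else s.mat (2 * n) 2 w' y) := by
  refine (Ends.forLoop (B := B) (fun k s' => ∀ w' < 2 * n, ∀ y < 2 * n, s'.mat (2 * n) 2 w' y
    = if w' = w ∧ y < k then F y else s.mat (2 * n) 2 w' y) hL.nodes ?_ ?_ le_rfl h1 h15).mono
    le_rfl ?_
  · intro w' _ y _
    simp [Store.mat]
  · intro k s' hk hf hsk hI
    refine (hstep k hk s' hf hsk ?_).mono le_rfl ?_
    · rw [hI w hw k hk]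
      simp
    · intro s'' h w' hw' y hy
      rw [Store.mat, Store.setVar_arr, h, update_index _ hk hy]
      have := hI w' hw' y hy
      simp only [Store.mat] at this
      simp only [setEntry, this, Store.mat]
      by_cases hc : w' = w ∧ y = k
      · simp [hc.1, hc.2]
      · rw [if_neg hc]
        have : (w' = w ∧ y < k + 1) ↔ (w' = w ∧ y < k) := by
          constructor
          · rintro ⟨h1, h2⟩
            refine ⟨h1, ?_⟩
            by_contra h3
            exact hc ⟨h1, by omega⟩
          · rintro ⟨h1, h2⟩
            exact ⟨h1, by omega⟩
        simp only [this]
  · rintro s' ⟨-, hI⟩ w' hw' y hy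
    rw [hI w' hw' y hy]
    simp [hy]

/-- Separate marked and unmarked nodes; the flow of marked agents is taken from array `3`. -/
def splitRow : Cmd :=
  forLoop 15 1
    (.ite (.lt (.sub (.const 1) (.get 9 (.var 13))) (.sub (.const 1) (.get 9 (.var 15))))
      (.store 2 (.add (.get 5 (.var 13)) (.var 15)) (.const 0))
      (.ite (.lt (.sub (.const 1) (.get 9 (.var 15))) (.sub (.const 1) (.get 9 (.var 13))))
        (.store 2 (.add (.get 5 (.var 13)) (.var 15)) (.const 0))
        (.ite (.lt (.const 0) (.get 9 (.var 13)))
          (.store 2 (.add (.get 5 (.var 13)) (.var 15)) (.entry 3 (.var 13) (.var 15)))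
          (.store 2 (.add (.get 5 (.var 13)) (.var 15)) (.entry 2 (.var 13) (.var 15))))))

/-- The expression `1 - mark` normalises marks to bits. Both strict comparisons of these bits fail
exactly if the two nodes are both marked or both unmarked. -/
lemma splitRow_spec {s : Store} (hL : Layout n s) {w : ℕ} (hw : w < 2 * n)
    (hsw : s.var 13 = w) :
    Ends u splitRow s (2 * n * 108 + 6) (fun s' =>
      ∀ w' < 2 * n, ∀ y < 2 * n, s'.mat (2 * n) 2 w' y = if w' = w then
        (if (s.arr 9 w ≠ 0 ↔ s.arr 9 y ≠ 0) then
          (if s.arr 9 w ≠ 0 then s.mat (2 * n) 3 w y else s.mat (2 * n) 2 w y) else 0)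
        else s.mat (2 * n) 2 w' y) := by
  refine (Ends.forRow (B := 100) hL hw (fun y => if (s.arr 9 w ≠ 0 ↔ s.arr 9 y ≠ 0) then
          (if s.arr 9 w ≠ 0 then s.mat (2 * n) 3 w y else s.mat (2 * n) 2 w y) else 0) ?_).mono
    (by omega) fun _ h => h
  intro y hy s' hf hsy hI
  have e13 : s'.var 13 = w := (hf.var 13).trans hsw
  have e9 : s'.arr 9 = s.arr 9 := hf.arr 9
  have e3 : s'.arr 3 = s.arr 3 := hf.arr 3
  have e5 : s'.arr 5 w = w * (2 * n) := (hL.frame hf).offset w hw.le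
  have e2 : s'.arr 2 (w * (2 * n) + y) = s.mat (2 * n) 2 w y := hI
  have e3' : s.arr 3 (w * (2 * n) + y) = s.mat (2 * n) 3 w y := rfl
  refine Ends.of_exec rfl ?_ (by decide)
  by_cases h1 : s.arr 9 w = 0 <;> by_cases h2 : s.arr 9 y = 0
  · simp [Cmd.exec, Test.Holds, Exp.eval, Exp.entry, e13, hsy, e9, h1, h2, e5, e2]
  · have h2' : 1 - s.arr 9 y = 0 := by omega
    simp [Cmd.exec, Test.Holds, Exp.eval, e13, hsy, e9, h1, h2, e5, h2']
  · have h1' : 1 - s.arr 9 w = 0 := by omega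
    simp [Cmd.exec, Test.Holds, Exp.eval, e13, hsy, e9, h1, h2, e5, h1']
  · have h1' : 1 - s.arr 9 w = 0 := by omega
    have h2' : 1 - s.arr 9 y = 0 := by omega
    have h3 : 0 < s.arr 9 w := by omega
    simp [Cmd.exec, Test.Holds, Exp.eval, Exp.entry, e13, hsy, e9, h1, h2, e5, h1', h2', e3, e3',
      h3]

/-- Split all blocks into their marked and unmarked parts. -/
def split : Cmd :=
  forLoop 13 1
    (.seq (.store 12 (.var 13) (.add (.add (.get 12 (.var 13)) (.get 12 (.var 13)))
      (.sub (.const 1) (.get 9 (.var 13))))) splitRow)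

lemma split_spec {s : Store} (hL : Layout n s) :
    Ends u split s (2 * n * (2 * n * 108 + 40) + 6) (fun s' =>
      (∀ w < 2 * n, s'.arr 12 w = 2 * s.arr 12 w + if s.arr 9 w ≠ 0 then 0 else 1) ∧
      ∀ w < 2 * n, ∀ y < 2 * n, s'.mat (2 * n) 2 w y =
        if (s.arr 9 w ≠ 0 ↔ s.arr 9 y ≠ 0) then
          (if s.arr 9 w ≠ 0 then s.mat (2 * n) 3 w y else s.mat (2 * n) 2 w y) else 0) := by
  refine (Ends.forLoop (B := 2 * n * 108 + 30) (fun k s' =>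
      (∀ w < 2 * n, s'.arr 12 w = if w < k then 2 * s.arr 12 w + (if s.arr 9 w ≠ 0 then 0 else 1)
        else s.arr 12 w) ∧
      ∀ w < 2 * n, ∀ y < 2 * n, s'.mat (2 * n) 2 w y = if w < k then
        (if (s.arr 9 w ≠ 0 ↔ s.arr 9 y ≠ 0) then
          (if s.arr 9 w ≠ 0 then s.mat (2 * n) 3 w y else s.mat (2 * n) 2 w y) else 0)
        else s.mat (2 * n) 2 w y) hL.nodes ?_ ?_ ?_).mono le_rfl ?_
  · simp [Store.mat]
  · rintro k s' hk hf hsk ⟨h1, h2⟩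
    have hL' := hL.frame hf
    have e9 : s'.arr 9 = s.arr 9 := hf.arr 9
    have e3 : s'.arr 3 = s.arr 3 := hf.arr 3
    refine Ends.next (T₁ := 12) (T₂ := 2 * n * 108 + 6)
      (P := fun s'' => s''.arr 12 = Function.update (s'.arr 12) k
        (2 * s.arr 12 k + if s.arr 9 k ≠ 0 then 0 else 1))
      (Ends.of_exec rfl ?_ (by decide)) (by omega) ?_
    · have := h1 k hk
      rw [if_neg (lt_irrefl _)] at this
      by_cases h9 : s.arr 9 k = 0
      · simp [Cmd.exec, Exp.eval, hsk, this, e9, h9, two_mul]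
      · have h9' : 1 - s.arr 9 k = 0 := by omega
        simp [Cmd.exec, Exp.eval, hsk, this, e9, h9, h9', two_mul]
    · intro s₁ hf₁ h12
      have hL₁ := hL'.frame hf₁
      have e13 : s₁.var 13 = k := (hf₁.var 13).trans hsk
      refine (splitRow_spec hL₁ hk e13).frame.mono le_rfl ?_
      rintro s₂ ⟨hf₂, hI⟩
      have e12 : s₂.arr 12 = s₁.arr 12 := hf₂.arr 12
      have e9' : s₁.arr 9 = s.arr 9 := (hf₁.arr 9).trans e9
      have e3' : ∀ w y, s₁.mat (2 * n) 3 w y = s.mat (2 * n) 3 w y := by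
        intro w y
        rw [Store.mat, Store.mat, hf₁.arr 3, e3]
      have e2' : ∀ w y, s₁.mat (2 * n) 2 w y = s'.mat (2 * n) 2 w y := by
        intro w y
        rw [Store.mat, Store.mat, hf₁.arr 2]
      refine ⟨?_, ?_⟩
      · intro w hw
        rw [Store.setVar_arr, e12, h12]
        by_cases hwk : w = k
        · subst hwk
          simp
        · have : w < k + 1 ↔ w < k := by omega
          rw [Function.update_of_ne hwk, h1 w hw]
          simp only [this]
      · intro w hw y hy
        have := hI w hw y hy
        rw [e9'] at this
        change s₂.mat (2 * n) 2 w y = _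
        rw [this]
        by_cases hwk : w = k
        · subst hwk
          have h3 := h2 w hw y hy
          rw [if_neg (lt_irrefl _)] at h3
          rw [if_pos rfl, if_pos (Nat.lt_succ_self w), e3', e2', h3]
        · have hlt : w < k + 1 ↔ w < k := by omega
          rw [if_neg hwk, e2', h2 w hw y hy]
          simp only [hlt]
  · have : 2 * n * (2 * n * 108 + 30 + 8) ≤ 2 * n * (2 * n * 108 + 40) :=
      Nat.mul_le_mul_left _ (by omega)
    omega
  · rintro s' ⟨-, h1, h2⟩
    refine ⟨fun w hw => ?_, fun w hw y hy => ?_⟩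
    · rw [h1 w hw, if_pos hw]
    · rw [h2 w hw y hy, if_pos hw]

/-- Open one unit of demand for every agent and set the capacities of the items. -/
def openDemands : Cmd :=
  forLoop 13 0 (.seq (.store 11 (.var 13) (.const 1))
    (.store 10 (.add (.var 0) (.var 13)) (.var 2)))

lemma openDemands_spec {s : Store} (hL : Layout n s) {m : ℕ} (hm : s.var 2 = m) :
    Ends u openDemands s (n * 28 + 6) (fun s' => (∀ i < n, s'.arr 11 i = 1) ∧
      (∀ i < n, s'.arr 10 (n + i) = m) ∧ ∀ i < n, s'.arr 10 i = s.arr 10 i) := by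
  refine (Ends.forLoop (B := 20) (fun k s' => (∀ i < k, s'.arr 11 i = 1) ∧
    (∀ i < k, s'.arr 10 (n + i) = m) ∧ ∀ i < n, s'.arr 10 i = s.arr 10 i) hL.agents ?_ ?_
    (by omega)).mono le_rfl fun s' h => h.2
  · simp
  · rintro k s' hk hf hsk ⟨h1, h2, h3⟩
    have e2 : s'.var 2 = m := (hf.var 2).trans hm
    have e0 : s'.var 0 = n := (hL.frame hf).agents
    refine Ends.of_exec rfl ?_ (by decide)
    refine ⟨?_, ?_, ?_⟩
    · intro x hx
      rcases Nat.lt_succ_iff_lt_or_eq.1 hx with h' | rfl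
      · simp [Cmd.exec, Exp.eval, hsk, h'.ne, h1 x h']
      · simp [Cmd.exec, Exp.eval, hsk]
    · intro x hx
      rcases Nat.lt_succ_iff_lt_or_eq.1 hx with h' | rfl
      · simp [Cmd.exec, Exp.eval, hsk, h'.ne, h2 x h', e0, e2]
      · simp [Cmd.exec, Exp.eval, hsk, e0, e2]
    · intro x hx
      have : x ≠ n + k := by omega
      simp [Cmd.exec, Exp.eval, hsk, h3 x hx, e0, this]

/-- Halve all brackets. -/
def level : Cmd :=
  .seq double (.seq (copyMatrix 2 3) (.seq clearMarks (.seq openDemands (.seq pass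
    (.seq split (.assign 2 (.add (.var 2) (.var 2))))))))

/-- The labels and the flow in the store bracket the rates at scale `m`. -/
def Bracketed (D : Fin n → Finset (Fin n)) (m : ℕ) (s : Store) : Prop :=
  Layout n s ∧ s.var 2 = m ∧ (∀ i < n, s.arr 10 i = 0) ∧
  ∃ g, Represents n (s.mat (2 * n) 2)
      (fun i j => j ∈ D i ∧ s.arr 12 i = s.arr 12 (n + j)) g ∧
    EPS.Bracketing D m (fun i => s.arr 12 i) (fun j => s.arr 12 (n + j)) g

/-- Array `3` saves the doubled flow from before the pass, which `EPS.Bracketing.step` needs for the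
marked agents. Deleting the pairs of a marked and an unmarked node matches the refinement of labels,
since nodes share a new label exactly if they shared the old one and are of the same kind. The pass
dominates the cost. -/
lemma level_spec {D : Fin n → Finset (Fin n)} {m : ℕ} {s : Store} (hn : 1 ≤ n)
    (h : Bracketed D m s) :
    Ends u level s (10000 * n ^ 3) (Bracketed D (2 * m)) := by
  obtain ⟨hL, hm, hcap, g, hrep, hB⟩ := h
  have e1 : n ≤ n ^ 3 := Nat.le_self_pow (by norm_num) n
  have e2 : n * n ≤ n ^ 3 := by
    rw [← pow_two]
    exact Nat.pow_le_pow_right hn (by norm_num)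
  have e3 : 2 * n * (2 * n) = 4 * (n * n) := by ring
  have e4 : n * (1200 * (2 * n * (2 * n)) + 28) + 6 = 4800 * n ^ 3 + 28 * n + 6 := by ring
  have e5 : 2 * n * (2 * n * 108 + 40) + 6 = 432 * (n * n) + 80 * n + 6 := by ring
  refine Ends.next (double_spec hL) (T₂ := 9900 * n ^ 3) (by omega) ?_
  intro s₁ hf₁ h₁
  have hL₁ := hL.frame hf₁
  refine Ends.next (copyMatrix_spec hL₁ rfl) (T₂ := 9800 * n ^ 3) (by omega) ?_
  intro s₂ hf₂ h₂
  have hL₂ := hL₁.frame hf₂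
  refine Ends.next (clearMarks_spec hL₂) (T₂ := 9700 * n ^ 3) (by omega) ?_
  intro s₃ hf₃ h₃
  have hL₃ := hL₂.frame hf₃
  have hm₃ : s₃.var 2 = m := by rw [hf₃.var 2, hf₂.var 2, hf₁.var 2, hm]
  refine Ends.next (openDemands_spec hL₃ hm₃) (T₂ := 9600 * n ^ 3) (by omega) ?_
  rintro s₄ hf₄ ⟨h4w, h4c, h4a⟩
  have hL₄ := hL₃.frame hf₄
  have hmat₄ : ∀ w < 2 * n, ∀ y < 2 * n, s₄.mat (2 * n) 2 w y = 2 * s.mat (2 * n) 2 w y := by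
    intro w hw y hy
    rw [← h₁ w hw y hy, Store.mat, Store.mat, hf₄.arr 2, hf₃.arr 2, hf₂.arr 2]
  have hrep₄ : Represents n (s₄.mat (2 * n) 2)
      (fun i j => j ∈ D i ∧ s.arr 12 i = s.arr 12 (n + j)) (fun i j => 2 * g i j) := by
    refine ⟨?_, ?_, ?_⟩
    · intro w hw x hx hwx
      rw [hmat₄ w hw x hx] at hwx
      exact hrep.bip w hw x hx (by omega)
    · intro i j
      rw [← hrep.edge i j, hmat₄ i (by omega) _ (by omega)]
      omega
    · intro i j
      rw [← hrep.flow i j, hmat₄ _ (by omega) i (by omega)]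
  have hcap₄ : ∀ i < n, s₄.arr 10 i = 0 := by
    intro i hi
    rw [h4a i hi, hf₃.arr 10, hf₂.arr 10, hf₁.arr 10, hcap i hi]
  refine Ends.next (pass_flow hL₄ hrep₄ ?_ ?_ hcap₄ ?_ ?_) (T₂ := 4000 * n ^ 3)
    (by omega) ?_
  · intro i j hij
    exact hB.supp i j (by omega)
  · intro j
    rw [h4c j j.2, ← Finset.mul_sum]
    exact hB.col_le j
  · intro w hw
    rw [hf₄.arr 9]
    exact h₃ w hw
  · intro i hi
    rw [h4w i hi]
  rintro s₅ hf₅ ⟨g', hrep₅, hpass⟩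
  have hL₅ := hL₄.frame hf₅
  refine Ends.next (split_spec hL₅) (T₂ := 4) (by omega) ?_
  rintro s₆ hf₆ ⟨h6l, h6m⟩
  have hL₆ := hL₅.frame hf₆
  refine (Ends.of_exec (Q := fun s' => s' = s₆.setVar 2 (2 * m)) rfl ?_ (by decide)).frame.mono le_rfl ?_
  · have : s₆.var 2 = m := by rw [hf₆.var 2, hf₅.var 2, hf₄.var 2, hm₃]
    simp [Cmd.exec, Exp.eval, this, Store.setVar, two_mul]
  rintro s₇ ⟨hf₇, rfl⟩
  have hL₇ := hL₆.frame hf₇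
  have hcap₆ : ∀ i < n, s₆.arr 10 i = 0 := by
    intro i hi
    rw [hf₆.arr 10, hf₅.arr 10, hcap₄ i hi]
  have hlab : s₅.arr 12 = s.arr 12 := by
    rw [hf₅.arr 12, hf₄.arr 12, hf₃.arr 12, hf₂.arr 12, hf₁.arr 12]
  have hsave : ∀ w < 2 * n, ∀ y < 2 * n, s₅.mat (2 * n) 3 w y = s₄.mat (2 * n) 2 w y := by
    intro w hw y hy
    have := h₂ w hw y hy
    rw [hmat₄ w hw y hy, ← h₁ w hw y hy, ← this, Store.mat, Store.mat, hf₅.arr 3, hf₄.arr 3,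
      hf₃.arr 3]
  have hpass' : EPS.Pass (fun i j => j ∈ D i ∧ s.arr 12 i = s.arr 12 (n + j)) (fun _ => m)
      (fun i j => 2 * g i j) g' (fun _ => 1) (fun i => s₅.arr 11 i) (fun i => s₅.arr 9 i ≠ 0)
      (fun j => s₅.arr 9 (n + j) ≠ 0) := by
    have ec : (fun j : Fin n => s₄.arr 10 (n + j)) = fun _ => m := by
      funext j
      exact h4c j j.2
    have ew : (fun i : Fin n => s₄.arr 11 i) = fun _ => 1 := by
      funext i
      exact h4w i i.2
    rw [ec, ew] at hpass
    exact hpass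
  have hstep := hB.step hpass'
  have key : ∀ a b G, EPS.Bracketing D (2 * m) a b G → a = (fun i : Fin n => s₆.arr 12 i) →
      b = (fun j : Fin n => s₆.arr 12 (n + j)) → Represents n (s₆.mat (2 * n) 2)
        (fun i j => j ∈ D i ∧ s₆.arr 12 i = s₆.arr 12 (n + j)) G →
      Bracketed D (2 * m) (s₆.setVar 2 (2 * m)) := by
    rintro _ _ G h1 rfl rfl h2
    exact ⟨hL₇, by simp, hcap₆, G, h2, h1⟩
  refine key _ _ _ hstep ?_ ?_ ?_
  · funext i
    rw [h6l i (by omega), hlab]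
    congr
  · funext j
    rw [h6l _ (by omega), hlab]
    congr
  · refine ⟨?_, ?_, ?_⟩
    · intro w hw x hx hwx
      rw [h6m w hw x hx] at hwx
      split_ifs at hwx with h1 h2
      · rw [hsave w hw x hx] at hwx
        exact hrep₄.bip w hw x hx hwx
      · exact hrep₅.bip w hw x hx hwx
      · omega
    · intro i j
      have h1 := hrep₄.edge i j
      have h2 := hrep₅.edge i j
      rw [h6m i (by omega) _ (by omega), hsave i (by omega) _ (by omega),
        h6l i (by omega), h6l (n + j) (by omega), hlab]
      by_cases hi : s₅.arr 9 i = 0 <;> by_cases hj : s₅.arr 9 (n + j) = 0 <;>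
        simp [hi, hj, h1, h2] <;> intros <;> omega
    · intro i j
      have h1 := hrep₄.flow i j
      have h2 := hrep₅.flow i j
      rw [h6m _ (by omega) i (by omega), hsave _ (by omega) i (by omega), h1, h2]
      by_cases hi : s₅.arr 9 i = 0 <;> by_cases hj : s₅.arr 9 (n + j) = 0 <;>
        simp [hi, hj]

end RAM

namespace RAM

variable {n : ℕ} {u : Fin n → Fin n → ℝ}

/-- Halve the brackets until they are narrow enough. -/
def narrow : Cmd := .loop (.lt (.add (.var 2) (.var 2)) (.var 14)) level

/-- The loop runs while the scale is below `2 * n * n`, so that half of the final scale is at least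
`n * n`. The scale doubles every time, hence the logarithmic number of rounds. -/
lemma narrow_spec {D : Fin n → Finset (Fin n)} {s : Store} (hn : 1 ≤ n) (h : Bracketed D 1 s) :
    Ends u narrow s ((2 * Nat.log 2 n + 3) * (10000 * n ^ 3 + 6) + 6) (fun s' => ∃ e,
      e ≤ 2 * Nat.log 2 n + 2 ∧ n * n ≤ 2 ^ e ∧ Bracketed D (2 * 2 ^ e) s') := by
  have hlog : 2 * (n * n) < 2 ^ (2 * Nat.log 2 n + 3) := by
    have h1 : n < 2 ^ (Nat.log 2 n + 1) := Nat.lt_pow_succ_log_self (by norm_num) n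
    have h2 : n * n < 2 ^ (Nat.log 2 n + 1) * 2 ^ (Nat.log 2 n + 1) := Nat.mul_lt_mul'' h1 h1
    have h3 : 2 ^ (2 * Nat.log 2 n + 3)
        = 2 * (2 ^ (Nat.log 2 n + 1) * 2 ^ (Nat.log 2 n + 1)) := by ring
    omega
  have htest : ∀ e s', Bracketed D (2 ^ e) s' →
      ((Test.lt (.add (.var 2) (.var 2)) (.var 14)).Holds u s' ↔ 2 ^ e < 2 * (n * n)) := by
    rintro e s' ⟨hL, hm, -⟩
    have h1 := hL.entries
    have h2 : 2 * n * (2 * n) = 2 * (2 * (n * n)) := by ring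
    simp only [Test.Holds, Exp.eval, hm, h1, h2]
    omega
  refine (Ends.loopIdx (N := 2 * Nat.log 2 n + 3) (B := 10000 * n ^ 3)
    (fun k s' => ∃ e, e + k = 2 * Nat.log 2 n + 3 ∧ Bracketed D (2 ^ e) s')
    ⟨0, by omega, h⟩ ?_ le_rfl).mono le_rfl ?_
  · rintro k s' - ⟨e, he, hB⟩ hb
    have hlt := ((htest e s' hB).1 hb).trans hlog
    have hlt' : e < 2 * Nat.log 2 n + 3 := (Nat.pow_lt_pow_iff_right (by norm_num)).1 hlt
    refine (level_spec hn hB).mono le_rfl fun s'' h'' => ?_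
    refine ⟨k - 1, by omega, e + 1, by omega, ?_⟩
    rw [pow_succ, mul_comm]
    exact h''
  · rintro s' ⟨⟨k, e, he, hB⟩, hb⟩
    have hge := (htest e s' hB).not.1 hb
    push Not at hge
    -- The initial scale 1 is below `2 * n * n`, so at least one level has been carried out and the
    -- scale can be halved.
    have he0 : e ≠ 0 := by
      rintro rfl
      have : 1 ≤ n * n := Nat.mul_le_mul hn hn
      omega
    obtain ⟨e, rfl⟩ := Nat.exists_eq_succ_of_ne_zero he0
    rw [Nat.succ_eq_add_one] at hge hB he
    have e2 : 2 ^ (e + 1) = 2 * 2 ^ e := by ring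
    rw [e2] at hge hB
    exact ⟨e, by omega, by omega, hB⟩

/-! ### Blocks

Variables: `16` label of the agents that get a full unit, `18` and `19` block sizes.
Arrays: `13` and `14` numbers of agents and of items in the block of a node, `15` remaining bits
of the former, `16` remainders. -/

/-- `1` if `e` and `f` are equal and `0` otherwise. -/
def Exp.eq (e f : Exp) : Exp := .sub (.const 1) (.add (.sub e f) (.sub f e))

lemma Exp.eval_eq (s : Store) (e f : Exp) :
    (Exp.eq e f).eval n s = if e.eval n s = f.eval n s then 1 else 0 := by
  simp only [Exp.eq, Exp.eval]
  split_ifs <;> omega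

/-- Merge all labels that are at least `2 ^ e`. -/
def capLabels : Cmd :=
  .seq (.assign 16 (.half (.var 2)))
    (forLoop 13 1 (.store 12 (.var 13)
      (.sub (.get 12 (.var 13)) (.sub (.get 12 (.var 13)) (.var 16)))))

lemma capLabels_spec {s : Store} (hL : Layout n s) {M : ℕ} (hM : s.var 2 = 2 * M) :
    Ends u capLabels s (2 * n * 30 + 20) (fun s' => s'.var 16 = M ∧
      ∀ w < 2 * n, s'.arr 12 w = min (s.arr 12 w) M) := by
  refine Ends.next (T₁ := 3) (T₂ := 2 * n * 30 + 10) (P := fun s' => s' = s.setVar 16 M)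
    (Ends.of_exec rfl ?_ (by decide)) (by omega) ?_
  · have : 2 * M / 2 = M := by omega
    simp [Cmd.exec, Exp.eval, hM, this, Store.setVar]
  rintro s₁ hf₁ hs₁
  have hL₁ := hL.frame hf₁
  have e16 : s₁.var 16 = M := by simp [hs₁]
  have e12 : s₁.arr 12 = s.arr 12 := hf₁.arr 12
  refine (Ends.forLoop (B := 20) (fun k s' => ∀ x, s'.arr 12 x
    = if x < k then min (s.arr 12 x) M else s.arr 12 x) hL₁.nodes ?_ ?_ (by omega)).frame.mono
    le_rfl ?_
  · simp [e12]
  · intro k s' hk hf hsk hI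
    refine Ends.of_exec rfl ?_ (by decide)
    have e16' : s'.var 16 = M := (hf.var 16).trans e16
    intro x
    by_cases hx : x = k
    · subst hx
      have := hI x
      rw [if_neg (lt_irrefl _)] at this
      have hmin : s.arr 12 x - (s.arr 12 x - M) = min (s.arr 12 x) M := by omega
      simp [Cmd.exec, Exp.eval, hsk, this, e16', hmin]
    · have : x < k + 1 ↔ x < k := by omega
      simp [Cmd.exec, Exp.eval, hsk, hI, hx, this]
  · rintro s' ⟨hf, -, hI⟩
    refine ⟨(hf.var 16).trans e16, fun w hw => ?_⟩
    rw [hI, if_pos hw]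

/-- Count the agents and the items with the label of node `13`. -/
def countBlock : Cmd :=
  .seq (.assign 18 (.const 0)) (.seq (.assign 19 (.const 0))
    (forLoop 15 0
      (.seq (.assign 18 (.add (.var 18) (.eq (.get 12 (.var 15)) (.get 12 (.var 13)))))
        (.assign 19 (.add (.var 19)
          (.eq (.get 12 (.add (.var 0) (.var 15))) (.get 12 (.var 13))))))))

lemma countBlock_spec {s : Store} (hL : Layout n s) {w : ℕ} (hw : s.var 13 = w) :
    Ends u countBlock s (n * 100 + 20) (fun s' =>
      s'.var 18 = (Finset.univ.filter fun i : Fin n => s.arr 12 i = s.arr 12 w).card ∧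
      s'.var 19 = (Finset.univ.filter fun j : Fin n => s.arr 12 (n + j) = s.arr 12 w).card) := by
  refine Ends.next (T₁ := 2) (T₂ := n * 100 + 12) (P := fun s' => s' = s.setVar 18 0)
    (Ends.of_exec rfl (by simp [Cmd.exec, Exp.eval, Store.setVar]) (by decide)) (by omega) ?_
  rintro s₁ hf₁ hs₁
  refine Ends.next (T₁ := 2) (T₂ := n * 100 + 10) (P := fun s' => s' = (s.setVar 18 0).setVar 19 0)
    (Ends.of_exec rfl (by simp [hs₁, Cmd.exec, Exp.eval, Store.setVar]) (by decide)) (by omega) ?_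
  rintro s₂ hf₂ hs₂
  have hL₂ := (hL.frame hf₁).frame hf₂
  refine (Ends.forLoop (B := 80) (fun k s' =>
    s'.var 18 = ∑ y ∈ Finset.range k, (if s.arr 12 y = s.arr 12 w then 1 else 0) ∧
    s'.var 19 = ∑ y ∈ Finset.range k, (if s.arr 12 (n + y) = s.arr 12 w then 1 else 0))
    hL₂.agents ?_ ?_ (by omega)).mono le_rfl ?_
  · simp [hs₂]
  · rintro k s' hk hf hsk ⟨h1, h2⟩
    have e12 : s'.arr 12 = s.arr 12 := by rw [hf.arr 12, hf₂.arr 12, hf₁.arr 12]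
    have e13 : s'.var 13 = w := by rw [hf.var 13, hf₂.var 13, hf₁.var 13, hw]
    have e0 : s'.var 0 = n := by rw [hf.var 0, hL₂.agents]
    refine Ends.of_exec rfl ?_ (by decide)
    rw [Finset.sum_range_succ, Finset.sum_range_succ, ← h1, ← h2]
    simp [Cmd.exec, Exp.eval, Exp.eval_eq, e12, e13, e0, hsk]
  · rintro s' ⟨-, h1, h2⟩
    rw [h1, h2, Finset.card_filter, Finset.card_filter, Finset.sum_range, Finset.sum_range]
    exact ⟨rfl, rfl⟩

/-- Set up the block data of node `13`. -/
def initNode : Cmd :=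
  .seq countBlock
  (.seq (.ite (.lt (.get 12 (.var 13)) (.var 16))
    (.seq (.store 13 (.var 13) (.var 18)) (.seq (.store 14 (.var 13) (.var 19))
      (.store 15 (.var 13) (.var 18))))
    (.seq (.store 13 (.var 13) (.const 1)) (.seq (.store 14 (.var 13) (.const 1))
      (.store 15 (.var 13) (.const 1)))))
  (.seq (.store 16 (.var 13) (.const 0)) (.store 10 (.var 13) (.const 0))))

/-- The number of agents in the block of node `w`. -/
def agentCount (n M : ℕ) (lab : ℕ → ℕ) (w : ℕ) : ℕ :=
  EPS.blockSize M (fun i : Fin n => lab i) (lab w)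

/-- The number of items in the block of node `w`. -/
def itemCount (n M : ℕ) (lab : ℕ → ℕ) (w : ℕ) : ℕ :=
  EPS.blockSize M (fun j : Fin n => lab (n + j)) (lab w)

lemma initNode_spec {s : Store} (hL : Layout n s) {w M : ℕ} (hw : s.var 13 = w)
    (hM : s.var 16 = M) :
    Ends u initNode s (n * 100 + 80) (fun s' =>
      s'.arr 13 = Function.update (s.arr 13) w (agentCount n M (s.arr 12) w) ∧
      s'.arr 14 = Function.update (s.arr 14) w (itemCount n M (s.arr 12) w) ∧
      s'.arr 15 = Function.update (s.arr 15) w (agentCount n M (s.arr 12) w) ∧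
      s'.arr 16 = Function.update (s.arr 16) w 0 ∧
      s'.arr 10 = Function.update (s.arr 10) w 0) := by
  refine Ends.next (countBlock_spec hL hw) (T₂ := 60) (by omega) ?_
  rintro s₁ hf₁ ⟨h1, h2⟩
  have e12 : s₁.arr 12 = s.arr 12 := hf₁.arr 12
  have e13 : s₁.var 13 = w := (hf₁.var 13).trans hw
  have e16 : s₁.var 16 = M := (hf₁.var 16).trans hM
  rw [← hf₁.arr 13, ← hf₁.arr 14, ← hf₁.arr 15, ← hf₁.arr 16, ← hf₁.arr 10]
  refine Ends.of_exec rfl ?_ (by decide)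
  by_cases hlt : s.arr 12 w < M
  · simp [Cmd.exec, Test.Holds, Exp.eval, e12, e13, e16, hlt, h1, h2, agentCount, itemCount,
      EPS.blockSize]
  · simp [Cmd.exec, Test.Holds, Exp.eval, e12, e13, e16, hlt, agentCount, itemCount,
      EPS.blockSize]

/-- Set up the block data of all nodes. -/
def initNodes : Cmd := forLoop 13 1 initNode

lemma initNodes_spec {s : Store} (hL : Layout n s) {M : ℕ} (hM : s.var 16 = M) :
    Ends u initNodes s (2 * n * (n * 100 + 90) + 6) (fun s' => ∀ w < 2 * n,
      s'.arr 13 w = agentCount n M (s.arr 12) w ∧ s'.arr 14 w = itemCount n M (s.arr 12) w ∧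
      s'.arr 15 w = agentCount n M (s.arr 12) w ∧ s'.arr 16 w = 0 ∧ s'.arr 10 w = 0) := by
  refine (Ends.forLoop (B := n * 100 + 80) (fun k s' => ∀ w < k,
      s'.arr 13 w = agentCount n M (s.arr 12) w ∧ s'.arr 14 w = itemCount n M (s.arr 12) w ∧
      s'.arr 15 w = agentCount n M (s.arr 12) w ∧ s'.arr 16 w = 0 ∧ s'.arr 10 w = 0)
    hL.nodes (by simp) ?_ ?_).mono le_rfl fun _ h => h.2
  · intro k s' hk hf hsk hI
    have e12 : s'.arr 12 = s.arr 12 := hf.arr 12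
    refine (initNode_spec (hL.frame hf) hsk ((hf.var 16).trans hM)).mono le_rfl ?_
    rintro s'' ⟨h1, h2, h3, h4, h5⟩
    intro w hw
    rw [Store.setVar_arr, h1, h2, h3, h4, h5, e12]
    rcases Nat.lt_succ_iff_lt_or_eq.1 hw with h' | rfl
    · simpa [h'.ne] using hI w h'
    · simp
  · have : 2 * n * (n * 100 + 80 + 8) ≤ 2 * n * (n * 100 + 90) :=
      Nat.mul_le_mul_left _ (by omega)
    omega

/-- Restore the preferences between nodes of the same block as residual matrix. -/
def restoreRow : Cmd :=
  forLoop 15 1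
    (.ite (.lt (.const 0) (.eq (.get 12 (.var 13)) (.get 12 (.var 15))))
      (.store 2 (.add (.get 5 (.var 13)) (.var 15)) (.entry 4 (.var 13) (.var 15)))
      (.store 2 (.add (.get 5 (.var 13)) (.var 15)) (.const 0)))

/-- Restore the preferences within blocks as residual matrix. -/
def restore : Cmd := forLoop 13 1 restoreRow

/-- The matrix cannot be reused: capping has merged the labels from `M` on, so pairs that the
bisection had separated become admissible again. The rows of items in array `4` are zero, so the new
flow starts empty. -/
lemma restore_spec {s : Store} (hL : Layout n s) :
    Ends u restore s (2 * n * (2 * n * 108 + 20) + 6) (fun s' =>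
      ∀ w < 2 * n, ∀ y < 2 * n, s'.mat (2 * n) 2 w y
        = if s.arr 12 w = s.arr 12 y then s.mat (2 * n) 4 w y else 0) := by
  refine (Ends.forLoop (B := 2 * n * 108 + 6) (fun k s' =>
      ∀ w < 2 * n, ∀ y < 2 * n, w < k → s'.mat (2 * n) 2 w y
        = if s.arr 12 w = s.arr 12 y then s.mat (2 * n) 4 w y else 0)
    hL.nodes (by simp) ?_ ?_).mono le_rfl ?_
  · intro k s' hk hf hsk hI
    have hL' := hL.frame hf
    refine (Ends.forRow (B := 100) hL' hk
      (fun y => if s.arr 12 k = s.arr 12 y then s.mat (2 * n) 4 k y else 0) ?_).mono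
      (by omega) ?_
    · intro y hy s₁ hf₁ hsy _
      have e13 : s₁.var 13 = k := (hf₁.var 13).trans hsk
      have e12 : s₁.arr 12 = s.arr 12 := (hf₁.arr 12).trans (hf.arr 12)
      have e4 : s₁.arr 4 = s.arr 4 := (hf₁.arr 4).trans (hf.arr 4)
      have e5 : s₁.arr 5 k = k * (2 * n) := (hL'.frame hf₁).offset k hk.le
      have e4' : s.arr 4 (k * (2 * n) + y) = s.mat (2 * n) 4 k y := rfl
      refine Ends.of_exec rfl ?_ (by decide)
      by_cases h : s.arr 12 k = s.arr 12 y
      · simp [Cmd.exec, Test.Holds, Exp.eval, Exp.eval_eq, Exp.entry, e13, hsy, e12, e5, e4, e4', h]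
      · simp [Cmd.exec, Test.Holds, Exp.eval, Exp.eval_eq, e13, hsy, e12, e5, h]
    · rintro s'' h w hw y hy hwk
      have := h w hw y hy
      change s''.mat (2 * n) 2 w y = _
      rw [this]
      by_cases h1 : w = k
      · rw [if_pos h1, h1]
      · rw [if_neg h1, hI w hw y hy (by omega)]
  · have : 2 * n * (2 * n * 108 + 6 + 8) ≤ 2 * n * (2 * n * 108 + 20) :=
      Nat.mul_le_mul_left _ (by omega)
    omega
  · rintro s' ⟨-, hI⟩ w hw y hy
    exact hI w hw y hy hw

end RAM

namespace RAM

variable {n : ℕ} {u : Fin n → Fin n → ℝ}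

/-! ### Exact flows in the blocks

Variable `17` is half of the current power of two; array `11` holds the open demands. -/

/-- Append the next bit of the number of agents in the block to the capacity of the agents. -/
def shiftAgents : Cmd :=
  forLoop 13 0
    (.ite (.lt (.get 15 (.var 13)) (.var 17))
      (.store 16 (.var 13) (.add (.get 16 (.var 13)) (.get 16 (.var 13))))
      (.seq (.store 15 (.var 13) (.sub (.get 15 (.var 13)) (.var 17)))
        (.store 16 (.var 13)
          (.add (.add (.get 16 (.var 13)) (.get 16 (.var 13))) (.get 14 (.var 13))))))

lemma shiftAgents_spec {s : Store} (hL : Layout n s) {P : ℕ} (hP : s.var 17 = P) :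
    Ends u shiftAgents s (n * 68 + 6) (fun s' =>
      (∀ w, s'.arr 15 w = if w < n ∧ ¬ s.arr 15 w < P then s.arr 15 w - P else s.arr 15 w) ∧
      ∀ i < n, s'.arr 16 i = 2 * s.arr 16 i + if s.arr 15 i < P then 0 else s.arr 14 i) := by
  refine (Ends.forLoop (B := 60) (fun k s' =>
      (∀ w, s'.arr 15 w = if w < k ∧ ¬ s.arr 15 w < P then s.arr 15 w - P else s.arr 15 w) ∧
      ∀ i, s'.arr 16 i = if i < k then 2 * s.arr 16 i + (if s.arr 15 i < P then 0 else s.arr 14 i)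
        else s.arr 16 i) hL.agents (by simp) ?_ (by omega)).mono le_rfl ?_
  · rintro k s' hk hf hsk ⟨h1, h2⟩
    have e14 : s'.arr 14 = s.arr 14 := hf.arr 14
    have e17 : s'.var 17 = P := (hf.var 17).trans hP
    have hk1 : s'.arr 15 k = s.arr 15 k := by
      rw [h1, if_neg (by omega)]
    have hk2 : s'.arr 16 k = s.arr 16 k := by
      rw [h2, if_neg (lt_irrefl _)]
    refine Ends.of_exec rfl ?_ (by decide)
    by_cases hlt : s.arr 15 k < P
    all_goals
      refine ⟨fun w => ?_, fun w => ?_⟩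
      all_goals
        have h1' := h1 w
        have h2' := h2 w
        by_cases hw : w = k
        · subst hw
          simp [Cmd.exec, Test.Holds, Exp.eval, hsk, e14, e17, hk1, hk2, hlt, two_mul]
        · have hwk : w < k + 1 ↔ w < k := by omega
          simp [Cmd.exec, Test.Holds, Exp.eval, hsk, e17, hk1, hlt, hw, hwk, h1', h2']
  · rintro s' ⟨-, h1, h2⟩
    refine ⟨h1, fun i hi => ?_⟩
    rw [h2, if_pos hi]

/-- Append the next bit of the number of agents in the block to the capacity of the items. -/
def shiftItems : Cmd :=
  forLoop 13 0
    (.ite (.lt (.get 15 (.add (.var 0) (.var 13))) (.var 17))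
      (.store 10 (.add (.var 0) (.var 13)) (.add (.get 10 (.add (.var 0) (.var 13)))
        (.get 10 (.add (.var 0) (.var 13)))))
      (.seq (.store 15 (.add (.var 0) (.var 13))
          (.sub (.get 15 (.add (.var 0) (.var 13))) (.var 17)))
        (.store 10 (.add (.var 0) (.var 13)) (.add (.add (.get 10 (.add (.var 0) (.var 13)))
          (.get 10 (.add (.var 0) (.var 13)))) (.const 1)))))

lemma shiftItems_spec {s : Store} (hL : Layout n s) {P : ℕ} (hP : s.var 17 = P) :
    Ends u shiftItems s (n * 88 + 6) (fun s' =>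
      (∀ w < 2 * n, s'.arr 15 w
        = if n ≤ w ∧ ¬ s.arr 15 w < P then s.arr 15 w - P else s.arr 15 w) ∧
      (∀ i < n, s'.arr 10 i = s.arr 10 i) ∧
      ∀ i < n, s'.arr 10 (n + i) = 2 * s.arr 10 (n + i)
        + if s.arr 15 (n + i) < P then 0 else 1) := by
  refine (Ends.forLoop (B := 80) (fun k s' =>
      (∀ w, s'.arr 15 w = if (n ≤ w ∧ w < n + k) ∧ ¬ s.arr 15 w < P then s.arr 15 w - P
        else s.arr 15 w) ∧
      ∀ w, s'.arr 10 w = if n ≤ w ∧ w < n + k then 2 * s.arr 10 w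
        + (if s.arr 15 w < P then 0 else 1) else s.arr 10 w) hL.agents ?_ ?_
      (by omega)).mono le_rfl ?_
  · have h : ∀ w, ¬ (n ≤ w ∧ w < n) := by omega
    simp [h]
  · rintro k s' hk hf hsk ⟨h1, h2⟩
    have e17 : s'.var 17 = P := (hf.var 17).trans hP
    have e0 : s'.var 0 = n := (hL.frame hf).agents
    have hk1 : s'.arr 15 (n + k) = s.arr 15 (n + k) := by
      rw [h1, if_neg (by omega)]
    have hk2 : s'.arr 10 (n + k) = s.arr 10 (n + k) := by
      rw [h2, if_neg (by omega)]
    refine Ends.of_exec rfl ?_ (by decide)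
    by_cases hlt : s.arr 15 (n + k) < P
    all_goals
      refine ⟨fun w => ?_, fun w => ?_⟩
      all_goals
        have h1' := h1 w
        have h2' := h2 w
        by_cases hw : w = n + k
        · subst hw
          simp [Cmd.exec, Test.Holds, Exp.eval, hsk, e17, e0, hk1, hk2, hlt, two_mul]
        · have hwk : w < n + (k + 1) ↔ w < n + k := by omega
          simp [Cmd.exec, Test.Holds, Exp.eval, hsk, e17, e0, hk1, hlt, hw, hwk, h1', h2']
  · rintro s' ⟨-, h1, h2⟩
    refine ⟨fun w hw => ?_, fun i hi => ?_, fun i hi => ?_⟩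
    · have : w < n + n := by omega
      simp only [h1, this, and_true]
    · rw [h2, if_neg (by omega)]
    · rw [h2, if_pos (by omega)]

/-- Append the next bit of the number of agents in the block to the capacities. -/
def shift : Cmd := .seq shiftAgents shiftItems

/-- Array `15` holds the part of the block size that has not been read; comparison with `P` extracts
its next bit. Items append the bit to their capacity, agents add the bit times the number of items
to their doubled remainder. -/
lemma shift_spec {s : Store} (hL : Layout n s) {P : ℕ} (hP : s.var 17 = P) :
    Ends u shift s (n * 156 + 12) (fun s' =>
      (∀ w < 2 * n, s'.arr 15 w = if s.arr 15 w < P then s.arr 15 w else s.arr 15 w - P) ∧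
      (∀ i < n, s'.arr 16 i = 2 * s.arr 16 i + if s.arr 15 i < P then 0 else s.arr 14 i) ∧
      (∀ i < n, s'.arr 10 i = s.arr 10 i) ∧
      (∀ i < n, s'.arr 10 (n + i) = 2 * s.arr 10 (n + i)
        + if s.arr 15 (n + i) < P then 0 else 1)) := by
  refine Ends.next (shiftAgents_spec hL hP) (T₂ := n * 88 + 6) (by omega) ?_
  rintro s₁ hf₁ ⟨h1, h2⟩
  refine (shiftItems_spec (hL.frame hf₁) ((hf₁.var 17).trans hP)).frame.mono le_rfl ?_
  rintro s₂ ⟨hf₂, h3, h4, h5⟩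
  have e10 : s₁.arr 10 = s.arr 10 := hf₁.arr 10
  have e16 : s₂.arr 16 = s₁.arr 16 := hf₂.arr 16
  refine ⟨fun w hw => ?_, fun i hi => ?_, fun i hi => ?_, fun i hi => ?_⟩
  · rw [h3 w hw, h1 w]
    by_cases hn : w < n
    · have : ¬ n ≤ w := by omega
      by_cases hlt : s.arr 15 w < P <;> simp [hn, this, hlt]
    · have : n ≤ w := by omega
      by_cases hlt : s.arr 15 w < P <;> simp [hn, this, hlt]
  · rw [e16, h2 i hi]
  · rw [h4 i hi, e10]
  · have : s₁.arr 15 (n + i) = s.arr 15 (n + i) := by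
      rw [h1, if_neg (by omega)]
    rw [h5 i hi, e10, this]

/-- Open one unit of demand for every agent whose remainder allows it. -/
def demand : Cmd :=
  forLoop 13 0
    (.ite (.lt (.get 16 (.var 13)) (.get 13 (.var 13)))
      (.store 11 (.var 13) (.const 0))
      (.seq (.store 16 (.var 13) (.sub (.get 16 (.var 13)) (.get 13 (.var 13))))
        (.store 11 (.var 13) (.const 1))))

lemma demand_spec {s : Store} (hL : Layout n s) :
    Ends u demand s (n * 48 + 6) (fun s' => ∀ i < n,
      s'.arr 11 i = (if s.arr 16 i < s.arr 13 i then 0 else 1) ∧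
      s'.arr 16 i = if s.arr 16 i < s.arr 13 i then s.arr 16 i
        else s.arr 16 i - s.arr 13 i) := by
  refine (Ends.forLoop (B := 40) (fun k s' => ∀ i,
      (i < k → s'.arr 11 i = if s.arr 16 i < s.arr 13 i then 0 else 1) ∧
      s'.arr 16 i = if i < k ∧ ¬ s.arr 16 i < s.arr 13 i then s.arr 16 i - s.arr 13 i
        else s.arr 16 i) hL.agents ?_ ?_ (by omega)).mono le_rfl ?_
  · simp
  · rintro k s' hk hf hsk hI
    have e13 : s'.arr 13 = s.arr 13 := hf.arr 13
    have hk1 : s'.arr 16 k = s.arr 16 k := by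
      rw [(hI k).2, if_neg (by omega)]
    refine Ends.of_exec rfl ?_ (by decide)
    intro i
    have hI' := hI i
    by_cases hi : i = k
    · subst hi
      by_cases hlt : s.arr 16 i < s.arr 13 i
      · simp [Cmd.exec, Test.Holds, Exp.eval, hsk, e13, hk1, hlt]
      · simp [Cmd.exec, Test.Holds, Exp.eval, hsk, e13, hk1, hlt]
    · have hik : i < k + 1 ↔ i < k := by omega
      by_cases hlt : s.arr 16 k < s.arr 13 k
      · simpa [Cmd.exec, Test.Holds, Exp.eval, hsk, e13, hk1, hlt, hi, hik] using hI'
      · simpa [Cmd.exec, Test.Holds, Exp.eval, hsk, e13, hk1, hlt, hi, hik] using hI'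
  · rintro s' ⟨-, hI⟩ i hi
    obtain ⟨h1, h2⟩ := hI i
    refine ⟨h1 hi, ?_⟩
    rw [h2]
    by_cases hlt : s.arr 16 i < s.arr 13 i <;> simp [hlt, hi]

/-- The flow in the store, together with the remainders, amounts to capacity `κ α` in the blocks
with label `α`. -/
structure Serving (D : Fin n → Finset (Fin n)) (M : ℕ) (κ : ℕ → ℕ) (s : Store) : Prop where
  layout : Layout n s
  blocks : EPS.Blocks D M (fun i => s.arr 12 i) (fun j => s.arr 12 (n + j))
    (EPS.blockSize M fun j : Fin n => s.arr 12 (n + j))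
    (EPS.blockSize M fun i : Fin n => s.arr 12 i)
  agents : ∀ w < 2 * n, s.arr 13 w = agentCount n M (s.arr 12) w
  items : ∀ w < 2 * n, s.arr 14 w = itemCount n M (s.arr 12) w
  zero : ∀ i < n, s.arr 10 i = 0
  capacity : ∀ i < n, s.arr 10 (n + i) = κ (s.arr 12 (n + i))
  flow : ∃ g : Fin n → Fin n → ℕ, Represents n (s.mat (2 * n) 2)
      (fun i j => j ∈ D i ∧ s.arr 12 i = s.arr 12 (n + j)) g ∧
    (∀ i j, 0 < g i j → j ∈ D i ∧ s.arr 12 i = s.arr 12 (n + j)) ∧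
    (∀ j : Fin n, ∑ i, g i j ≤ s.arr 10 (n + j)) ∧
    ∀ i : Fin n, (∑ j, g i j) * s.arr 13 i + s.arr 16 i = κ (s.arr 12 i) * s.arr 14 i

/-- Serve one unit of demand for every agent whose remainder allows it. -/
def serve : Cmd := .seq demand pass

/-- Demand is opened only where the remainder is at least the number of agents in the block, so no
total exceeds its share of the current capacity and `EPS.Blocks.not_marked` applies. As items are
marked only along with an agent who likes them, no mark is left at all and a second pass may follow
at once. -/
lemma serve_spec {D : Fin n → Finset (Fin n)} {M : ℕ} {κ : ℕ → ℕ} {s : Store}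
    (h : Serving D M κ s) (hmark : ∀ w < 2 * n, s.arr 9 w = 0) :
    Ends u serve s (n * (1200 * (2 * n * (2 * n)) + 76) + 12) (fun s' => Serving D M κ s' ∧
      (∀ w < 2 * n, s'.arr 9 w = 0) ∧
      ∀ i < n, s'.arr 16 i
        = if s.arr 16 i < s.arr 13 i then s.arr 16 i else s.arr 16 i - s.arr 13 i) := by
  have hL := h.layout
  refine Ends.next (demand_spec hL) (T₂ := n * (1200 * (2 * n * (2 * n)) + 28) + 6)
    (le_of_eq (by ring)) ?_
  intro s₁ hf₁ h₁
  have hL₁ := hL.frame hf₁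
  obtain ⟨g, hrep, hsupp, hcol, hrow⟩ := h.flow
  have emat : s₁.mat (2 * n) 2 = s.mat (2 * n) 2 := by
    funext w y
    rw [Store.mat, Store.mat, hf₁.arr 2]
  have e10 : s₁.arr 10 = s.arr 10 := hf₁.arr 10
  rw [← emat] at hrep
  rw [← e10] at hcol
  refine (pass_flow hL₁ hrep hsupp hcol (by rw [e10]; exact h.zero)
    (by rw [hf₁.arr 9]; exact hmark) ?_).frame.mono le_rfl ?_
  · intro i hi
    rw [(h₁ i hi).1]
    split_ifs <;> omega
  rintro s₂ ⟨hf₂, g', hrep', hP⟩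
  have f9 : ∀ i : Fin n, ¬ s₂.arr 9 i ≠ 0 := by
    refine h.blocks.not_marked κ hP (fun j => ?_) fun i => ?_
    · rw [e10, h.capacity j j.2]
    · have h1 := hrow i
      have h2 := (h₁ i i.2).1
      have h3 := h.agents i (by omega)
      have h4 := h.items i (by omega)
      simp only [agentCount, itemCount] at h3 h4
      rw [← h3, ← h4, ← h1, h2, add_mul]
      split_ifs <;> omega
  have e10' : s₂.arr 10 = s.arr 10 := (hf₂.arr 10).trans e10
  have e12 : s₂.arr 12 = s.arr 12 := (hf₂.arr 12).trans (hf₁.arr 12)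
  have e13 : s₂.arr 13 = s.arr 13 := (hf₂.arr 13).trans (hf₁.arr 13)
  have e14 : s₂.arr 14 = s.arr 14 := (hf₂.arr 14).trans (hf₁.arr 14)
  have e16 : s₂.arr 16 = s₁.arr 16 := hf₂.arr 16
  refine ⟨⟨hL₁.frame hf₂, ?_, ?_, ?_, ?_, ?_, g', ?_, ?_, ?_, ?_⟩, ?_, ?_⟩
  · rw [e12]
    exact h.blocks
  · rw [e12, e13]
    exact h.agents
  · rw [e12, e14]
    exact h.items
  · rw [e10']
    exact h.zero
  · rw [e10', e12]
    exact h.capacity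
  · rw [e12]
    exact hrep'
  · rw [e12]
    exact hP.supp
  · rw [e10', ← e10]
    exact hP.col_le
  · intro i
    have h1 := hP.row i
    have h2 := hP.satisfied i (f9 i)
    have h3 := hrow i
    obtain ⟨h4, h5⟩ := h₁ i i.2
    rw [e12, e13, e14, e16, ← h3, h5]
    rw [h2, add_zero] at h1
    rw [h1, h4, add_mul]
    split_ifs with h6
    · simp
    · rw [one_mul]
      omega
  · intro w hw
    by_contra h0
    by_cases hwn : w < n
    · exact f9 ⟨w, hwn⟩ h0
    · obtain ⟨j, rfl⟩ := exists_fin_of_node (not_lt.1 hwn) hw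
      obtain ⟨i, hi, -⟩ := hP.origin j h0
      exact f9 i hi
  · intro i hi
    rw [e16, (h₁ i hi).2]

/-- The flow in the store serves the number of agents in the blocks, divided by `P`. -/
structure Scaled (D : Fin n → Finset (Fin n)) (M P : ℕ) (s : Store) : Prop where
  serving : Serving D M (fun α => EPS.blockSize M (fun i : Fin n => s.arr 12 i) α / P) s
  bits : ∀ w < 2 * n, s.arr 15 w = s.arr 13 w % P
  rem_lt : ∀ i < n, s.arr 16 i < s.arr 13 i

/-- Proceed to the next bit. -/
def nextBit : Cmd :=
  .seq double (.seq clearMarks (.seq shift (.seq serve (.seq serve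
    (.assign 17 (.half (.var 17)))))))

/-- Going from `2 * P` to `P` moves one binary digit from the remainder to the quotient. -/
lemma div_mod_two_mul {q P : ℕ} (hP : 0 < P) :
    (q / P = 2 * (q / (2 * P)) + if q % (2 * P) < P then 0 else 1) ∧
    q % P = if q % (2 * P) < P then q % (2 * P) else q % (2 * P) - P := by
  have h1 := Nat.div_add_mod q (2 * P)
  have h2 := Nat.mod_lt q (show 0 < 2 * P by omega)
  refine (Nat.div_mod_unique hP).2 ?_
  split_ifs with h
  · refine ⟨?_, h⟩
    have : P * (2 * (q / (2 * P)) + 0) = 2 * P * (q / (2 * P)) := by ring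
    rw [this]
    omega
  · refine ⟨?_, by omega⟩
    have : P * (2 * (q / (2 * P)) + 1) = 2 * P * (q / (2 * P)) + P := by ring
    rw [this]
    omega

/-- For an agent with d units and remainder r in a block with q agents and p items, `d * q + r = κ *
p` becomes `2 * d * q + (2 * r + bit * p) = (2 * κ + bit) * p`. From r < q and p ≤ q the new
remainder is below 3q, so two passes, each lowering it by q if possible, bring it below q. -/
lemma nextBit_spec {D : Fin n → Finset (Fin n)} {M P : ℕ} {s : Store} (hn : 1 ≤ n) (hP : 0 < P)
    (h : Scaled D M (2 * P) s) (h17 : s.var 17 = P) :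
    Ends u nextBit s (20000 * n ^ 3) (fun s' => Scaled D M P s' ∧ s'.var 17 = P / 2) := by
  have c1 : n ≤ n ^ 3 := Nat.le_self_pow (by norm_num) n
  have c2 : n * n ≤ n ^ 3 := by
    rw [← pow_two]
    exact Nat.pow_le_pow_right hn (by norm_num)
  have c3 : 2 * n * (2 * n) = 4 * (n * n) := by ring
  have c4 : n * (1200 * (2 * n * (2 * n)) + 76) + 12 = 4800 * n ^ 3 + 76 * n + 12 := by ring
  have hS := h.serving
  have hL := hS.layout
  refine Ends.next (double_spec hL) (T₂ := 19900 * n ^ 3) (by omega) ?_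
  intro s₁ hf₁ h₁
  have hL₁ := hL.frame hf₁
  refine Ends.next (clearMarks_spec hL₁) (T₂ := 19800 * n ^ 3) (by omega) ?_
  intro s₂ hf₂ h₂
  have hL₂ := hL₁.frame hf₂
  have h17' : s₂.var 17 = P := by rw [hf₂.var 17, hf₁.var 17, h17]
  refine Ends.next (shift_spec hL₂ h17') (T₂ := 19600 * n ^ 3) (by omega) ?_
  rintro s₃ hf₃ ⟨h3a, h3b, h3c, h3d⟩
  have hL₃ := hL₂.frame hf₃
  have e10 : s₂.arr 10 = s.arr 10 := (hf₂.arr 10).trans (hf₁.arr 10)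
  have e12 : s₃.arr 12 = s.arr 12 := by rw [hf₃.arr 12, hf₂.arr 12, hf₁.arr 12]
  have e13 : s₃.arr 13 = s.arr 13 := by rw [hf₃.arr 13, hf₂.arr 13, hf₁.arr 13]
  have e14 : s₃.arr 14 = s.arr 14 := by rw [hf₃.arr 14, hf₂.arr 14, hf₁.arr 14]
  have e14' : s₂.arr 14 = s.arr 14 := by rw [hf₂.arr 14, hf₁.arr 14]
  have e15 : s₂.arr 15 = s.arr 15 := (hf₂.arr 15).trans (hf₁.arr 15)
  have e16 : s₂.arr 16 = s.arr 16 := (hf₂.arr 16).trans (hf₁.arr 16)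
  have hmat : ∀ w < 2 * n, ∀ y < 2 * n, s₃.mat (2 * n) 2 w y = 2 * s.mat (2 * n) 2 w y := by
    intro w hw y hy
    rw [← h₁ w hw y hy, Store.mat, Store.mat, hf₃.arr 2, hf₂.arr 2]
  rw [e15] at h3a h3b h3d
  rw [e16, e14'] at h3b
  rw [e10] at h3c h3d
  have hbits : ∀ w < 2 * n, s₃.arr 15 w = s.arr 13 w % P := by
    intro w hw
    rw [h3a w hw, h.bits w hw, (div_mod_two_mul hP).2]
  obtain ⟨g, hrep, hsupp, hcol, hrow⟩ := hS.flow
  have hS₃ : Serving D M (fun α => EPS.blockSize M (fun i : Fin n => s.arr 12 i) α / P) s₃ := by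
    refine ⟨hL₃, ?_, ?_, ?_, ?_, ?_, fun i j => 2 * g i j, ?_, ?_, ?_, ?_⟩
    · rw [e12]
      exact hS.blocks
    · rw [e12, e13]
      exact hS.agents
    · rw [e12, e14]
      exact hS.items
    · intro i hi
      rw [h3c i hi, hS.zero i hi]
    · intro i hi
      have h1 := hS.agents (n + i) (by omega)
      rw [agentCount] at h1
      rw [h3d i hi, hS.capacity i hi, h.bits _ (by omega), e12, ← h1]
      exact (div_mod_two_mul hP).1.symm
    · rw [e12]
      refine ⟨?_, ?_, ?_⟩
      · intro w hw x hx hwx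
        rw [hmat w hw x hx] at hwx
        exact hrep.bip w hw x hx (by omega)
      · intro i j
        rw [← hrep.edge i j, hmat i (by omega) _ (by omega)]
        omega
      · intro i j
        rw [← hrep.flow i j, hmat _ (by omega) i (by omega)]
    · rw [e12]
      exact fun i j hij => hsupp i j (Nat.pos_of_mul_pos_left hij)
    · intro j
      rw [h3d j j.2, ← Finset.mul_sum]
      have := hcol j
      omega
    · intro i
      have h1 := hS.agents i (by omega)
      rw [agentCount] at h1
      have h2 := hrow i
      rw [← h1] at h2
      rw [e12, e13, e14, ← Finset.mul_sum, h3b i i.2, ← h1, (div_mod_two_mul hP).1,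
        h.bits i (by omega), add_mul, mul_assoc, mul_assoc, ← h2]
      split_ifs <;> ring
  have hrem : ∀ i < n, s₃.arr 16 i < 3 * s.arr 13 i := by
    intro i hi
    have h1 := h.rem_lt i hi
    have h2 := hS.blocks.p_le_q ⟨i, hi⟩
    have h3 := hS.agents i (by omega)
    have h4 := hS.items i (by omega)
    simp only [agentCount, itemCount] at h3 h4
    rw [← h3, ← h4] at h2
    rw [h3b i hi]
    split_ifs <;> omega
  refine Ends.next (serve_spec hS₃ (by rw [hf₃.arr 9]; exact h₂)) (T₂ := 10000 * n ^ 3)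
    (by omega) ?_
  rintro s₄ hf₄ ⟨hS₄, h4m, h4r⟩
  have g12 : s₄.arr 12 = s.arr 12 := (hf₄.arr 12).trans e12
  have g13 : s₄.arr 13 = s.arr 13 := (hf₄.arr 13).trans e13
  refine Ends.next (serve_spec hS₄ h4m) (T₂ := 4) (by omega) ?_
  rintro s₅ hf₅ ⟨hS₅, -, h5r⟩
  have k12 : s₅.arr 12 = s.arr 12 := (hf₅.arr 12).trans g12
  have k13 : s₅.arr 13 = s.arr 13 := (hf₅.arr 13).trans g13
  have k17 : s₅.var 17 = P := by rw [hf₅.var 17, hf₄.var 17, hf₃.var 17, h17']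
  refine (Ends.of_exec (Q := fun s' => s' = s₅.setVar 17 (P / 2)) rfl ?_
    (by decide)).frame.mono le_rfl ?_
  · simp [Cmd.exec, Exp.eval, k17, Store.setVar]
  rintro s₆ ⟨hf₆, rfl⟩
  refine ⟨⟨?_, ?_, ?_⟩, by simp⟩
  · rw [Store.setVar_arr, k12]
    exact ⟨hS₅.layout.frame hf₆, hS₅.blocks, hS₅.agents, hS₅.items, hS₅.zero, hS₅.capacity,
      hS₅.flow⟩
  · intro w hw
    rw [Store.setVar_arr, k13, hf₅.arr 15, hf₄.arr 15]
    exact hbits w hw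
  · intro i hi
    have h1 := hrem i hi
    have h2 := h4r i hi
    have h3 := h5r i hi
    rw [e13] at h2
    rw [g13] at h3
    rw [Store.setVar_arr, k13, h3, h2]
    split_ifs <;> omega

/-- Proceed to the last bit. -/
def allBits : Cmd := .loop (.lt (.const 0) (.var 17)) nextBit

/-- Variable `17` is half of the current power of two, rounded down, so it vanishes exactly when
that power is 1. -/
lemma allBits_spec {D : Fin n → Finset (Fin n)} {M e : ℕ} {s : Store} (hn : 1 ≤ n)
    (h : Scaled D M (2 * 2 ^ e) s) (h17 : s.var 17 = 2 ^ e) :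
    Ends u allBits s ((e + 1) * (20000 * n ^ 3 + 4) + 4) (Scaled D M 1) := by
  refine (Ends.loopIdx (N := e + 1) (B := 20000 * n ^ 3)
    (fun k s' => Scaled D M (2 ^ k) s' ∧ s'.var 17 = 2 ^ k / 2) ⟨?_, ?_⟩ ?_ le_rfl).mono le_rfl ?_
  · rw [pow_succ, mul_comm]
    exact h
  · rw [h17, pow_succ]
    simp
  · rintro k s' - ⟨hS, hv⟩ hb
    have hb' : 0 < s'.var 17 := by simpa [Test.Holds, Exp.eval] using hb
    rcases k with _ | k
    · simp [hv] at hb'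
    · have e1 : 2 ^ (k + 1) = 2 * 2 ^ k := by ring
      rw [e1] at hS hv
      rw [Nat.mul_div_cancel_left _ two_pos] at hv
      exact (nextBit_spec hn (by positivity) hS hv).mono le_rfl fun s'' h'' =>
        ⟨k, Nat.lt_succ_self k, h''⟩
  · rintro s' ⟨⟨k, hS, hv⟩, hb⟩
    have hb' : s'.var 17 = 0 := by simpa [Test.Holds, Exp.eval] using hb
    rcases k with _ | k
    · simpa using hS
    · have e1 : 2 ^ (k + 1) = 2 * 2 ^ k := by ring
      rw [e1, Nat.mul_div_cancel_left _ two_pos, hb'] at hv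
      exact absurd hv.symm (by positivity)

end RAM

namespace RAM

variable {n : ℕ} {u : Fin n → Fin n → ℝ}

/-- Compute the blocks and an exact flow within the blocks. -/
def exactFlow : Cmd :=
  .seq narrow (.seq capLabels (.seq initNodes (.seq restore
    (.seq (.assign 17 (.var 16)) allBits))))

lemma blockSize_le {M : ℕ} (hM : n * n ≤ M) (hM0 : 0 < M) (a : Fin n → ℕ) (α : ℕ) :
    EPS.blockSize M a α ≤ M := by
  rw [EPS.blockSize]
  split_ifs
  · refine (Finset.card_le_univ _).trans ?_
    rw [Fintype.card_fin]
    exact (Nat.le_mul_self n).trans hM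
  · exact hM0

/-- Block sizes are at most `M`, so division by `2 * M` gives 0: zero flow, zero capacities and zero
remainders form a valid start, with all bits still to be read. Since `M = 2 ^ e` with `e = O(log
n)`, reading the bits takes as many rounds as the bisection, up to a constant factor. -/
lemma exactFlow_spec {D : Fin n → Finset (Fin n)} {s : Store} (hn : 1 ≤ n)
    (h : Bracketed D 1 s) (hpref : Represents n (s.mat (2 * n) 4) (fun i j => j ∈ D i) 0) :
    Ends u exactFlow s ((2 * Nat.log 2 n + 3) * (31000 * n ^ 3)) (fun s' => ∃ M,
      s'.var 16 = M ∧ Scaled D M 1 s') := by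
  have c1 : n ≤ n ^ 3 := Nat.le_self_pow (by norm_num) n
  have c2 : n * n ≤ n ^ 3 := by
    rw [← pow_two]
    exact Nat.pow_le_pow_right hn (by norm_num)
  set X := (2 * Nat.log 2 n + 3) * n ^ 3 with hX
  have c3 : 3 * n ^ 3 ≤ X := Nat.mul_le_mul_right _ (by omega)
  have c4 : 2 * Nat.log 2 n + 3 ≤ X := Nat.le_mul_of_pos_right _ (by positivity)
  have c5 : (2 * Nat.log 2 n + 3) * (31000 * n ^ 3) = 31000 * X := by rw [hX]; ring
  have c6 : (2 * Nat.log 2 n + 3) * (10000 * n ^ 3 + 6)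
      = 10000 * X + 6 * (2 * Nat.log 2 n + 3) := by rw [hX]; ring
  have c7 : (2 * Nat.log 2 n + 3) * (20000 * n ^ 3 + 4)
      = 20000 * X + 4 * (2 * Nat.log 2 n + 3) := by rw [hX]; ring
  have c8 : 2 * n * (n * 100 + 90) = 200 * (n * n) + 180 * n := by ring
  have c9 : 2 * n * (2 * n * 108 + 20) = 432 * (n * n) + 40 * n := by ring
  rw [c5]
  refine Ends.next (narrow_spec hn h) (T₂ := 20900 * X) (by omega) ?_
  rintro s₁ hf₁ ⟨e, he, hM, hL₁, hm₁, hz₁, g, -, hB⟩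
  set M := 2 ^ e with hMe
  have hM0 : 0 < M := by positivity
  refine Ends.next (capLabels_spec hL₁ hm₁) (T₂ := 20800 * X) (by omega) ?_
  rintro s₂ hf₂ ⟨h16, hlab⟩
  have hL₂ := hL₁.frame hf₂
  refine Ends.next (initNodes_spec hL₂ h16) (T₂ := 20500 * X) (by omega) ?_
  rintro s₃ hf₃ h₃
  have hL₃ := hL₂.frame hf₃
  refine Ends.next (restore_spec hL₃) (T₂ := 20200 * X) (by omega) ?_
  rintro s₄ hf₄ h₄
  have hL₄ := hL₃.frame hf₄
  have h16₄ : s₄.var 16 = M := by rw [hf₄.var 16, hf₃.var 16, h16]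
  refine Ends.next (T₁ := 2) (T₂ := 20100 * X) (P := fun s' => s' = s₄.setVar 17 M)
    (Ends.of_exec rfl (by simp [Cmd.exec, Exp.eval, h16₄, Store.setVar]) (by decide))
    (by omega) ?_
  rintro _ hf₅ rfl
  have e12 : s₃.arr 12 = s₂.arr 12 := hf₃.arr 12
  have e12' : s₄.arr 12 = s₂.arr 12 := (hf₄.arr 12).trans e12
  have e4 : ∀ w y, s₃.mat (2 * n) 4 w y = s.mat (2 * n) 4 w y := by
    intro w y
    rw [Store.mat, Store.mat, hf₃.arr 4, hf₂.arr 4, hf₁.arr 4]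
  have hblocks : EPS.Blocks D M (fun i => s₂.arr 12 i) (fun j => s₂.arr 12 (n + j))
      (EPS.blockSize M fun j : Fin n => s₂.arr 12 (n + j))
      (EPS.blockSize M fun i : Fin n => s₂.arr 12 i) := by
    have ha : (fun i : Fin n => s₂.arr 12 i) = fun i : Fin n => min (s₁.arr 12 i) M := by
      funext i
      exact hlab i (by omega)
    have hb : (fun j : Fin n => s₂.arr 12 (n + j)) = fun j : Fin n => min (s₁.arr 12 (n + j)) M := by
      funext j
      exact hlab _ (by omega)
    rw [ha, hb]
    exact hB.blocks hM hM0
  have hq : ∀ α, EPS.blockSize M (fun i : Fin n => s₂.arr 12 i) α < 2 * M := fun α =>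
    lt_of_le_of_lt (blockSize_le hM hM0 _ _) (by omega)
  have key : Scaled D M (2 * 2 ^ e) (s₄.setVar 17 M) := by
    rw [← hMe]
    refine ⟨⟨hL₄.frame hf₅, ?_, ?_, ?_, ?_, ?_, 0, ?_, ?_, ?_, ?_⟩, ?_, ?_⟩
    · rw [Store.setVar_arr, e12']
      exact hblocks
    · intro w hw
      rw [Store.setVar_arr, e12', hf₄.arr 13]
      exact (h₃ w hw).1
    · intro w hw
      rw [Store.setVar_arr, e12', hf₄.arr 14]
      exact (h₃ w hw).2.1
    · intro i hi
      rw [Store.setVar_arr, hf₄.arr 10]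
      exact (h₃ i (by omega)).2.2.2.2
    · intro i hi
      simp only [Store.setVar_arr, e12', hf₄.arr 10]
      rw [Nat.div_eq_of_lt (hq _)]
      exact (h₃ _ (by omega)).2.2.2.2
    · simp only [Store.setVar_arr, e12']
      rw [e12] at h₄
      have hmat : ∀ w < 2 * n, ∀ y < 2 * n, (s₄.setVar 17 M).mat (2 * n) 2 w y
          = if s₂.arr 12 w = s₂.arr 12 y then s.mat (2 * n) 4 w y else 0 := by
        intro w hw y hy
        rw [← e4, ← h₄ w hw y hy]
        rfl
      refine ⟨?_, ?_, ?_⟩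
      · intro w hw x hx hwx
        rw [hmat w hw x hx] at hwx
        split_ifs at hwx
        · exact hpref.bip w hw x hx hwx
        · omega
      · intro i j
        rw [hmat _ (by omega) _ (by omega), ← hpref.edge i j]
        split_ifs with h1 <;> simp [h1]
      · intro i j
        rw [hmat _ (by omega) _ (by omega), hpref.flow i j]
        simp
    · simp
    · simp
    · intro i
      simp only [Store.setVar_arr, e12', hf₄.arr 16]
      rw [Nat.div_eq_of_lt (hq _), (h₃ i (by omega)).2.2.2.1]
      simp
    · intro w hw
      simp only [Store.setVar_arr, hf₄.arr 15, hf₄.arr 13]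
      rw [(h₃ w hw).2.2.1, (h₃ w hw).1, agentCount, Nat.mod_eq_of_lt (hq _)]
    · intro i hi
      simp only [Store.setVar_arr, hf₄.arr 16, hf₄.arr 13]
      rw [(h₃ i (by omega)).2.2.2.1, (h₃ i (by omega)).1]
      exact hblocks.q_pos ⟨i, hi⟩
  have c10 : (e + 1) * (20000 * n ^ 3 + 4) ≤ (2 * Nat.log 2 n + 3) * (20000 * n ^ 3 + 4) :=
    Nat.mul_le_mul_right _ (by omega)
  refine (allBits_spec hn key (by simp [hMe])).frame.mono (by omega) ?_
  rintro s₆ ⟨hf₆, h₆⟩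
  refine ⟨M, ?_, h₆⟩
  rw [hf₆.var 16]
  simpa using h16₄

/-! ### Reading the preferences

Variable `12` is the best item found so far. -/

/-- Set up the layout of the matrices. -/
def initLayout : Cmd :=
  .seq (.assign 0 .size) (.seq (.assign 1 (.add .size .size))
    (.seq (forLoop 13 1 (.store 5 (.add (.var 13) (.const 1)) (.add (.get 5 (.var 13)) (.var 1))))
      (.assign 14 (.get 5 (.var 1)))))

/-- Row offsets are computed by repeated addition, as the machine does not multiply. The offset of
row `2 * n` is included: it is the number of entries, and augmentation writes to that row. -/
lemma initLayout_spec : Ends u initLayout Store.init (n * 40 + 30) (Layout n) := by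
  refine Ends.next (T₁ := 2) (T₂ := n * 40 + 20) (P := fun s' => s' = Store.init.setVar 0 n)
    (Ends.of_exec rfl (by simp [Cmd.exec, Exp.eval, Store.setVar]) (by decide)) (by omega) ?_
  rintro _ - rfl
  refine Ends.next (T₁ := 4) (T₂ := n * 40 + 10)
    (P := fun s' => s' = (Store.init.setVar 0 n).setVar 1 (2 * n))
    (Ends.of_exec rfl (by simp [Cmd.exec, Exp.eval, Store.setVar, two_mul]) (by decide))
    (by omega) ?_
  rintro _ - rfl
  refine Ends.next (Ends.forLoop (N := 2 * n) (B := 10) (fun k s' => ∀ w ≤ k,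
    s'.arr 5 w = w * (2 * n)) (by simp) ?_ ?_ le_rfl) (T₂ := 3) (by omega) ?_
  · intro w hw
    simp [Nat.le_zero.1 hw, Store.init]
  · intro k s' hk hf hsk hI
    have e1 : s'.var 1 = 2 * n := (hf.var 1).trans (by simp)
    refine Ends.of_exec rfl ?_ (by decide)
    intro w hw
    rcases Nat.le_succ_iff.1 hw with h | rfl
    · have : w ≠ k + 1 := by omega
      simp [Cmd.exec, Exp.eval, hsk, this, hI w h]
    · simp [Cmd.exec, Exp.eval, hsk, hI k le_rfl, e1]
      ring
  · rintro s₁ hf₁ ⟨-, h₁⟩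
    have e0 : s₁.var 0 = n := (hf₁.var 0).trans (by simp)
    have e1 : s₁.var 1 = 2 * n := (hf₁.var 1).trans (by simp)
    refine Ends.of_exec rfl ?_ (by decide)
    refine ⟨?_, ?_, ?_, ?_⟩
    · simp [Cmd.exec, e0]
    · simp [Cmd.exec, e1]
    · simp [Cmd.exec, Exp.eval, e1, h₁]
    · simpa [Cmd.exec] using h₁

/-- Find a best item of the agent in variable `13`. -/
def bestItem : Cmd :=
  .seq (.assign 12 (.const 0))
    (forLoop 15 0 (.ite (.utilLt (.var 13) (.var 12) (.var 13) (.var 15))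
      (.assign 12 (.var 15)) .skip))

lemma bestItem_spec {s : Store} (hL : Layout n s) (i : Fin n) (hi : s.var 13 = i) :
    Ends u bestItem s (n * 20 + 10) (fun s' => ∃ b : Fin n, s'.var 12 = b ∧
      ∀ k, u i k ≤ u i b) := by
  have hn : 0 < n := Nat.zero_lt_of_lt i.2
  refine Ends.next (T₁ := 2) (T₂ := n * 20 + 6) (P := fun s' => s' = s.setVar 12 0)
    (Ends.of_exec rfl (by simp [Cmd.exec, Exp.eval, Store.setVar]) (by decide)) (by omega) ?_
  rintro _ hf₁ rfl
  have hL₁ := hL.frame hf₁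
  refine (Ends.forLoop (B := 12) (fun l s' => ∃ b : Fin n, s'.var 12 = b ∧
    ∀ k : Fin n, k < l → u i k ≤ u i b) hL₁.agents ?_ ?_ le_rfl).mono le_rfl ?_
  · exact ⟨⟨0, hn⟩, by simp, fun k hk => absurd hk (Nat.not_lt_zero _)⟩
  · rintro l s' hl hf hsl ⟨b, hb, hI⟩
    have e13 : s'.var 13 = i := (hf.var 13).trans (by simpa using hi)
    have htest : (Test.utilLt (.var 13) (.var 12) (.var 13) (.var 15)).Holds u s'
        ↔ u i b < u i ⟨l, hl⟩ := by
      constructor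
      · rintro ⟨i', j', k', l', h1, h2, h3, h4, h5⟩
        simp only [Exp.eval, e13, hb, hsl] at h1 h2 h3 h4
        obtain rfl := Fin.ext h1
        obtain rfl := Fin.ext h2
        obtain rfl := Fin.ext h3
        obtain rfl : (⟨l, hl⟩ : Fin n) = l' := Fin.ext h4
        exact h5
      · exact fun h => ⟨i, b, i, ⟨l, hl⟩, e13, hb, e13, hsl, h⟩
    refine Ends.of_exec rfl ?_ (by decide)
    by_cases h : u i b < u i ⟨l, hl⟩
    · refine ⟨⟨l, hl⟩, ?_, fun k hk => ?_⟩
      · simp [Cmd.exec, htest, h, Exp.eval, hsl]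
      · rcases Nat.lt_succ_iff_lt_or_eq.1 hk with h' | h'
        · exact (hI k h').trans h.le
        · rw [show k = ⟨l, hl⟩ from Fin.ext h']
    · refine ⟨b, ?_, fun k hk => ?_⟩
      · simp [Cmd.exec, htest, h, hb]
      · rcases Nat.lt_succ_iff_lt_or_eq.1 hk with h' | h'
        · exact hI k h'
        · rw [show k = ⟨l, hl⟩ from Fin.ext h']
          exact not_lt.1 h
  · rintro s' ⟨-, b, hb, hI⟩
    exact ⟨b, hb, fun k => hI k k.2⟩

/-- Store the favourites of the agent in variable `13`, given one of them. -/
def prefRow : Cmd :=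
  forLoop 15 0 (.ite (.utilLt (.var 13) (.var 15) (.var 13) (.var 12)) .skip
    (.store 4 (.add (.get 5 (.var 13)) (.add (.var 0) (.var 15))) (.const 1)))

lemma prefRow_spec {s : Store} (hL : Layout n s) (i b : Fin n) (hi : s.var 13 = i)
    (hb : s.var 12 = b) :
    Ends u prefRow s (n * 30 + 6) (fun s' => ∀ w < 2 * n, ∀ y < 2 * n,
      0 < s'.mat (2 * n) 4 w y ↔ 0 < s.mat (2 * n) 4 w y ∨
        w = i ∧ ∃ j : Fin n, y = n + j ∧ u i b ≤ u i j) := by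
  refine (Ends.forLoop (B := 22) (fun l s' => ∀ w < 2 * n, ∀ y < 2 * n,
      0 < s'.mat (2 * n) 4 w y ↔ 0 < s.mat (2 * n) 4 w y ∨
        w = i ∧ ∃ j : Fin n, y = n + j ∧ j < l ∧ u i b ≤ u i j)
    hL.agents ?_ ?_ le_rfl).mono le_rfl ?_
  · intro w _ y _
    simp [Store.mat]
  · rintro l s' hl hf hsl hI
    have e13 : s'.var 13 = i := (hf.var 13).trans hi
    have e12 : s'.var 12 = b := (hf.var 12).trans hb
    have hL' := hL.frame hf
    have e0 : s'.var 0 = n := hL'.agents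
    have e5 : s'.arr 5 i = i * (2 * n) := hL'.offset i (by omega)
    have htest : (Test.utilLt (.var 13) (.var 15) (.var 13) (.var 12)).Holds u s'
        ↔ u i ⟨l, hl⟩ < u i b := by
      constructor
      · rintro ⟨i', j', k', l', h1, h2, h3, h4, h5⟩
        simp only [Exp.eval, e13, e12, hsl] at h1 h2 h3 h4
        obtain rfl := Fin.ext h1
        obtain rfl := Fin.ext h3
        obtain rfl := Fin.ext h4
        obtain rfl : (⟨l, hl⟩ : Fin n) = j' := Fin.ext h2
        exact h5
      · exact fun h => ⟨i, ⟨l, hl⟩, i, b, e13, hsl, e13, e12, h⟩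
    refine Ends.of_exec rfl ?_ (by decide)
    intro w hw y hy
    have hIw := hI w hw y hy
    by_cases h : u i ⟨l, hl⟩ < u i b
    · have e : ((Cmd.ite (.utilLt (.var 13) (.var 15) (.var 13) (.var 12)) .skip
          (.store 4 (.add (.get 5 (.var 13)) (.add (.var 0) (.var 15))) (.const 1))).exec u s')
          = s' := by
        simp [Cmd.exec, htest, h]
      rw [e]
      refine hIw.trans (or_congr_right (and_congr_right fun _ => ?_))
      refine exists_congr fun j => and_congr_right fun _ => ?_
      constructor
      · exact fun ⟨h1, h2⟩ => ⟨by omega, h2⟩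
      · rintro ⟨h1, h2⟩
        refine ⟨lt_of_le_of_ne (Nat.lt_succ_iff.1 h1) ?_, h2⟩
        rintro rfl
        exact absurd h (not_lt.2 h2)
    · have e : ((Cmd.ite (.utilLt (.var 13) (.var 15) (.var 13) (.var 12)) .skip
          (.store 4 (.add (.get 5 (.var 13)) (.add (.var 0) (.var 15))) (.const 1))).exec u s').arr
          4 = Function.update (s'.arr 4) (i * (2 * n) + (n + l)) 1 := by
        simp [Cmd.exec, htest, h, Exp.eval, e13, e5, e0, hsl]
      rw [Store.mat, Store.setVar_arr, e, update_index _ (by omega) hy, setEntry]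
      by_cases hc : w = i ∧ y = n + l
      · rw [if_pos hc]
        refine iff_of_true one_pos (Or.inr ⟨hc.1, ⟨l, hl⟩, hc.2, by simp, not_lt.1 h⟩)
      · rw [if_neg hc]
        refine hIw.trans (or_congr_right (and_congr_right fun hwi => ?_))
        refine exists_congr fun j => and_congr_right fun hyj => and_congr_left fun _ => ?_
        have : (j : ℕ) ≠ l := by
          rintro rfl
          exact hc ⟨hwi, hyj⟩
        omega
  · rintro s' ⟨-, hI⟩ w hw y hy
    rw [hI w hw y hy]
    simp

/-- Store the preferences. -/
def readPrefs : Cmd := forLoop 13 0 (.seq bestItem prefRow)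

/-- An item is a favourite exactly if it is not worse than one best item, so a linear number of
comparisons per agent suffices. -/
lemma readPrefs_spec {D : Fin n → Finset (Fin n)} (hD : ∀ i j, j ∈ D i ↔ ∀ k, u i k ≤ u i j)
    {s : Store} (hL : Layout n s) (h4 : ∀ x, s.arr 4 x = 0) :
    Ends u readPrefs s (n * (n * 50 + 30) + 6) (fun s' =>
      Represents n (s'.mat (2 * n) 4) (fun i j => j ∈ D i) 0) := by
  refine (Ends.forLoop (B := n * 50 + 20) (fun k s' => ∀ w < 2 * n, ∀ y < 2 * n,
      0 < s'.mat (2 * n) 4 w y ↔ ∃ i j : Fin n, i < k ∧ w = i ∧ y = n + j ∧ j ∈ D i)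
    hL.agents ?_ ?_ (by rw [Nat.mul_add, Nat.mul_add, Nat.mul_add]; omega)).mono le_rfl ?_
  · intro w _ y _
    simp [Store.mat, h4]
  · intro k s' hk hf hsk hI
    have hL' := hL.frame hf
    refine Ends.next (bestItem_spec hL' ⟨k, hk⟩ hsk) (T₂ := n * 30 + 6) (by omega) ?_
    rintro s₁ hf₁ ⟨b, hb, hbest⟩
    refine (prefRow_spec (hL'.frame hf₁) ⟨k, hk⟩ b ((hf₁.var 13).trans hsk) hb).mono le_rfl ?_
    intro s₂ h₂ w hw y hy
    have e4 : s₁.mat (2 * n) 4 w y = s'.mat (2 * n) 4 w y := by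
      rw [Store.mat, Store.mat, hf₁.arr 4]
    have hmem : ∀ j, u ⟨k, hk⟩ b ≤ u ⟨k, hk⟩ j ↔ j ∈ D ⟨k, hk⟩ := by
      intro j
      rw [hD]
      exact ⟨fun h l => (hbest l).trans h, fun h => h b⟩
    refine (h₂ w hw y hy).trans ?_
    rw [e4, hI w hw y hy]
    constructor
    · rintro (⟨i, j, h1, h2⟩ | ⟨hwk, j, h1, h2⟩)
      · exact ⟨i, j, by omega, h2⟩
      · exact ⟨⟨k, hk⟩, j, by simp, hwk, h1, (hmem j).1 h2⟩
    · rintro ⟨i, j, h1, h2, h3, h4⟩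
      rcases Nat.lt_succ_iff_lt_or_eq.1 h1 with h' | h'
      · exact Or.inl ⟨i, j, h', h2, h3, h4⟩
      · obtain rfl : i = ⟨k, hk⟩ := Fin.ext h'
        exact Or.inr ⟨h2, j, h3, (hmem j).2 h4⟩
  · rintro s' ⟨-, hI⟩
    refine ⟨?_, ?_, ?_⟩
    · intro w hw x hx hwx
      obtain ⟨i, j, -, rfl, rfl, -⟩ := (hI w hw x hx).1 hwx
      omega
    · intro i j
      rw [hI i (by omega) _ (by omega)]
      constructor
      · rintro ⟨i', j', -, h1, h2, h3⟩
        obtain rfl := Fin.ext h1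
        obtain rfl : j = j' := Fin.ext (by omega)
        exact h3
      · exact fun h => ⟨i, j, i.2, rfl, rfl, h⟩
    · intro i j
      have := hI (n + j) (by omega) i (by omega)
      by_contra h0
      obtain ⟨i', j', -, h1, -⟩ := this.1 (Nat.pos_of_ne_zero h0)
      omega

/-- Read the input. -/
def setup : Cmd :=
  .seq initLayout (.seq readPrefs (.seq (copyMatrix 4 2) (.assign 2 (.const 1))))

lemma setup_spec {D : Fin n → Finset (Fin n)} (hn : 1 ≤ n)
    (hD : ∀ i j, j ∈ D i ↔ ∀ k, u i k ≤ u i j) :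
    Ends u setup Store.init (1000 * n ^ 3) (fun s' => Bracketed D 1 s' ∧
      Represents n (s'.mat (2 * n) 4) (fun i j => j ∈ D i) 0) := by
  have c1 : n ≤ n ^ 3 := Nat.le_self_pow (by norm_num) n
  have c2 : n * n ≤ n ^ 3 := by
    rw [← pow_two]
    exact Nat.pow_le_pow_right hn (by norm_num)
  have c3 : 2 * n * (2 * n) = 4 * (n * n) := by ring
  have c4 : n * (n * 50 + 30) = 50 * (n * n) + 30 * n := by ring
  refine Ends.next initLayout_spec (T₂ := 900 * n ^ 3) (by omega) ?_
  intro s₁ hf₁ hL₁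
  refine Ends.next (readPrefs_spec hD hL₁ fun x => by rw [hf₁.arr 4]; rfl) (T₂ := 800 * n ^ 3)
    (by omega) ?_
  intro s₂ hf₂ h₂
  have hL₂ := hL₁.frame hf₂
  refine Ends.next (copyMatrix_spec hL₂ rfl) (T₂ := 2) (by omega) ?_
  intro s₃ hf₃ h₃
  have hL₃ := hL₂.frame hf₃
  have e4 : s₃.mat (2 * n) 4 = s₂.mat (2 * n) 4 := by
    funext w y
    rw [Store.mat, Store.mat, hf₃.arr 4]
  refine (Ends.of_exec (Q := fun s' => s' = s₃.setVar 2 1) rfl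
    (by simp [Cmd.exec, Exp.eval, Store.setVar]) (by decide)).frame.mono le_rfl ?_
  rintro _ ⟨hf₄, rfl⟩
  -- Capacities and labels have not been written; their initial value 0 is the one required.
  have e10 : s₃.arr 10 = fun _ => 0 := by rw [hf₃.arr 10, hf₂.arr 10, hf₁.arr 10]; rfl
  have e12 : s₃.arr 12 = fun _ => 0 := by rw [hf₃.arr 12, hf₂.arr 12, hf₁.arr 12]; rfl
  refine ⟨⟨hL₃.frame hf₄, by simp, by simp [e10], 0, ⟨?_, ?_, ?_⟩, ?_⟩, ?_⟩
  · intro w hw x hx hwx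
    exact h₂.bip w hw x hx (by rw [← h₃ w hw x hx]; exact hwx)
  · intro i j
    have := h₂.edge i j
    rw [← h₃ i (by omega) _ (by omega)] at this
    simp only [Store.setVar_arr, e12, and_true]
    exact this
  · intro i j
    have := h₂.flow i j
    rw [← h₃ _ (by omega) i (by omega)] at this
    exact this
  · rw [Store.setVar_arr, e12]
    exact EPS.Bracketing.init D
  · rw [← e4] at h₂
    exact h₂

end RAM

namespace RAM

variable {n : ℕ} {u : Fin n → Fin n → ℝ}

/-! ### Writing the output

Variables: `18` amount of an item in use, `20` number of free items, `21` denominator of the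
shares of the free items, `22` index of the next entry. Array `17` marks the free items. -/

/-- Is item `j` free, i.e. unused and outside of the bottleneck sets? -/
def Free (n M : ℕ) (s : Store) (j : ℕ) : Prop :=
  M ≤ s.arr 12 (n + j) ∧ ∑ i ∈ Finset.range n, s.mat (2 * n) 2 (n + j) i = 0

/-- Decide whether the item in variable `13` is free. -/
def freeItem : Cmd :=
  .seq (.assign 18 (.const 0))
    (.seq (forLoop 15 0 (.assign 18 (.add (.var 18) (.entry 2 (.add (.var 0) (.var 13)) (.var 15)))))
      (.ite (.lt (.add (.var 18) (.sub (.var 16) (.get 12 (.add (.var 0) (.var 13))))) (.const 1))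
        (.seq (.store 17 (.var 13) (.const 1)) (.assign 20 (.add (.var 20) (.const 1))))
        (.store 17 (.var 13) (.const 0))))

open Classical in
lemma freeItem_spec {s : Store} (hL : Layout n s) {M j : ℕ} (hM : s.var 16 = M) (hj : j < n)
    (hsj : s.var 13 = j) :
    Ends u freeItem s (n * 30 + 40) (fun s' =>
      s'.arr 17 = Function.update (s.arr 17) j (if Free n M s j then 1 else 0) ∧
      s'.var 20 = s.var 20 + if Free n M s j then 1 else 0) := by
  refine Ends.next (T₁ := 2) (T₂ := n * 30 + 38) (P := fun s' => s' = s.setVar 18 0)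
    (Ends.of_exec rfl (by simp [Cmd.exec, Exp.eval, Store.setVar]) (by decide)) (by omega) ?_
  rintro _ hf₁ rfl
  have hL₁ := hL.frame hf₁
  refine Ends.next (Ends.forLoop (B := 22) (fun k s' => s'.var 18
    = ∑ i ∈ Finset.range k, s.mat (2 * n) 2 (n + j) i) hL₁.agents (by simp) ?_ le_rfl)
    (T₂ := 30) (by omega) ?_
  · intro k s' hk hf hsk hI
    have e0 : s'.var 0 = n := (hL₁.frame hf).agents
    have e13 : s'.var 13 = j := (hf.var 13).trans (by simpa using hsj)
    have e5 : s'.arr 5 (n + j) = (n + j) * (2 * n) := (hL₁.frame hf).offset _ (by omega)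
    have e2 : s'.arr 2 = s.arr 2 := hf.arr 2
    refine Ends.of_exec rfl ?_ (by decide)
    rw [Finset.sum_range_succ, ← hI]
    simp [Cmd.exec, Exp.eval, Exp.entry, e0, e13, e5, e2, hsk, Store.mat]
  · rintro s₂ hf₂ ⟨-, h₂⟩
    have e0 : s₂.var 0 = n := (hL₁.frame hf₂).agents
    have e13 : s₂.var 13 = j := (hf₂.var 13).trans (by simpa using hsj)
    have e16 : s₂.var 16 = M := (hf₂.var 16).trans (by simpa using hM)
    have e12 : s₂.arr 12 = s.arr 12 := hf₂.arr 12
    have e17 : s₂.arr 17 = s.arr 17 := hf₂.arr 17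
    have e20 : s₂.var 20 = s.var 20 := (hf₂.var 20).trans (by simp)
    refine Ends.of_exec rfl ?_ (by decide)
    -- The amount in use plus the truncated difference of `M` and the label is below 1 exactly if
    -- both vanish.
    have htest : (Test.lt (.add (.var 18) (.sub (.var 16) (.get 12 (.add (.var 0) (.var 13)))))
        (.const 1)).Holds u s₂ ↔ Free n M s j := by
      simp only [Test.Holds, Exp.eval, h₂, e16, e12, e0, e13, Free]
      omega
    by_cases h : Free n M s j
    · simp [Cmd.exec, htest, h, Exp.eval, e13, e17, e20]
    · simp [Cmd.exec, htest, h, Exp.eval, e13, e17, e20]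

/-- Find the free items. -/
def freeItems : Cmd := .seq (.assign 20 (.const 0)) (forLoop 13 0 freeItem)

open Classical in
lemma freeItems_spec {s : Store} (hL : Layout n s) {M : ℕ} (hM : s.var 16 = M) :
    Ends u freeItems s (n * (n * 30 + 48) + 8) (fun s' =>
      (∀ j < n, s'.arr 17 j = if Free n M s j then 1 else 0) ∧
      s'.var 20 = (Finset.univ.filter fun j : Fin n => Free n M s j).card) := by
  refine Ends.next (T₁ := 2) (T₂ := n * (n * 30 + 48) + 6) (P := fun s' => s' = s.setVar 20 0)
    (Ends.of_exec rfl (by simp [Cmd.exec, Exp.eval, Store.setVar]) (by decide)) (by omega) ?_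
  rintro _ hf₁ rfl
  have hL₁ := hL.frame hf₁
  refine (Ends.forLoop (B := n * 30 + 40) (fun k s' =>
    (∀ j < k, s'.arr 17 j = if Free n M s j then 1 else 0) ∧
    s'.var 20 = ∑ j ∈ Finset.range k, if Free n M s j then 1 else 0) hL₁.agents (by simp) ?_
    le_rfl).mono le_rfl ?_
  · rintro k s' hk hf hsk ⟨h1, h2⟩
    have hL' := hL₁.frame hf
    have e16 : s'.var 16 = M := (hf.var 16).trans (by simpa using hM)
    have hfree : ∀ j, Free n M s' j ↔ Free n M s j := by
      intro j
      simp only [Free, Store.mat, hf.arr 12, hf.arr 2, Store.setVar_arr]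
    refine (freeItem_spec hL' e16 hk hsk).mono le_rfl ?_
    rintro s'' ⟨h3, h4⟩
    simp only [hfree] at h3 h4
    refine ⟨fun j hj => ?_, ?_⟩
    · rw [Store.setVar_arr, h3]
      rcases Nat.lt_succ_iff_lt_or_eq.1 hj with h' | rfl
      · simpa [h'.ne] using h1 j h'
      · simp
    · rw [Finset.sum_range_succ, ← h2, ← h4]
      simp
  · rintro s' ⟨-, h1, h2⟩
    refine ⟨h1, ?_⟩
    rw [h2, Finset.card_filter, Finset.sum_range]

/-- The numerators of the output. -/
def numerator (n M : ℕ) (s : Store) (i j : ℕ) : ℕ :=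
  if s.arr 12 i < M ∧ 0 < s.arr 17 j then s.arr 13 i - s.arr 14 i else s.mat (2 * n) 2 (n + j) i

/-- The denominators of the output. -/
def denominator (M : ℕ) (s : Store) (i j : ℕ) : ℕ :=
  if s.arr 12 i < M ∧ 0 < s.arr 17 j then s.arr 13 i * s.var 20 else s.arr 13 i

/-- Write an entry that is given by the flow. -/
def writeFlow : Cmd :=
  .seq (.store 0 (.var 22) (.entry 2 (.add (.var 0) (.var 15)) (.var 13)))
    (.store 1 (.var 22) (.get 13 (.var 13)))

/-- Write the entry of agent `13` and item `15`. -/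
def writeEntry : Cmd :=
  .seq (.ite (.lt (.get 12 (.var 13)) (.var 16))
    (.ite (.lt (.const 0) (.get 17 (.var 15)))
      (.seq (.store 0 (.var 22) (.sub (.get 13 (.var 13)) (.get 14 (.var 13))))
        (.store 1 (.var 22) (.var 21)))
      writeFlow)
    writeFlow) (.assign 22 (.add (.var 22) (.const 1)))

lemma writeEntry_spec {s : Store} (hL : Layout n s) {M i j x : ℕ} (hM : s.var 16 = M)
    (hj : j < n) (hsi : s.var 13 = i) (hsj : s.var 15 = j) (hx : s.var 22 = x)
    (h21 : s.var 21 = s.arr 13 i * s.var 20) :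
    Ends u writeEntry s 60 (fun s' =>
      s'.arr 0 = Function.update (s.arr 0) x (numerator n M s i j) ∧
      s'.arr 1 = Function.update (s.arr 1) x (denominator M s i j) ∧ s'.var 22 = x + 1) := by
  have e5 : s.arr 5 (n + j) = (n + j) * (2 * n) := hL.offset _ (by omega)
  have e0 := hL.agents
  refine Ends.of_exec rfl ?_ (by decide)
  by_cases h1 : s.arr 12 i < M
  · by_cases h2 : 0 < s.arr 17 j
    · simp [Cmd.exec, writeEntry, Test.Holds, Exp.eval, hM, hsi, hsj, hx, h1, h2, numerator, denominator, h21]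
    · simp [Cmd.exec, writeEntry, writeFlow, Test.Holds, Exp.eval, Exp.entry, hM, hsi, hsj, hx, h1, h2,
        numerator, denominator, e5, e0, Store.mat]
  · simp [Cmd.exec, writeEntry, writeFlow, Test.Holds, Exp.eval, Exp.entry, hM, hsi, hsj, hx, h1,
      numerator, denominator, e5, e0, Store.mat]

/-- Write the row of agent `13`. -/
def writeRow : Cmd :=
  .seq (.assign 21 (.const 0))
    (.seq (forLoop 15 20 (.assign 21 (.add (.var 21) (.get 13 (.var 13))))) (forLoop 15 0 writeEntry))

/-- The first `x` entries of the output have been written. -/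
def Written (n M : ℕ) (s s' : Store) (x : ℕ) : Prop :=
  s'.var 22 = x ∧ ∀ y < x, s'.arr 0 y = numerator n M s (y / n) (y % n) ∧
    s'.arr 1 y = denominator M s (y / n) (y % n)

/-- All values refer to the store `s₀` before any output. The denominator for the shares of free
items is a product; it is formed once per row by at most `n` additions. -/
lemma writeRow_spec {s s₀ : Store} (hL : Layout n s) {M i : ℕ} (hM : s.var 16 = M)
    (hsi : s.var 13 = i) (h20 : s.var 20 ≤ n)
    (hnum : ∀ j, numerator n M s i j = numerator n M s₀ i j)
    (hden : ∀ j, denominator M s i j = denominator M s₀ i j)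
    (hw : Written n M s₀ s (i * n)) :
    Ends u writeRow s (n * 90 + 14) (fun s' => Written n M s₀ s' ((i + 1) * n)) := by
  refine Ends.next (T₁ := 2) (T₂ := n * 90 + 12) (P := fun s' => s' = s.setVar 21 0)
    (Ends.of_exec rfl (by simp [Cmd.exec, Exp.eval, Store.setVar]) (by decide)) (by omega) ?_
  rintro _ hf₁ rfl
  have hL₁ := hL.frame hf₁
  refine Ends.next (Ends.forLoop (N := s.var 20) (B := 10) (fun k s' =>
    s'.var 21 = k * s.arr 13 i) (by simp) (by simp) ?_ le_rfl) (T₂ := n * 68 + 6) (by omega) ?_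
  · intro k s' hk hf hsk hI
    have e13 : s'.var 13 = i := (hf.var 13).trans (by simpa using hsi)
    have e13' : s'.arr 13 = s.arr 13 := hf.arr 13
    refine Ends.of_exec rfl ?_ (by decide)
    simp [Cmd.exec, Exp.eval, hI, e13, e13']
    ring
  rintro s₂ hf₂ ⟨-, h21⟩
  have hL₂ := hL₁.frame hf₂
  have v20 : s₂.var 20 = s.var 20 := (hf₂.var 20).trans (by simp)
  have v22 : s₂.var 22 = s.var 22 := (hf₂.var 22).trans (by simp)
  have v13 : s₂.var 13 = i := (hf₂.var 13).trans (by simpa using hsi)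
  have v16 : s₂.var 16 = M := (hf₂.var 16).trans (by simpa using hM)
  refine (Ends.forLoop (B := 60) (fun k s' => Written n M s₀ s' (i * n + k)) hL₂.agents ?_ ?_
    le_rfl).mono le_rfl ?_
  · refine ⟨?_, fun y hy => ?_⟩
    · simp [v22, hw.1]
    · have := hw.2 y hy
      rwa [Store.setVar_arr, hf₂.arr 0, hf₂.arr 1, Store.setVar_arr]
  · intro k s' hk hf hsk hI
    have hL' := hL₂.frame hf
    have e2 : s'.arr 2 = s.arr 2 := (hf.arr 2).trans (hf₂.arr 2)
    have e12 : s'.arr 12 = s.arr 12 := (hf.arr 12).trans (hf₂.arr 12)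
    have e13 : s'.arr 13 = s.arr 13 := (hf.arr 13).trans (hf₂.arr 13)
    have e14 : s'.arr 14 = s.arr 14 := (hf.arr 14).trans (hf₂.arr 14)
    have e17 : s'.arr 17 = s.arr 17 := (hf.arr 17).trans (hf₂.arr 17)
    have w20 : s'.var 20 = s.var 20 := (hf.var 20).trans v20
    refine (writeEntry_spec hL' ((hf.var 16).trans v16) hk ((hf.var 13).trans v13) hsk hI.1
      ?_).mono le_rfl ?_
    · rw [hf.var 21, h21, w20, e13, mul_comm]
    · rintro s'' ⟨h1, h2, h3⟩
      have hdiv : (i * n + k) / n = i ∧ (i * n + k) % n = k :=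
        (Nat.div_mod_unique (by omega)).2 ⟨by ring, hk⟩
      have hn1 : numerator n M s' i k = numerator n M s₀ i k := by
        rw [← hnum]
        simp only [numerator, Store.mat, e2, e12, e13, e14, e17]
      have hd1 : denominator M s' i k = denominator M s₀ i k := by
        rw [← hden]
        simp only [denominator, e12, e13, e17, w20]
      refine ⟨by simp [h3, add_assoc], fun y hy => ?_⟩
      rw [Store.setVar_arr, h1, h2, hn1, hd1]
      by_cases hyk : y = i * n + k
      · subst hyk
        rw [hdiv.1, hdiv.2]
        simp
      · rw [Function.update_of_ne hyk, Function.update_of_ne hyk]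
        exact hI.2 y (by omega)
  · rintro s' ⟨-, h⟩
    rwa [Nat.succ_mul]

/-- Write the output. -/
def writeOutput : Cmd := .seq (.assign 22 (.const 0)) (forLoop 13 0 writeRow)

lemma writeOutput_spec {s : Store} (hL : Layout n s) {M : ℕ} (hM : s.var 16 = M)
    (h20 : s.var 20 ≤ n) :
    Ends u writeOutput s (n * (n * 90 + 22) + 8) (fun s' => ∀ i < n, ∀ j < n,
      s'.arr 0 (i * n + j) = numerator n M s i j ∧
      s'.arr 1 (i * n + j) = denominator M s i j) := by
  refine Ends.next (T₁ := 2) (T₂ := n * (n * 90 + 22) + 6) (P := fun s' => s' = s.setVar 22 0)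
    (Ends.of_exec rfl (by simp [Cmd.exec, Exp.eval, Store.setVar]) (by decide)) (by omega) ?_
  rintro _ hf₁ rfl
  have hL₁ := hL.frame hf₁
  refine (Ends.forLoop (B := n * 90 + 14) (fun k s' => Written n M s s' (k * n)) hL₁.agents ?_ ?_
    le_rfl).mono le_rfl ?_
  · exact ⟨by simp, fun y hy => by omega⟩
  · intro k s' hk hf hsk hI
    have e2 : s'.arr 2 = s.arr 2 := hf.arr 2
    have e12 : s'.arr 12 = s.arr 12 := hf.arr 12
    have e13 : s'.arr 13 = s.arr 13 := hf.arr 13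
    have e14 : s'.arr 14 = s.arr 14 := hf.arr 14
    have e17 : s'.arr 17 = s.arr 17 := hf.arr 17
    have w20 : s'.var 20 = s.var 20 := (hf.var 20).trans (by simp)
    refine (writeRow_spec (hL₁.frame hf) ((hf.var 16).trans (by simpa using hM)) hsk
      (by rwa [w20]) (fun j => ?_) (fun j => ?_) hI).mono le_rfl ?_
    · simp only [numerator, Store.mat, e2, e12, e13, e14, e17]
    · simp only [denominator, e12, e13, e17, w20]
    · rintro s'' ⟨h1, h2⟩
      exact ⟨by simpa using h1, h2⟩
  · rintro s' ⟨-, -, h⟩ i hi j hj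
    have hdiv : (i * n + j) / n = i ∧ (i * n + j) % n = j :=
      (Nat.div_mod_unique (by omega)).2 ⟨by ring, hj⟩
    have := h (i * n + j) (by
      have : (i + 1) * n ≤ n * n := Nat.mul_le_mul_right _ hi
      rw [Nat.succ_mul] at this
      omega)
    rwa [hdiv.1, hdiv.2] at this

/-- At `P = 1` the capacity is the number q of agents itself, and `q * d + r = q * p` with r < q
forces r = 0 and d = p. -/
lemma Scaled.exists_flow {D : Fin n → Finset (Fin n)} {M : ℕ} {s : Store}
    (h : Scaled D M 1 s) : ∃ g : Fin n → Fin n → ℕ,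
      Represents n (s.mat (2 * n) 2) (fun i j => j ∈ D i ∧ s.arr 12 i = s.arr 12 (n + j)) g ∧
      (∀ i j, 0 < g i j → j ∈ D i ∧ s.arr 12 i = s.arr 12 (n + j)) ∧
      (∀ j : Fin n, ∑ i, g i j
        ≤ EPS.blockSize M (fun i : Fin n => s.arr 12 i) (s.arr 12 (n + j))) ∧
      ∀ i : Fin n, ∑ j, g i j = s.arr 14 i := by
  obtain ⟨g, hrep, hsupp, hcol, hrow⟩ := h.serving.flow
  refine ⟨g, hrep, hsupp, fun j => ?_, fun i => ?_⟩
  · have h1 := hcol j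
    rwa [h.serving.capacity j j.2, Nat.div_one] at h1
  · have h1 := hrow i
    have h2 := h.rem_lt i i.2
    have h3 := h.serving.agents i (by omega)
    rw [agentCount] at h3
    rw [Nat.div_one, ← h3, mul_comm _ (s.arr 13 i)] at h1
    have h4 : s.arr 16 i = 0 := by
      have h5 : s.arr 13 i ∣ s.arr 16 i :=
        (Nat.dvd_add_right (Dvd.intro _ rfl)).1 (h1 ▸ Dvd.intro _ rfl)
      exact Nat.eq_zero_of_dvd_of_lt h5 h2
    rw [h4, add_zero] at h1
    exact Nat.eq_of_mul_eq_mul_left (by omega) h1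

-- Division of the flow by the number of agents in the block yields the exact shares. In the top
-- block the divisor is 1 and the flow integral, so each item there is used completely or not at
-- all; the unused ones are the free items.
open Classical in
lemma Scaled.isOutcome {D : Fin n → Finset (Fin n)} {M : ℕ} {s : Store} (h : Scaled D M 1 s)
    (h17 : ∀ j < n, s.arr 17 j = if Free n M s j then 1 else 0)
    (h20 : s.var 20 = (Finset.univ.filter fun j : Fin n => Free n M s j).card) :
    (∀ i j : Fin n, denominator M s i j ≠ 0) ∧
    EPS.IsOutcome D fun i j => (numerator n M s i j : ℝ) / denominator M s i j := by
  obtain ⟨g, hrep, hsupp, hcol, hrow⟩ := h.exists_flow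
  have hB := h.serving.blocks
  set q := EPS.blockSize M fun i : Fin n => s.arr 12 i with hq
  set p := EPS.blockSize M fun j : Fin n => s.arr 12 (n + j) with hp
  have eq : ∀ i : Fin n, s.arr 13 i = q (s.arr 12 i) := fun i => h.serving.agents i (by omega)
  have ep : ∀ i : Fin n, s.arr 14 i = p (s.arr 12 i) := fun i => h.serving.items i (by omega)
  have hqpos := hB.q_pos
  set F := Finset.univ.filter fun j : Fin n => Free n M s j with hF
  have hmem : ∀ j : Fin n, 0 < s.arr 17 j ↔ j ∈ F := by
    intro j
    rw [h17 j j.2, hF]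
    simp only [Finset.mem_filter, Finset.mem_univ, true_and]
    split_ifs with h1 <;> simp [h1]
  have hfree : ∀ j, j ∈ F ↔ s.arr 12 (n + j) = M ∧ ∑ i, g i j = 0 := by
    intro j
    have h1 : ∑ i ∈ Finset.range n, s.mat (2 * n) 2 (n + j) i = ∑ i, g i j := by
      rw [Finset.sum_range]
      exact Finset.sum_congr rfl fun i _ => hrep.flow i j
    have h2 := hB.b_le j
    rw [hF, Finset.mem_filter, Free, h1]
    simp only [Finset.mem_univ, true_and]
    refine and_congr_left fun _ => ?_
    omega
  have hcolR : ∀ j : Fin n, ∑ i : Fin n, ((g i j : ℝ) / q (s.arr 12 i))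
      = ((∑ i, g i j : ℕ) : ℝ) / q (s.arr 12 (n + j)) := by
    intro j
    rw [Nat.cast_sum, Finset.sum_div]
    refine Finset.sum_congr rfl fun i _ => ?_
    rcases Nat.eq_zero_or_pos (g i j) with h0 | h0
    · simp [h0]
    · rw [(hsupp i j h0).2]
  refine ⟨fun i j => ?_, ?_⟩
  · have h1 := hqpos i
    simp only [denominator, hmem, eq]
    split_ifs with hc
    · rw [h20]
      exact Nat.mul_ne_zero h1.ne' (Finset.card_pos.2 ⟨j, hc.2⟩).ne'
    · exact h1.ne'
  · have key := hB.isOutcome (y := fun i j => (g i j : ℝ) / q (s.arr 12 i))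
      (fun i j => by positivity) ?_ ?_ ?_ F ?_ ?_
    · convert key using 3 with i j
      simp only [numerator, denominator, hmem, eq, ep, hrep.flow, h20]
      split_ifs <;> simp
    · intro i j hij
      refine hsupp i j (Nat.pos_of_ne_zero ?_)
      intro h0
      simp [h0] at hij
    · intro i
      rw [← Finset.sum_div, ← Nat.cast_sum, hrow, ep]
    · intro j
      rw [hcolR]
      exact div_le_one_of_le₀ (by exact_mod_cast hcol j) (Nat.cast_nonneg _)
    · intro j hj
      obtain ⟨h1, h2⟩ := (hfree j).1 hj
      refine ⟨h1, ?_⟩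
      rw [hcolR, h2]
      simp
    · intro j hj hjF
      have h1 := hcol j
      have h2 : ∑ i, g i j ≠ 0 := fun h0 => hjF ((hfree j).2 ⟨hj, h0⟩)
      rw [hj, hB.q_top] at h1
      have h3 : ∑ i, g i j = 1 := by omega
      rw [hcolR, h3, hj, hB.q_top]
      simp

/-- The EPS procedure for at least one agent. -/
def eps : Cmd := .seq setup (.seq exactFlow (.seq freeItems writeOutput))

lemma eps_spec {D : Fin n → Finset (Fin n)} (hn : 1 ≤ n)
    (hD : ∀ i j, j ∈ D i ↔ ∀ k, u i k ≤ u i j) :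
    Ends u eps Store.init ((2 * Nat.log 2 n + 4) * (31000 * n ^ 3)) (fun s' =>
      ∃ x, Outputs s' x ∧ EPS.IsOutcome D x) := by
  have c1 : n ≤ n ^ 3 := Nat.le_self_pow (by norm_num) n
  have c2 : n * n ≤ n ^ 3 := by
    rw [← pow_two]
    exact Nat.pow_le_pow_right hn (by norm_num)
  have c3 : (2 * Nat.log 2 n + 4) * (31000 * n ^ 3)
      = (2 * Nat.log 2 n + 3) * (31000 * n ^ 3) + 31000 * n ^ 3 := by ring
  have c4 : n * (n * 30 + 48) = 30 * (n * n) + 48 * n := by ring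
  have c5 : n * (n * 90 + 22) = 90 * (n * n) + 22 * n := by ring
  refine Ends.next (setup_spec hn hD)
    (T₂ := (2 * Nat.log 2 n + 3) * (31000 * n ^ 3) + 1000 * n ^ 3) (by omega) ?_
  rintro s₁ - ⟨hB, hpref⟩
  refine Ends.next (exactFlow_spec hn hB hpref) (T₂ := 1000 * n ^ 3) (by omega) ?_
  rintro s₂ - ⟨M, hM, hS⟩
  have hL := hS.serving.layout
  refine Ends.next (freeItems_spec hL hM) (T₂ := 900 * n ^ 3) (by omega) ?_
  rintro s₃ hf₃ ⟨h17, h20⟩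
  have hL₃ := hL.frame hf₃
  have hfree : Free n M s₃ = Free n M s₂ := by
    funext j
    simp only [Free, Store.mat, hf₃.arr 12, hf₃.arr 2]
  have hS₃ : Scaled D M 1 s₃ := by
    have hS' := hS.serving
    refine ⟨⟨hL₃, ?_, ?_, ?_, ?_, ?_, ?_⟩, ?_, ?_⟩
    · rw [hf₃.arr 12]; exact hS'.blocks
    · rw [hf₃.arr 12, hf₃.arr 13]; exact hS'.agents
    · rw [hf₃.arr 12, hf₃.arr 14]; exact hS'.items
    · rw [hf₃.arr 10]; exact hS'.zero
    · rw [hf₃.arr 10, hf₃.arr 12]; exact hS'.capacity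
    · have emat : s₃.mat (2 * n) 2 = s₂.mat (2 * n) 2 := by
        funext w y
        rw [Store.mat, Store.mat, hf₃.arr 2]
      rw [hf₃.arr 10, hf₃.arr 12, hf₃.arr 13, hf₃.arr 14, hf₃.arr 16, emat]
      exact hS'.flow
    · rw [hf₃.arr 15, hf₃.arr 13]; exact hS.bits
    · rw [hf₃.arr 16, hf₃.arr 13]; exact hS.rem_lt
  rw [← hfree] at h17 h20
  obtain ⟨h1, h2⟩ := hS₃.isOutcome h17 h20
  refine (writeOutput_spec hL₃ ((hf₃.var 16).trans hM) ?_).mono (by omega) ?_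
  · rw [h20]
    exact (Finset.card_le_univ _).trans_eq (Fintype.card_fin n)
  · intro s₄ h₄
    refine ⟨_, fun i j => ?_, h2⟩
    obtain ⟨h5, h6⟩ := h₄ i i.2 j j.2
    rw [h5, h6]
    exact ⟨h1 i j, rfl⟩

end RAM

/-! ### The time bound and the conclusion. -/

-- From `log 2 > 1/2` one gets `Nat.log 2 n ≤ 2 * log n` and, for `n ≥ 2`, `4 ≤ 8 * log n`; hence
-- the factor `12 * log n` in `h7`.
open Filter in
lemma isBigO_log_mul_pow :
    (fun n : ℕ => (((2 * Nat.log 2 n + 4) * (31000 * n ^ 3) + 10 : ℕ) : ℝ))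
      =O[atTop] fun n : ℕ => (n : ℝ) ^ 3 * Real.log n := by
  refine Asymptotics.IsBigO.of_bound 1000000 ?_
  filter_upwards [eventually_ge_atTop 2] with n hn
  have hn' : (2 : ℝ) ≤ n := by exact_mod_cast hn
  have h2 : (0.5 : ℝ) < Real.log 2 := lt_trans (by norm_num) Real.log_two_gt_d9
  have h3 : Real.log 2 ≤ Real.log n := Real.log_le_log two_pos hn'
  have h4 : (Nat.log 2 n : ℝ) * Real.log 2 ≤ Real.log n := by
    rw [← Real.log_pow]
    refine Real.log_le_log (by positivity) ?_
    exact_mod_cast Nat.pow_log_le_self 2 (by omega)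
  have h5 : (Nat.log 2 n : ℝ) ≤ 2 * Real.log n := by
    have : (0 : ℝ) ≤ Nat.log 2 n := Nat.cast_nonneg _
    nlinarith
  have h6 : (1 : ℝ) ≤ (n : ℝ) ^ 3 := one_le_pow₀ (by linarith)
  rw [Real.norm_of_nonneg (Nat.cast_nonneg _),
    Real.norm_of_nonneg (mul_nonneg (by positivity) (by linarith))]
  push_cast
  have h7 : (2 * (Nat.log 2 n : ℝ) + 4) * (31000 * (n : ℝ) ^ 3)
      ≤ (12 * Real.log n) * (31000 * (n : ℝ) ^ 3) :=
    mul_le_mul_of_nonneg_right (by linarith) (by positivity)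
  have h8 : Real.log n ≤ (n : ℝ) ^ 3 * Real.log n :=
    le_mul_of_one_le_left (by linarith) h6
  linarith

theorem mainTheorem8 :
    (∀ (n : ℕ) (P : AssignmentProblem n), P.IsBivalued →
      ∀ x : Fin n → Fin n → ℝ, EPS.IsOutcome P.favorites x → P.IsHZSolution x) ∧
    ∃ (c : RAM.Cmd) (T : ℕ → ℕ),
      (fun n : ℕ => (T n : ℝ)) =O[Filter.atTop] (fun n : ℕ => (n : ℝ) ^ 3 * Real.log n) ∧
      ∀ (n : ℕ) (P : AssignmentProblem n), P.IsBivalued →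
        ∃ (t : ℕ) (s : RAM.Store) (x : Fin n → Fin n → ℝ),
          RAM.Run P.u c RAM.Store.init t s ∧ t ≤ T n ∧ RAM.Outputs s x ∧
          EPS.IsOutcome P.favorites x ∧ P.IsHZSolution x := by
  refine ⟨fun n P hP x hx => hP.isHZSolution_of_isOutcome hx,
    .ite (.lt (.const 0) .size) RAM.eps .skip, _, isBigO_log_mul_pow, ?_⟩
  intro n P hP
  obtain ⟨t, s, hr, ht, x, hx, ho⟩ : RAM.Ends P.u (.ite (.lt (.const 0) .size) RAM.eps .skip)
      RAM.Store.init ((2 * Nat.log 2 n + 4) * (31000 * n ^ 3) + 10)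
      (fun s' => ∃ x, RAM.Outputs s' x ∧ EPS.IsOutcome P.favorites x) := by
    -- `RAM.eps_spec` requires at least one agent. The outer test catches the empty problem, for
    -- which every condition on outcomes is void; its cost is covered by the summand 10.
    refine RAM.Ends.ite (T := (2 * Nat.log 2 n + 4) * (31000 * n ^ 3) + 1) (fun hn => ?_)
      (fun hn => ?_) (by simp only [RAM.Test.cost, RAM.Exp.cost]; omega)
    · exact (RAM.eps_spec (n := n) hn fun i j => by simp [AssignmentProblem.favorites]).mono
        (Nat.le_succ _) fun _ h => h
    · obtain rfl : n = 0 := by simpa [RAM.Test.Holds, RAM.Exp.eval] using hn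
      refine RAM.Ends.of_exec rfl ?_ (by simp [RAM.Cmd.maxCost])
      exact ⟨0, fun i => i.elim0, ⟨Finset.univ, Finset.univ, 0⟩, .refl, by simp, 0, by simp,
        by simp, by simp, fun i => i.elim0, fun i => i.elim0, fun i => i.elim0⟩
  exact ⟨t, s, x, hr, ht, hx, ho, hP.isHZSolution_of_isOutcome ho⟩
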